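/- **Setting.** Let $\Pi$ be a finite nonempty set of decisions, $O$ a measurable space of observations with a base measure $\nu$, and $R:O\to\mathbb R$ a known measurable reward. An instance $f$ assigns to each $\pi\in\Pi$ a probability density $f[\pi]$ on $O$ with respect to $\nu$. Let $\mathcal F$ be a (possibly infinite) class of instances such that, for all $f\in\mathcal F$, $\pi\in\Pi$: $\sup_o f[\pi](o)<\infty$; $0\le R(o)\le R_{\max}$ for $f[\pi]$-almost every $o$; and $R_f(\pi)=\mathbb E_{o\sim f[\pi]}[R(o)]$ has a unique maximizer $\pi^\star(f)$. Put $\Delta(f,\pi)=R_f(\pi^\star(f))-R_f(\pi)$. In round $t$ a learner picks $\pi_t$ from the past observations and sees $o_t\sim f^\star[\pi_t]$; $\mathrm{Reg}_{f^\star,n}=\mathbb E_{f^\star}\big[\sum_{t=1}^n\Delta(f^\star,\pi_t)\big]$. For $B\ge 0$ let $$\mathcal C(f,B)=\inf\Big\{\sum_\pi w_\pi\Delta(f,\pi)\;:\;0\le w_\pi\le B,\ \sum_\pi w_\pi D_{\rm KL}(f[\pi]\|g[\pi])\ge 1\ \ \forall g\in\mathcal F,\ \pi^\star(g)\ne\pi^\star(f)\Big\}$$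 (with $0\cdot\infty=0$ and $\inf\emptyset=\infty$), and $\mathcal C(f)=\lim_{n\to\infty}\mathcal C(f,n)$. For $\zeta\in(0,1)$ let $D_\zeta(p\|q)=\frac1{\zeta-1}\ln\int p^\zeta q^{1-\zeta}\,d\nu$. **Conditions.** 1. There are constants $c_1,c_2,c_3>0$ and a function $\iota:\mathcal F\to(0,\infty)$ such that for all $\alpha>0$, $\epsilon>0$, $f\in\mathcal F$ there is $\lambda_0(\alpha,\epsilon,f)>0$ with $\lambda_0(\alpha,\epsilon,f)\ge\epsilon^{c_1}\min\{1/\alpha,c_2\}^{c_3}\iota(f)$ and, for all $\lambda\in(0,1)$ with $\lambda\le\lambda_0(\alpha,\epsilon,f)$, all $g\in\mathcal F$ and $\pi\in\Pi$: $D_{1-\lambda}(f[\pi]\|g[\pi])\ge\min\{D_{\rm KL}(f[\pi]\|g[\pi])-\epsilon,\alpha\}$. 2. $\nu(O)<\infty$, and, with $\mathcal N(\mathcal F,\epsilon)$ the proper covering number of $\mathcal F$ for the distance $d(f,g)=\sup_{\pi,o}|f[\pi](o)-g[\pi](o)|$, $\mathcal N(\mathcal F,\epsilon)$ is finite and $\ln\mathcal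 N(\mathcal F,\epsilon)=O(\ln(1/\epsilon))$ as $\epsilon\downarrow0$. 3. (For the true instance $f^\star\in\mathcal F$.) There is $c_{\min}>0$ such that $f^\star[\pi](o)>c_{\min}$ whenever $f^\star[\pi](o)\neq0$; and there are $\iota',c_5>0$ such that for all $f\in\mathcal F$, $\pi\in\Pi$ with $D_{\rm KL}(f^\star[\pi]\|f[\pi])\le1$ one has $\sup_o|f^\star[\pi](o)-f[\pi](o)|\le\iota' D_{\rm KL}(f^\star[\pi]\|f[\pi])^{c_5}$. **Algorithm Test-to-Commit (horizon $n$).** Let $b_n=(\ln\ln n)^{1/4}$. *Step 1:* play every decision $\lceil\ln n/\ln\ln n\rceil$ times and let $\hat f\in\mathcal F$ maximize the log-likelihood of the observations over $\mathcal F$. *Step 2:* let $\hat w$ be a solution of the program defining $\mathcal C(\hat f,b_n)$ and play every $\pi$ exactly $\lceil((1+1/b_n)\hat w_\pi+1/b_n)\ln n\rceil$ times. Accept $\hat f$ if the decisions and observations $(\pi_i,o_i)$ of this step satisfy $\sum_i\ln\frac{\hat f[\pi_i](o_i)}{g[\pi_i](o_i)}\ge\ln n$ for all $g\in\mathcal F$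 with $\pi^\star(g)\ne\pi^\star(\hat f)$. *Step 3:* in the remaining rounds play $\pi^\star(\hat f)$ if $\hat f$ was accepted; otherwise run UCB from scratch, always playing a decision $\pi$ with maximal index $\hat\mu_\pi+R_{\max}\sqrt{2\ln(n^2)/T_\pi}$, where $T_\pi$ and $\hat\mu_\pi$ are the number of plays and the average reward of $\pi$ in this step (index $\infty$ if $T_\pi=0$). Ties are broken arbitrarily (measurably). Since maximizers and minimizers need not exist, it is only required that $\hat f$ maximizes the log-likelihood up to $\tau_n$, and that $\hat w\in[0,b_n]^\Pi$ is feasible and optimal up to $\tau_n$ whenever the program is feasible, where $\tau_n\ge0$, $\tau_n\to0$ ($\tau_n=0$ being the exact algorithm). **Theorem.** If Conditions 1–3 hold, then for every such implementation of Test-to-Commit $$\limsup_{n\to\infty}\frac{\mathrm{Reg}_{f^\star,n}}{\ln n}\le\mathcal C(f^\star).$$ -/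

import Mathlib

open MeasureTheory Filter Topology InformationTheory
open scoped ENNReal NNReal

noncomputable section

namespace T2C

/-- An instance: it assigns to every decision `π` a density `f π` on the observation space,
with respect to a fixed base measure. -/
abbrev Inst (D O : Type*) := D → O → ℝ≥0

variable {D O : Type*} [Fintype D] [Nonempty D] [MeasurableSpace O]

/-! ### Interactive decision making problems -/

/-- The distribution over observations of decision `π` under instance `f`. -/
def law (ν : Measure O) (f : Inst D O) (π : D) : Measure O :=
  ν.withDensity fun o => (f π o : ℝ≥0∞)

/-- Expected reward of decision `π` under instance `f`. -/
def meanReward (ν : Measure O) (R : O → ℝ) (f : Inst D O) (π : D) : ℝ :=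
  ∫ o, R o ∂(law ν f π)

/-- An optimal decision of instance `f` (the optimal decision, when it is unique). -/
def best (ν : Measure O) (R : O → ℝ) (f : Inst D O) : D :=
  Classical.choose (Finite.exists_max (meanReward ν R f))

/-- The sub-optimality gap `Δ(f, π)`. -/
def gap (ν : Measure O) (R : O → ℝ) (f : Inst D O) (π : D) : ℝ :=
  meanReward ν R f (best ν R f) - meanReward ν R f π

/-- The standing assumptions on the base measure, the reward and the hypothesis class. -/
structure IsDecisionProblem (ν : Measure O) (R : O → ℝ) (Rmax : ℝ) (F : Set (Inst D O)) :
    Prop where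
  measurable_reward : Measurable R
  measurable_density : ∀ f ∈ F, ∀ π, Measurable (f π)
  lintegral_density : ∀ f ∈ F, ∀ π, ∫⁻ o, (f π o : ℝ≥0∞) ∂ν = 1
  bounded_density : ∀ f ∈ F, ∀ π, BddAbove (Set.range (f π))
  bounded_reward : ∀ f ∈ F, ∀ π, ∀ᵐ o ∂(law ν f π), 0 ≤ R o ∧ R o ≤ Rmax
  unique_optimal : ∀ f ∈ F, ∃! π, ∀ π', meanReward ν R f π' ≤ meanReward ν R f π

/-! ### The complexity measure -/

/-- KL divergence between the observation distributions of `π` under `f` and `g`. -/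
def kl (ν : Measure O) (f g : Inst D O) (π : D) : ℝ≥0∞ :=
  klDiv (law ν f π) (law ν g π)

/-- The feasible set of the program defining `C(f, B)`. -/
def Feasible (ν : Measure O) (R : O → ℝ) (F : Set (Inst D O)) (f : Inst D O) (B : ℝ)
    (w : D → ℝ≥0) : Prop :=
  (∀ g ∈ F, best ν R g ≠ best ν R f → 1 ≤ ∑ π, (w π : ℝ≥0∞) * kl ν f g π) ∧
    ∀ π, (w π : ℝ) ≤ B

/-- The objective of the program defining `C(f, B)`. -/
def cost (ν : Measure O) (R : O → ℝ) (f : Inst D O) (w : D → ℝ≥0) : ℝ≥0∞ :=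
  ∑ π, (w π : ℝ≥0∞) * ENNReal.ofReal (gap ν R f π)

/-- The value `C(f, B)`; it is `∞` if the program is infeasible. -/
def complexityAt (ν : Measure O) (R : O → ℝ) (F : Set (Inst D O)) (f : Inst D O) (B : ℝ) :
    ℝ≥0∞ :=
  ⨅ (w : D → ℝ≥0) (_ : Feasible ν R F f B w), cost ν R f w

/-- The asymptotic complexity `C(f) = lim C(f, n)`. -/
def complexity (ν : Measure O) (R : O → ℝ) (F : Set (Inst D O)) (f : Inst D O) : ℝ≥0∞ :=
  limUnder atTop fun k : ℕ => complexityAt ν R F f k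

theorem complexityAt_antitone (ν : Measure O) (R : O → ℝ) (F : Set (Inst D O))
    (f : Inst D O) : Antitone (complexityAt ν R F f) := fun _ _ h =>
  le_iInf₂ fun w hw => iInf₂_le w ⟨hw.1, fun π => (hw.2 π).trans h⟩

/-- The limit defining `C(f)` always exists. -/
theorem tendsto_complexity (ν : Measure O) (R : O → ℝ) (F : Set (Inst D O))
    (f : Inst D O) :
    Tendsto (fun k : ℕ => complexityAt ν R F f k) atTop (𝓝 (complexity ν R F f)) := by
  have h : Tendsto (fun k : ℕ => complexityAt ν R F f k) atTop
      (𝓝 (⨅ k : ℕ, complexityAt ν R F f k)) :=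
    tendsto_atTop_iInf fun _ _ hab =>
      complexityAt_antitone ν R F f (Nat.cast_le.mpr hab)
  exact tendsto_nhds_limUnder ⟨_, h⟩

/-! ### The three conditions -/

/-- The Rényi divergence of order `ζ ∈ (0, 1)` between two densities; it is `⊤` when the
densities are mutually singular. -/
def renyi (ν : Measure O) (ζ : ℝ) (p q : O → ℝ≥0) : EReal :=
  ((1 / (ζ - 1) : ℝ) : EReal) *
    ENNReal.log (∫⁻ x, (p x : ℝ≥0∞) ^ ζ * (q x : ℝ≥0∞) ^ (1 - ζ) ∂ν)

/-- Uniform convergence of the Rényi divergences to the KL divergence. -/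
def RenyiUniformConvergence (ν : Measure O) (F : Set (Inst D O)) : Prop :=
  ∃ (c₁ c₂ c₃ : ℝ) (ι : Inst D O → ℝ) (lam₀ : ℝ → ℝ → Inst D O → ℝ),
    0 < c₁ ∧ 0 < c₂ ∧ 0 < c₃ ∧ (∀ f ∈ F, 0 < ι f) ∧
    ∀ α > 0, ∀ ε > 0, ∀ f ∈ F,
      0 < lam₀ α ε f ∧
      ε ^ c₁ * min (1 / α) c₂ ^ c₃ * ι f ≤ lam₀ α ε f ∧
      ∀ lam : ℝ, 0 < lam → lam < 1 → lam ≤ lam₀ α ε f → ∀ g ∈ F, ∀ π,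
        min ((kl ν f g π : EReal) - (ε : EReal)) (α : EReal) ≤
          renyi ν (1 - lam) (f π) (g π)

/-- The sup-distance `sup_o |p(o) - q(o)|` of two densities. -/
def densityDist (p q : O → ℝ≥0) : ℝ≥0∞ := ⨆ o, edist (p o) (q o)

/-- The distance `d(f, g) = sup_{π, o} |f[π](o) - g[π](o)|` of two instances. -/
def instDist (f g : Inst D O) : ℝ≥0∞ := ⨆ π, densityDist (f π) (g π)

/-- The proper covering number of `F` at scale `ε` for the distance `d`. -/
def coveringNumber (F : Set (Inst D O)) (ε : ℝ) : ℕ∞ :=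
  ⨅ (C : Set (Inst D O))
    (_ : C ⊆ F ∧ ∀ g ∈ F, ∃ g' ∈ C, instDist g g' ≤ ENNReal.ofReal ε), C.encard

/-- Logarithmic growth of the log-covering number, and finite volume of the base measure. -/
def LogCovering (ν : Measure O) (F : Set (Inst D O)) : Prop :=
  (∃ c : ℝ, ∀ᶠ ε in 𝓝[>] (0 : ℝ), coveringNumber F ε ≠ ⊤ ∧
    Real.log (coveringNumber F ε).toNat ≤ c * Real.log (1 / ε)) ∧
  ν Set.univ < ⊤

/-- The density of `fstar` is bounded below on its support, and the sup-distance to `fstar`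
is controlled by a power of the KL divergence. -/
def DensityControl (ν : Measure O) (F : Set (Inst D O)) (fstar : Inst D O) : Prop :=
  (∃ cmin : ℝ, 0 < cmin ∧ ∀ π o, fstar π o ≠ 0 → cmin < fstar π o) ∧
  ∃ ι c₅ : ℝ, 0 < ι ∧ 0 < c₅ ∧ ∀ f ∈ F, ∀ π, kl ν fstar f π ≤ 1 →
    densityDist (fstar π) (f π) ≤ ENNReal.ofReal ι * kl ν fstar f π ^ c₅

/-! ### The interaction and the regret

A (deterministic, non-anticipating) learner maps the list of past observations to the next
decision. -/

/-- The joint distribution of the first `t` observations when the learner `alg` interacts with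
instance `f`: given the past `h`, the next observation is drawn from `f[alg h]`. -/
def obsLaw (ν : Measure O) (f : Inst D O) (alg : List O → D) :
    (t : ℕ) → Measure (Fin t → O)
  | 0 => Measure.dirac Fin.elim0
  | t + 1 => (obsLaw ν f alg t).bind fun h =>
      (law ν f (alg (List.ofFn h))).map fun o =>
        (Fin.snoc (α := fun _ => O) h o : Fin (t + 1) → O)

/-- Expected regret over `n` rounds. -/
def regret (ν : Measure O) (R : O → ℝ) (f : Inst D O) (alg : List O → D) (n : ℕ) : ℝ :=
  ∫ h, ∑ t ∈ Finset.range n, gap ν R f (alg ((List.ofFn h).take t)) ∂(obsLaw ν f alg n)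

/-! ### Test-to-Commit -/

/-- The list of decisions in which every `π` occurs `k π` times. -/
def playList (k : D → ℕ) : List D :=
  (Finset.univ : Finset D).toList.flatMap fun π => List.replicate (k π) π

/-- Step 1: every decision is played `⌈ln n / ln ln n⌉` times. -/
def initPlays (D : Type*) [Fintype D] (n : ℕ) : List D :=
  playList fun _ => ⌈Real.log n / Real.log (Real.log n)⌉₊

/-- The quantity `(ln ln n)^{1/4}`. -/
def cap (n : ℕ) : ℝ := Real.log (Real.log n) ^ (1 / 4 : ℝ)

/-- Step 2: every decision is played `⌈((1 + 1/(ln ln n)^{1/4}) w_π + 1/(ln ln n)^{1/4}) ln n⌉`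
times. -/
def identPlays (n : ℕ) (w : D → ℝ≥0) : List D :=
  playList fun π => ⌈((1 + 1 / cap n) * w π + 1 / cap n) * Real.log n⌉₊

/-- The log-likelihood of a list of decisions and observations, with `ln 0 = -∞`. -/
def logLik (f : Inst D O) (l : List (D × O)) : EReal :=
  (l.map fun p => ENNReal.log (f p.1 p.2)).sum

/-- The log-likelihood ratio, with `ln (x / 0) = ∞` for `x > 0` and `ln 0 = -∞`; a sum with a
summand `-∞` is `-∞`. -/
def logLikRatio (f g : Inst D O) (l : List (D × O)) : EReal :=
  (l.map fun p => ENNReal.log ((f p.1 p.2 : ℝ≥0∞) / (g p.1 p.2 : ℝ≥0∞))).sum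

/-- The acceptance event of the log-likelihood ratio test of `fhat`. -/
def Accepts (ν : Measure O) (R : O → ℝ) (F : Set (Inst D O)) (n : ℕ) (fhat : Inst D O)
    (l : List (D × O)) : Prop :=
  ∀ g ∈ F, best ν R g ≠ best ν R fhat → (Real.log n : EReal) ≤ logLikRatio fhat g l

open scoped Classical in
/-- The UCB index of `π` with horizon `n` for rewards in `[0, Rmax]`:
empirical mean plus `Rmax √(2 ln(n²) / T_π)`, and `∞` for a decision that was not played. -/
def ucbIndex (R : O → ℝ) (Rmax : ℝ) (n : ℕ) (hist : List (D × O)) (π : D) : EReal :=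
  let mine := hist.filter fun p => p.1 = π
  if mine.length = 0 then ⊤
  else (((mine.map fun p => R p.2).sum / mine.length +
    Rmax * √(2 * Real.log ((n : ℝ) ^ 2) / mine.length) : ℝ) : EReal)

/-- The decisions and observations of a UCB phase, given the observations of that phase. -/
def ucbHistory (ucb : List (D × O) → D) (obs : List O) : List (D × O) :=
  obs.foldl (fun hist o => hist ++ [(ucb hist, o)]) []

open scoped Classical in
/-- Test-to-Commit with horizon `n`. The parameters are the estimator `est` and the weights `wt`
(functions of the observations of Step 1) and the rule `ucb` for the UCB phase. -/
def t2c (ν : Measure O) (R : O → ℝ) (F : Set (Inst D O)) (n : ℕ)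
    (est : List O → Inst D O) (wt : List O → D → ℝ≥0) (ucb : List (D × O) → D)
    (obs : List O) : D :=
  let init := initPlays D n
  if h₁ : obs.length < init.length then init[obs.length]
  else
    let x := obs.take init.length
    let rest := obs.drop init.length
    let ident := identPlays n (wt x)
    if h₂ : rest.length < ident.length then ident[rest.length]
    else if Accepts ν R F n (est x) (ident.zip rest) then best ν R (est x)
    else ucb (ucbHistory ucb (rest.drop ident.length))

/-- `est` computes a maximum likelihood estimate in `F`, up to `tol` in the log-likelihood,
from the observations of Step 1, and it depends measurably on them. -/
structure IsMLE (F : Set (Inst D O)) (n : ℕ) (tol : ℝ) (est : List O → Inst D O) :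
    Prop where
  mem : ∀ x : List O, x.length = (initPlays D n).length → est x ∈ F
  maximal : ∀ x : List O, x.length = (initPlays D n).length → ∀ g ∈ F,
    logLik g ((initPlays D n).zip x) ≤
      logLik (est x) ((initPlays D n).zip x) + (tol : EReal)
  measurable : ∀ π, Measurable fun p : (Fin (initPlays D n).length → O) × O =>
    est (List.ofFn p.1) π p.2

/-- `wt` computes, from the observations of Step 1, a solution of the program defining
`C(est x, (ln ln n)^{1/4})`, up to `tol` in the objective, and it depends measurably on them.
If the program is infeasible, any weights that obey the cap are allowed. -/
structure SolvesProgram (ν : Measure O) (R : O → ℝ) (F : Set (Inst D O)) (n : ℕ) (tol : ℝ)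
    (est : List O → Inst D O) (wt : List O → D → ℝ≥0) : Prop where
  le_cap : ∀ x : List O, x.length = (initPlays D n).length → ∀ π, (wt x π : ℝ) ≤ cap n
  optimal : ∀ x : List O, x.length = (initPlays D n).length →
    (∃ w, Feasible ν R F (est x) (cap n) w) →
      Feasible ν R F (est x) (cap n) (wt x) ∧
      cost ν R (est x) (wt x) ≤
        complexityAt ν R F (est x) (cap n) + ENNReal.ofReal tol
  measurable : ∀ π, Measurable fun x : Fin (initPlays D n).length → O =>
    wt (List.ofFn x) π

/-- `ucb` always selects a decision of maximal UCB index, with measurable tie-breaking. -/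
structure IsUCB (R : O → ℝ) (Rmax : ℝ) (n : ℕ) (ucb : List (D × O) → D) : Prop where
  maximal : ∀ hist π, ucbIndex R Rmax n hist π ≤ ucbIndex R Rmax n hist (ucb hist)
  measurable : ∀ (t : ℕ) (d : Fin t → D) (π : D),
    MeasurableSet {h : Fin t → O | ucb (List.ofFn fun i => (d i, h i)) = π}

end T2C

end

noncomputable section

namespace T2C

/-!
The Rényi divergence of order `1 - λ` controls the `(1 - λ)`-affinity of two instances, hence, by
Markov's inequality, the probability that the likelihood ratio of the true instance `f⋆` and a given
instance `g` is much smaller than the exponential of the information collected about `g`. A cover of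
the class at scale `exp (-√(ln n))` has only `exp (O(√(ln n)))` members, which makes this bound
uniform in `g` as soon as the information exceeds its threshold by a bit more than `√(ln n)`.

The maximum likelihood estimate of the first phase is therefore close to `f⋆`, in divergence and
thus uniformly, outside an event of probability at most `1 / ln n`. Near `f⋆` the optimal decision
does not change and the densities have almost the same ratios, so that weights feasible for `f⋆`
become feasible for the estimate after multiplication by `1 + 1 / b_n`: the second phase costs
asymptotically at most as much as any fixed feasible weights. The same bound shows that the test
rejects a good estimate with probability at most `1 / ln n`. A wrong decision is accepted with
probability at most `1 / n` by Markov's inequality, so committing costs `O(1)`, and UCB, which costs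
`O(ln n)`, only contributes on events of probability `O(1 / ln n)`.
-/

section ExpectedCost

variable {D O : Type*} [MeasurableSpace O] {μ : D → Measure O} {c : D → ℝ≥0∞}

/-- The expected total cost of `t` rounds of the learner `alg`, who pays `c π` for playing `π` and
then observes `o ∼ μ π`. As an iterated lower integral it makes sense for non-measurable `alg`. -/
def expectedCost (μ : D → Measure O) (c : D → ℝ≥0∞) : ℕ → (List O → D) → ℝ≥0∞
  | 0, _ => 0
  | t + 1, alg => c (alg []) + ∫⁻ o, expectedCost μ c t (fun z => alg (o :: z)) ∂μ (alg [])

theorem expectedCost_le_of_potential {t : ℕ} {alg : List O → D} (W : List O → ℝ≥0∞)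
    (hW : ∀ z, z.length < t → c (alg z) + ∫⁻ o, W (z ++ [o]) ∂μ (alg z) ≤ W z) :
    expectedCost μ c t alg ≤ W [] := by
  induction t generalizing alg W with
  | zero => exact zero_le
  | succ t ih =>
    refine le_trans ?_ (hW [] t.succ_pos)
    refine add_le_add_right (lintegral_mono fun o => ?_) _
    exact ih (fun z => W (o :: z)) fun z hz => hW (o :: z) (Nat.succ_lt_succ hz)

theorem expectedCost_le_mul [∀ π, IsProbabilityMeasure (μ π)] {C : ℝ≥0∞} {alg : List O → D}
    (hC : ∀ z, c (alg z) ≤ C) (t : ℕ) : expectedCost μ c t alg ≤ t * C := by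
  induction t generalizing alg with
  | zero => simp [expectedCost]
  | succ t ih =>
    calc expectedCost μ c (t + 1) alg
        ≤ C + ∫⁻ _, (t * C : ℝ≥0∞) ∂μ (alg []) :=
          add_le_add (hC []) (lintegral_mono fun o => ih fun z => hC (o :: z))
      _ = (t + 1 : ℕ) * C := by simp [add_mul, add_comm]

end ExpectedCost

section Regret

variable {D O : Type*} [MeasurableSpace O] {ν : Measure O} {f : Inst D O} {alg : List O → D}

-- Where the kernel in `obsLaw` fails to be a.e. measurable, `Measure.bind` is the zero measure.
theorem lintegral_obsLaw_succ_le (φ : List O → ℝ≥0∞) (t : ℕ) :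
    ∫⁻ h, φ (List.ofFn h) ∂obsLaw ν f alg (t + 1) ≤
      ∫⁻ h, ∫⁻ o, φ (List.ofFn h ++ [o]) ∂law ν f (alg (List.ofFn h)) ∂obsLaw ν f alg t := by
  obtain ⟨ψ, hψ, hψφ, hint⟩ := exists_measurable_le_lintegral_eq (obsLaw ν f alg (t + 1))
    fun h => φ (List.ofFn h)
  rw [hint, obsLaw]
  by_cases hκ : AEMeasurable (fun h : Fin t → O => (law ν f (alg (List.ofFn h))).map
      fun o => (Fin.snoc (α := fun _ => O) h o : Fin (t + 1) → O)) (obsLaw ν f alg t)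
  · rw [Measure.lintegral_bind hκ hψ.aemeasurable]
    refine lintegral_mono fun h => (lintegral_map_le _ _).trans (lintegral_mono fun o => ?_)
    have hsnoc : List.ofFn (Fin.snoc (α := fun _ => O) h o : Fin (t + 1) → O) =
        List.ofFn h ++ [o] := by
      rw [List.ofFn_succ']
      simp
    exact (hψφ _).trans_eq (congrArg φ hsnoc)
  · simp [Measure.bind, Measure.map_of_not_aemeasurable hκ]

theorem lintegral_obsLaw_add_expectedCost_le [∀ π, IsProbabilityMeasure (law ν f π)]
    (c : D → ℝ≥0∞) (t s : ℕ) :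
    ∫⁻ h, (∑ i ∈ Finset.range t, c (alg ((List.ofFn h).take i)) +
        expectedCost (law ν f) c s fun z => alg (List.ofFn h ++ z)) ∂obsLaw ν f alg t ≤
      expectedCost (law ν f) c (t + s) alg := by
  induction t generalizing s with
  | zero =>
    simp [obsLaw]
  | succ t ih =>
    rw [Nat.add_right_comm, add_assoc t s 1]
    refine (lintegral_obsLaw_succ_le (fun y => ∑ i ∈ Finset.range (t + 1), c (alg (y.take i)) +
      expectedCost (law ν f) c s fun z => alg (y ++ z)) t).trans ((lintegral_mono ?_).trans
        (ih (s + 1)))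
    intro h
    have hpast : ∀ o, ∑ i ∈ Finset.range (t + 1), c (alg ((List.ofFn h ++ [o]).take i)) =
        ∑ i ∈ Finset.range t, c (alg ((List.ofFn h).take i)) + c (alg (List.ofFn h)) := by
      intro o
      rw [Finset.sum_range_succ, List.take_append_of_le_length (by simp)]
      congr 1
      · refine Finset.sum_congr rfl fun i hi => ?_
        rw [List.take_append_of_le_length (by simpa using (Finset.mem_range.1 hi).le)]
      · rw [List.take_of_length_le (by simp)]
    simp only [hpast, lintegral_add_left measurable_const, lintegral_const, measure_univ, mul_one,
      expectedCost, List.append_assoc, List.singleton_append, List.append_nil, add_assoc, le_refl]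

end Regret

section RegretCost

variable {D O : Type*} [Fintype D] [Nonempty D] [MeasurableSpace O]

theorem gap_nonneg (ν : Measure O) (R : O → ℝ) (f : Inst D O) (π : D) : 0 ≤ gap ν R f π :=
  sub_nonneg.2 (Classical.choose_spec (Finite.exists_max (meanReward ν R f)) π)

theorem gap_best (ν : Measure O) (R : O → ℝ) (f : Inst D O) : gap ν R f (best ν R f) = 0 :=
  sub_self _

theorem ofReal_regret_le_expectedCost {ν : Measure O} {f : Inst D O}
    [∀ π, IsProbabilityMeasure (law ν f π)] (R : O → ℝ) (alg : List O → D) (n : ℕ) :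
    ENNReal.ofReal (regret ν R f alg n) ≤
      expectedCost (law ν f) (fun π => ENNReal.ofReal (gap ν R f π)) n alg := by
  calc ENNReal.ofReal (regret ν R f alg n)
      ≤ ‖regret ν R f alg n‖ₑ := by
        rw [← ofReal_norm]
        exact ENNReal.ofReal_le_ofReal (le_abs_self _)
    _ ≤ ∫⁻ h, ‖∑ i ∈ Finset.range n, gap ν R f (alg ((List.ofFn h).take i))‖ₑ
          ∂obsLaw ν f alg n := enorm_integral_le_lintegral_enorm _
    _ = ∫⁻ h, ∑ i ∈ Finset.range n, ENNReal.ofReal (gap ν R f (alg ((List.ofFn h).take i)))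
          ∂obsLaw ν f alg n := by
        refine lintegral_congr fun h => ?_
        rw [Real.enorm_of_nonneg (Finset.sum_nonneg fun _ _ => gap_nonneg ..),
          ENNReal.ofReal_sum_of_nonneg fun _ _ => gap_nonneg ..]
    _ ≤ expectedCost (law ν f) (fun π => ENNReal.ofReal (gap ν R f π)) n alg := by
        simpa [expectedCost] using lintegral_obsLaw_add_expectedCost_le (ν := ν) (f := f)
          (alg := alg) (fun π => ENNReal.ofReal (gap ν R f π)) n 0

end RegretCost

namespace IsDecisionProblem

section

variable {D O : Type*} [MeasurableSpace O]
  {ν : Measure O} {R : O → ℝ} {Rmax : ℝ} {F : Set (Inst D O)} {f : Inst D O}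

theorem isProbabilityMeasure (hF : IsDecisionProblem ν R Rmax F) (hf : f ∈ F) (π : D) :
    IsProbabilityMeasure (law ν f π) :=
  ⟨by simp [law, hF.lintegral_density f hf π]⟩

theorem integrable_reward (hF : IsDecisionProblem ν R Rmax F) (hf : f ∈ F) (π : D) :
    Integrable R (law ν f π) :=
  have := hF.isProbabilityMeasure hf π
  .of_mem_Icc 0 Rmax hF.measurable_reward.aemeasurable (hF.bounded_reward f hf π)

theorem meanReward_mem_Icc (hF : IsDecisionProblem ν R Rmax F) (hf : f ∈ F) (π : D) :
    meanReward ν R f π ∈ Set.Icc 0 Rmax := by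
  have := hF.isProbabilityMeasure hf π
  have hR := hF.bounded_reward f hf π
  refine ⟨integral_nonneg_of_ae (hR.mono fun o ho => ho.1), ?_⟩
  calc meanReward ν R f π ≤ ∫ _, Rmax ∂law ν f π :=
        integral_mono_ae (hF.integrable_reward hf π) (integrable_const _)
          (hR.mono fun o ho => ho.2)
    _ = Rmax := by simp

theorem Rmax_nonneg [Nonempty D] (hF : IsDecisionProblem ν R Rmax F) (hf : f ∈ F) : 0 ≤ Rmax :=
  let ⟨hnonneg, hle⟩ := hF.meanReward_mem_Icc hf (Classical.arbitrary D)
  hnonneg.trans hle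

end

theorem gap_le {D O : Type*} [Fintype D] [Nonempty D] [MeasurableSpace O] {ν : Measure O}
    {R : O → ℝ} {Rmax : ℝ} {F : Set (Inst D O)} {f : Inst D O}
    (hF : IsDecisionProblem ν R Rmax F) (hf : f ∈ F) (π : D) : gap ν R f π ≤ Rmax := by
  have hπ := hF.meanReward_mem_Icc hf π
  have hbest := hF.meanReward_mem_Icc hf (best ν R f)
  unfold gap
  linarith [hπ.1, hbest.2]

end IsDecisionProblem

section FixedPlays

variable {D O : Type*} [MeasurableSpace O] {μ : D → Measure O}

/-- The expectation of a function of the observations when the decisions in a list are played in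
order, as an iterated lower integral: no measurability of the function is required. -/
def playLIntegral (μ : D → Measure O) : List D → (List O → ℝ≥0∞) → ℝ≥0∞
  | [], φ => φ []
  | π :: l, φ => ∫⁻ o, playLIntegral μ l (fun y => φ (o :: y)) ∂μ π

/-- The inner probability of an event about the observations when the decisions in a list are
played in order; events such as the rejection of an estimate need not be measurable. -/
def playProb (μ : D → Measure O) (l : List D) (E : Set (List O)) : ℝ≥0∞ :=
  playLIntegral μ l (E.indicator 1)

theorem playLIntegral_mono {l : List D} {φ ψ : List O → ℝ≥0∞}
    (h : ∀ y, y.length = l.length → φ y ≤ ψ y) : playLIntegral μ l φ ≤ playLIntegral μ l ψ := by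
  induction l generalizing φ ψ with
  | nil => exact h [] rfl
  | cons π l ih => exact lintegral_mono fun o => ih fun y hy => h (o :: y) (by simp [hy])

theorem playLIntegral_add_mul [∀ π, IsProbabilityMeasure (μ π)] (a : ℝ≥0∞) {b : ℝ≥0∞}
    (hb : b ≠ ⊤) (l : List D) (φ : List O → ℝ≥0∞) :
    playLIntegral μ l (fun y => a + b * φ y) = a + b * playLIntegral μ l φ := by
  induction l generalizing φ with
  | nil => rfl
  | cons π l ih =>
    simp [playLIntegral, ih, lintegral_add_left measurable_const, lintegral_const_mul' _ _ hb]

theorem playLIntegral_le_add_mul_playProb [∀ π, IsProbabilityMeasure (μ π)] {a b : ℝ≥0∞}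
    (hb : b ≠ ⊤) {l : List D} {φ : List O → ℝ≥0∞} {E : Set (List O)}
    (hφ : ∀ y, y.length = l.length → φ y ≤ a + b * E.indicator 1 y) :
    playLIntegral μ l φ ≤ a + b * playProb μ l E :=
  (playLIntegral_mono hφ).trans_eq (playLIntegral_add_mul a hb l _)

theorem playLIntegral_sum_mul_prod {ι : Type*} (s : Finset ι) (c : ι → ℝ≥0∞)
    {u : ι → D → O → ℝ≥0∞} (hu : ∀ j ∈ s, ∀ π, Measurable (u j π)) (l : List D) :
    playLIntegral μ l (fun y => ∑ j ∈ s, c j * ((l.zip y).map fun p => u j p.1 p.2).prod) =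
      ∑ j ∈ s, c j * (l.map fun π => ∫⁻ o, u j π o ∂μ π).prod := by
  induction l generalizing c with
  | nil => simp [playLIntegral]
  | cons π l ih =>
    simp only [playLIntegral, List.zip_cons_cons, List.map_cons, List.prod_cons, ← mul_assoc,
      ih fun j => c j * u j π _]
    rw [lintegral_finsetSum _ fun j hj => ((hu j hj π).const_mul _).mul_const _]
    refine Finset.sum_congr rfl fun j hj => ?_
    rw [lintegral_mul_const _ ((hu j hj π).const_mul _), lintegral_const_mul _ (hu j hj π)]

theorem playProb_le_sum_mul_prod {ι : Type*} {s : Finset ι} {c : ι → ℝ≥0∞}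
    {u : ι → D → O → ℝ≥0∞} (hu : ∀ j ∈ s, ∀ π, Measurable (u j π)) {l : List D}
    {E : Set (List O)} (hE : ∀ y ∈ E, y.length = l.length →
      1 ≤ ∑ j ∈ s, c j * ((l.zip y).map fun p => u j p.1 p.2).prod) :
    playProb μ l E ≤ ∑ j ∈ s, c j * (l.map fun π => ∫⁻ o, u j π o ∂μ π).prod := by
  rw [← playLIntegral_sum_mul_prod s c hu l]
  refine playLIntegral_mono fun y hy => ?_
  by_cases hyE : y ∈ E
  · simpa [hyE] using hE y hyE hy
  · simp [hyE]

theorem expectedCost_length_add [∀ π, IsProbabilityMeasure (μ π)] (c : D → ℝ≥0∞)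
    {alg : List O → D} {l : List D} (halg : ∀ y, ∀ hy : y.length < l.length, alg y = l[y.length])
    (r : ℕ) :
    expectedCost μ c (l.length + r) alg =
      (l.map c).sum + playLIntegral μ l fun y => expectedCost μ c r fun z => alg (y ++ z) := by
  induction l generalizing alg with
  | nil => simp [playLIntegral]
  | cons π l ih =>
    have hfirst : alg [] = π := halg [] (by simp)
    have htail : ∀ o, expectedCost μ c (l.length + r) (fun z => alg (o :: z)) = (l.map c).sum +
        playLIntegral μ l fun y => expectedCost μ c r fun z => alg (o :: y ++ z) := fun o =>
      ih fun y hy => halg (o :: y) (by simpa using hy)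
    rw [List.length_cons, Nat.add_right_comm]
    simp [expectedCost, playLIntegral, hfirst, htail, lintegral_add_left measurable_const,
      add_assoc]

end FixedPlays

section PlayList

variable {D : Type*} [Fintype D]

@[to_additive]
theorem prod_map_playList {M : Type*} [CommMonoid M] (N : D → ℕ) (g : D → M) :
    ((playList N).map g).prod = ∏ π, g π ^ N π := by
  have hblocks : ∀ L : List D, ((L.flatMap fun π => List.replicate (N π) π).map g).prod =
      (L.map fun π => g π ^ N π).prod := by
    intro L
    induction L with
    | nil => simp
    | cons π L ih => simp [ih]
  rw [playList, hblocks, Finset.prod_map_toList]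

theorem length_playList (N : D → ℕ) : (playList N).length = ∑ π, N π := by
  simpa using sum_map_playList (M := ℕ) N fun _ => 1

end PlayList

theorem lintegral_exp_centered_le_one {Ω : Type*} [MeasurableSpace Ω] {P : Measure Ω}
    [IsProbabilityMeasure P] {X : Ω → ℝ} {a b : ℝ} (hX : Measurable X)
    (hab : ∀ᵐ ω ∂P, X ω ∈ Set.Icc a b) (θ : ℝ) :
    ∫⁻ ω, ENNReal.ofReal (Real.exp (θ * (X ω - ∫ x, X x ∂P) - θ ^ 2 * (b - a) ^ 2 / 8)) ∂P ≤ 1 := by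
  have hsub := ProbabilityTheory.hasSubgaussianMGF_of_mem_Icc hX.aemeasurable hab
  have hsplit : ∀ ω, Real.exp (θ * (X ω - ∫ x, X x ∂P) - θ ^ 2 * (b - a) ^ 2 / 8) =
      Real.exp (-(θ ^ 2 * (b - a) ^ 2 / 8)) * Real.exp (θ * (X ω - ∫ x, X x ∂P)) := fun ω => by
    rw [← Real.exp_add, neg_add_eq_sub]
  simp_rw [hsplit]
  rw [← ofReal_integral_eq_lintegral_ofReal ((hsub.integrable_exp_mul θ).const_mul _)
    (.of_forall fun ω => by positivity), integral_const_mul, ENNReal.ofReal_le_one]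
  refine (mul_le_mul_of_nonneg_left (hsub.mgf_le θ) (Real.exp_nonneg _)).trans_eq ?_
  rw [← Real.exp_add, Real.exp_eq_one_iff]
  push_cast
  rw [Real.norm_eq_abs, div_pow, sq_abs]
  ring

section UCB

variable {D O : Type*}

open scoped Classical in
/-- The number of plays of `π` in a history. -/
def plays (H : List (D × O)) (π : D) : ℕ := (H.filter fun p => p.1 = π).length

open scoped Classical in
/-- The total reward of the plays of `π` in a history. -/
def totalReward (R : O → ℝ) (H : List (D × O)) (π : D) : ℝ :=
  ((H.filter fun p => p.1 = π).map fun p => R p.2).sum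

/-- The radius of the UCB confidence interval after `s` plays. -/
def radius (Rmax : ℝ) (n s : ℕ) : ℝ := Rmax * √(2 * Real.log ((n : ℝ) ^ 2) / s)

theorem plays_append_self (H : List (D × O)) (π : D) (o : O) :
    plays (H ++ [(π, o)]) π = plays H π + 1 := by
  simp [plays]

theorem plays_append_of_ne (H : List (D × O)) {π π' : D} (h : π' ≠ π) (o : O) :
    plays (H ++ [(π', o)]) π = plays H π := by
  simp [plays, h]

theorem totalReward_append_self (R : O → ℝ) (H : List (D × O)) (π : D) (o : O) :
    totalReward R (H ++ [(π, o)]) π = totalReward R H π + R o := by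
  simp [totalReward]

theorem totalReward_append_of_ne (R : O → ℝ) (H : List (D × O)) {π π' : D} (h : π' ≠ π) (o : O) :
    totalReward R (H ++ [(π', o)]) π = totalReward R H π := by
  simp [totalReward, h]

theorem plays_le_length (H : List (D × O)) (π : D) : plays H π ≤ H.length :=
  List.length_filter_le _ _

theorem ucbHistory_append (ucb : List (D × O) → D) (z : List O) (o : O) :
    ucbHistory ucb (z ++ [o]) = ucbHistory ucb z ++ [(ucb (ucbHistory ucb z), o)] := by
  simp [ucbHistory]

theorem length_ucbHistory (ucb : List (D × O) → D) (z : List O) :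
    (ucbHistory ucb z).length = z.length := by
  induction z using List.reverseRecOn with
  | nil => rfl
  | append_singleton z o ih => simp [ucbHistory_append, ih]

theorem ucbIndex_of_plays_eq_zero (R : O → ℝ) (Rmax : ℝ) (n : ℕ) {H : List (D × O)} {π : D}
    (h : plays H π = 0) : ucbIndex R Rmax n H π = ⊤ :=
  if_pos h

theorem ucbIndex_of_plays_ne_zero (R : O → ℝ) (Rmax : ℝ) (n : ℕ) {H : List (D × O)} {π : D}
    (h : plays H π ≠ 0) : ucbIndex R Rmax n H π =
      ((totalReward R H π / plays H π + radius Rmax n (plays H π) : ℝ) : EReal) :=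
  if_neg h

theorem mul_sq_radius {n s : ℕ} (hs : s ≠ 0) (Rmax : ℝ) :
    s * radius Rmax n s ^ 2 = 4 * Rmax ^ 2 * Real.log n := by
  have : 0 ≤ Real.log n := Real.log_natCast_nonneg n
  rw [radius, mul_pow, Real.sq_sqrt (by rw [Real.log_pow]; positivity), Real.log_pow]
  push_cast
  field_simp
  ring

/-- The exponent for which the Chernoff bound at the confidence radius is tightest. -/
def chernoffRate (Rmax : ℝ) (n s : ℕ) : ℝ := 4 * radius Rmax n s / Rmax ^ 2

theorem eight_mul_log_le {Rmax : ℝ} (hRmax : 0 < Rmax) {n s : ℕ} (hs : s ≠ 0) {x : ℝ}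
    (hx : s * radius Rmax n s ≤ x) :
    8 * Real.log n ≤
      chernoffRate Rmax n s * x - s * (chernoffRate Rmax n s ^ 2 * Rmax ^ 2 / 8) := by
  have hrate : 0 ≤ chernoffRate Rmax n s := by unfold chernoffRate radius; positivity
  have hlinear : chernoffRate Rmax n s * (s * radius Rmax n s) = 16 * Real.log n := by
    calc chernoffRate Rmax n s * (s * radius Rmax n s)
        = 4 * (s * radius Rmax n s ^ 2) / Rmax ^ 2 := by unfold chernoffRate; ring
      _ = 16 * Real.log n := by rw [mul_sq_radius hs]; field_simp; ring
  have hquadratic : s * (chernoffRate Rmax n s ^ 2 * Rmax ^ 2 / 8) = 8 * Real.log n := by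
    calc s * (chernoffRate Rmax n s ^ 2 * Rmax ^ 2 / 8)
        = 2 * (s * radius Rmax n s ^ 2) / Rmax ^ 2 := by unfold chernoffRate; field_simp; ring
      _ = 8 * Real.log n := by rw [mul_sq_radius hs]; field_simp; ring
  linarith [mul_le_mul_of_nonneg_left hx hrate]

variable [MeasurableSpace O] {μ : D → Measure O} {R : O → ℝ} {Rmax : ℝ}

/-- The exponential supermartingale of the centred rewards of `π`. -/
def expPotential (μ : D → Measure O) (R : O → ℝ) (Rmax θ : ℝ) (π : D) (H : List (D × O)) : ℝ≥0∞ :=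
  ENNReal.ofReal (Real.exp (θ * (totalReward R H π - plays H π * ∫ o, R o ∂μ π) -
    plays H π * (θ ^ 2 * Rmax ^ 2 / 8)))

theorem expPotential_append_self (θ : ℝ) (π : D) (H : List (D × O)) (o : O) :
    expPotential μ R Rmax θ π (H ++ [(π, o)]) = expPotential μ R Rmax θ π H *
      ENNReal.ofReal (Real.exp (θ * (R o - ∫ o, R o ∂μ π) - θ ^ 2 * Rmax ^ 2 / 8)) := by
  unfold expPotential
  rw [totalReward_append_self, plays_append_self, ← ENNReal.ofReal_mul (Real.exp_nonneg _),
    ← Real.exp_add]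
  congr 2
  push_cast
  ring

theorem expPotential_append_of_ne (θ : ℝ) {π π' : D} (h : π' ≠ π) (H : List (D × O)) (o : O) :
    expPotential μ R Rmax θ π (H ++ [(π', o)]) = expPotential μ R Rmax θ π H := by
  simp only [expPotential, totalReward_append_of_ne R H h, plays_append_of_ne H h]

theorem expPotential_nil (θ : ℝ) (π : D) : expPotential μ R Rmax θ π [] = 1 := by
  simp [expPotential, totalReward, plays]

theorem measurable_expPotential_append (hR : Measurable R) (θ : ℝ) (π π' : D)
    (H : List (D × O)) : Measurable fun o => expPotential μ R Rmax θ π (H ++ [(π', o)]) := by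
  rcases eq_or_ne π' π with rfl | h
  · simp only [expPotential_append_self]
    fun_prop
  · simp only [expPotential_append_of_ne θ h, measurable_const]

theorem lintegral_expPotential_append_le [∀ π, IsProbabilityMeasure (μ π)]
    (hR : Measurable R) (hbound : ∀ π, ∀ᵐ o ∂μ π, R o ∈ Set.Icc 0 Rmax)
    (θ : ℝ) (π π' : D) (H : List (D × O)) :
    ∫⁻ o, expPotential μ R Rmax θ π (H ++ [(π', o)]) ∂μ π' ≤ expPotential μ R Rmax θ π H := by
  rcases eq_or_ne π' π with rfl | h
  · simp only [expPotential_append_self]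
    rw [lintegral_const_mul _ (by fun_prop)]
    refine mul_le_of_le_one_right' ?_
    simpa using lintegral_exp_centered_le_one hR (hbound π') θ
  · simp [expPotential_append_of_ne θ h]

theorem natCast_pow_le_expPotential (hRmax : 0 < Rmax) {n : ℕ} (hn : 1 ≤ n) {H : List (D × O)}
    {π : D} (hπ : plays H π ≠ 0) {σ : ℝ} (hσ : σ ^ 2 = 1)
    (hfail : plays H π * radius Rmax n (plays H π) ≤
      σ * (totalReward R H π - plays H π * ∫ o, R o ∂μ π)) :
    (n : ℝ≥0∞) ^ 8 ≤
      expPotential μ R Rmax (σ * chernoffRate Rmax n (plays H π)) π H := by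
  have hn' : (0 : ℝ) < n := by exact_mod_cast hn
  have hpow : (n : ℝ≥0∞) ^ 8 = ENNReal.ofReal (Real.exp (8 * Real.log n)) := by
    rw [← Nat.cast_ofNat (R := ℝ), ← Real.log_pow, Real.exp_log (by positivity),
      ENNReal.ofReal_pow hn'.le, ENNReal.ofReal_natCast]
  rw [hpow, expPotential, mul_pow, hσ, one_mul]
  exact ENNReal.ofReal_le_ofReal (Real.exp_le_exp.2
    ((eight_mul_log_le hRmax hπ hfail).trans_eq (by ring)))

variable [Fintype D]

/-- A supermartingale that is at least one as soon as some confidence interval of UCB fails. It sums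
the exponential supermartingales of both signs over all possible numbers of plays. -/
def failPotential (μ : D → Measure O) (R : O → ℝ) (Rmax : ℝ) (n : ℕ) (H : List (D × O)) : ℝ≥0∞ :=
  ((n : ℝ≥0∞) ^ 8)⁻¹ *
    ∑ j ∈ (Finset.univ : Finset D) ×ˢ Finset.Icc 1 n ×ˢ ({1, -1} : Finset ℝ),
      expPotential μ R Rmax (j.2.2 * chernoffRate Rmax n j.2.1) j.1 H

theorem measurable_failPotential_append (hR : Measurable R) (n : ℕ) (π : D) (H : List (D × O)) :
    Measurable fun o => failPotential μ R Rmax n (H ++ [(π, o)]) :=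
  (Finset.measurable_fun_sum _ fun _ _ => measurable_expPotential_append hR _ _ _ _).const_mul _

theorem lintegral_failPotential_append_le [∀ π, IsProbabilityMeasure (μ π)]
    (hR : Measurable R) (hbound : ∀ π, ∀ᵐ o ∂μ π, R o ∈ Set.Icc 0 Rmax)
    (n : ℕ) (π : D) (H : List (D × O)) :
    ∫⁻ o, failPotential μ R Rmax n (H ++ [(π, o)]) ∂μ π ≤ failPotential μ R Rmax n H := by
  have hmeas := fun θ π' => measurable_expPotential_append (μ := μ) (Rmax := Rmax) hR θ π' π H
  unfold failPotential
  rw [lintegral_const_mul _ (Finset.measurable_fun_sum _ fun _ _ => hmeas _ _),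
    lintegral_finsetSum _ fun _ _ => hmeas _ _]
  gcongr
  exact lintegral_expPotential_append_le hR hbound _ _ _ _

theorem natCast_mul_failPotential_nil_le {n : ℕ} (hn : 1 ≤ n) :
    n * failPotential μ R Rmax n [] ≤ 2 * Fintype.card D := by
  have hpow : (n : ℝ≥0∞) ^ 2 * ((n : ℝ≥0∞) ^ 8)⁻¹ ≤ 1 := by
    rw [← div_eq_mul_inv]
    refine ENNReal.div_le_of_le_mul ?_
    rw [one_mul]
    exact pow_le_pow_right₀ (by exact_mod_cast hn) (by norm_num)
  calc n * failPotential μ R Rmax n []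
      = (n : ℝ≥0∞) ^ 2 * ((n : ℝ≥0∞) ^ 8)⁻¹ * (2 * Fintype.card D) := by
        simp only [failPotential, expPotential_nil, Finset.sum_const, Finset.card_product,
          Finset.card_univ, Nat.card_Icc, Nat.add_sub_cancel,
          Finset.card_pair (by norm_num : (1 : ℝ) ≠ -1), nsmul_eq_mul, mul_one, Nat.cast_mul,
          Nat.cast_ofNat]
        ring
    _ ≤ 2 * Fintype.card D := mul_le_of_le_one_left' hpow

theorem one_le_failPotential (hRmax : 0 < Rmax) {n : ℕ} (hn : 1 ≤ n) {H : List (D × O)}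
    (hH : H.length ≤ n) {π : D} (hπ : plays H π ≠ 0)
    (hfail : radius Rmax n (plays H π) ≤
      |totalReward R H π / plays H π - ∫ o, R o ∂μ π|) :
    1 ≤ failPotential μ R Rmax n H := by
  have hpos : (0 : ℝ) < plays H π := by exact_mod_cast Nat.pos_of_ne_zero hπ
  obtain ⟨σ, hσ1, hσ⟩ : ∃ σ ∈ ({1, -1} : Finset ℝ), plays H π * radius Rmax n (plays H π) ≤
      σ * (totalReward R H π - plays H π * ∫ o, R o ∂μ π) := by
    have hmean : totalReward R H π - plays H π * ∫ o, R o ∂μ π =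
        plays H π * (totalReward R H π / plays H π - ∫ o, R o ∂μ π) := by field_simp
    rw [hmean]
    rcases le_abs.1 hfail with h | h
    · exact ⟨1, by simp, by simpa using mul_le_mul_of_nonneg_left h hpos.le⟩
    · exact ⟨-1, by simp, by simpa [-neg_sub] using mul_le_mul_of_nonneg_left h hpos.le⟩
  have hmem : (π, plays H π, σ) ∈ (Finset.univ : Finset D) ×ˢ Finset.Icc 1 n ×ˢ
      ({1, -1} : Finset ℝ) :=
    Finset.mem_product.2 ⟨Finset.mem_univ π, Finset.mem_product.2 ⟨Finset.mem_Icc.2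
      ⟨Nat.one_le_iff_ne_zero.2 hπ, (plays_le_length H π).trans hH⟩, hσ1⟩⟩
  have hsingle := Finset.single_le_sum_of_canonicallyOrdered (f := fun j : D × ℕ × ℝ =>
    expPotential μ R Rmax (j.2.2 * chernoffRate Rmax n j.2.1) j.1 H) hmem
  have hsum : (n : ℝ≥0∞) ^ 8 ≤
      ∑ j ∈ (Finset.univ : Finset D) ×ˢ Finset.Icc 1 n ×ˢ ({1, -1} : Finset ℝ),
        expPotential μ R Rmax (j.2.2 * chernoffRate Rmax n j.2.1) j.1 H :=
    (natCast_pow_le_expPotential hRmax hn hπ (by aesop) hσ).trans hsingle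
  have hn8 : (n : ℝ≥0∞) ^ 8 ≠ 0 := pow_ne_zero _ (by exact_mod_cast Nat.one_le_iff_ne_zero.1 hn)
  rw [← ENNReal.inv_mul_cancel hn8 (by finiteness)]
  exact mul_le_mul' le_rfl hsum

theorem plays_ucb_le (hRmax : 0 < Rmax) {n : ℕ} (hn : 1 ≤ n) {ucb : List (D × O) → D}
    (hucb : IsUCB R Rmax n ucb) {H : List (D × O)} (hH : H.length ≤ n)
    (hgood : failPotential μ R Rmax n H < 1) {π₀ : D}
    (hgap : 0 < ∫ o, R o ∂μ π₀ - ∫ o, R o ∂μ (ucb H)) :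
    (plays H (ucb H) : ℝ) ≤
      16 * Rmax ^ 2 * Real.log n / (∫ o, R o ∂μ π₀ - ∫ o, R o ∂μ (ucb H)) ^ 2 := by
  set π := ucb H with hπ
  have : 0 ≤ Real.log n := Real.log_natCast_nonneg n
  by_cases hplays : plays H π = 0
  · rw [hplays, Nat.cast_zero]
    positivity
  have hconf : ∀ π', plays H π' ≠ 0 →
      |totalReward R H π' / plays H π' - ∫ o, R o ∂μ π'| < radius Rmax n (plays H π') := by
    intro π' hπ'
    by_contra! hfail
    exact (one_le_failPotential hRmax hn hH hπ' hfail).not_gt hgood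
  have hindex := hucb.maximal H π₀
  rw [← hπ, ucbIndex_of_plays_ne_zero R Rmax n hplays] at hindex
  have hplays₀ : plays H π₀ ≠ 0 := by
    intro h
    rw [ucbIndex_of_plays_eq_zero R Rmax n h, top_le_iff] at hindex
    exact EReal.coe_ne_top _ hindex
  rw [ucbIndex_of_plays_ne_zero R Rmax n hplays₀, EReal.coe_le_coe_iff] at hindex
  have hgap_le : ∫ o, R o ∂μ π₀ - ∫ o, R o ∂μ π ≤ 2 * radius Rmax n (plays H π) := by
    linarith [(abs_lt.1 (hconf π hplays)).2, (abs_lt.1 (hconf π₀ hplays₀)).1]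
  rw [le_div_iff₀ (by positivity)]
  calc (plays H π : ℝ) * (∫ o, R o ∂μ π₀ - ∫ o, R o ∂μ π) ^ 2
      ≤ plays H π * (2 * radius Rmax n (plays H π)) ^ 2 := by gcongr
    _ = 4 * (plays H π * radius Rmax n (plays H π) ^ 2) := by ring
    _ = 16 * Rmax ^ 2 * Real.log n := by rw [mul_sq_radius hplays]; ring

theorem expectedReward_mem_Icc {P : Measure O} [IsProbabilityMeasure P] (hR : Measurable R)
    (hbound : ∀ᵐ o ∂P, R o ∈ Set.Icc 0 Rmax) : ∫ o, R o ∂P ∈ Set.Icc 0 Rmax :=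
  (convex_Icc 0 Rmax).integral_mem isClosed_Icc hbound (.of_mem_Icc 0 Rmax hR.aemeasurable hbound)

/-- An upper bound for the cost of the plays that UCB has not yet made while its confidence
intervals hold, when playing `π` costs its gap to `π₀`. -/
def remainingCost (μ : D → Measure O) (R : O → ℝ) (Rmax : ℝ) (n : ℕ) (π₀ : D)
    (H : List (D × O)) : ℝ≥0∞ :=
  ∑ π, ENNReal.ofReal (∫ o, R o ∂μ π₀ - ∫ o, R o ∂μ π) *
    (ENNReal.ofReal (16 * Rmax ^ 2 * Real.log n / (∫ o, R o ∂μ π₀ - ∫ o, R o ∂μ π) ^ 2 + 1) -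
      plays H π)

theorem remainingCost_append_le (n : ℕ) (π₀ π : D) (H : List (D × O)) (o : O) :
    remainingCost μ R Rmax n π₀ (H ++ [(π, o)]) ≤ remainingCost μ R Rmax n π₀ H := by
  unfold remainingCost
  gcongr with π'
  rcases eq_or_ne π π' with rfl | h
  · simp [plays_append_self]
  · simp [plays_append_of_ne H h]

theorem add_remainingCost_append_le {n : ℕ} {π₀ π : D} {H : List (D × O)}
    (hplays : (plays H π : ℝ) ≤
      16 * Rmax ^ 2 * Real.log n / (∫ o, R o ∂μ π₀ - ∫ o, R o ∂μ π) ^ 2) (o : O) :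
    ENNReal.ofReal (∫ o, R o ∂μ π₀ - ∫ o, R o ∂μ π) +
      remainingCost μ R Rmax n π₀ (H ++ [(π, o)]) ≤ remainingCost μ R Rmax n π₀ H := by
  classical
  unfold remainingCost
  rw [← Finset.add_sum_erase _ _ (Finset.mem_univ π), ← Finset.add_sum_erase _ _
    (Finset.mem_univ π), ← add_assoc, plays_append_self]
  have hothers : ∀ π' ∈ Finset.univ.erase π, plays (H ++ [(π, o)]) π' = plays H π' :=
    fun π' hπ' => plays_append_of_ne H (Finset.ne_of_mem_erase hπ').symm o
  refine add_le_add ?_ (Finset.sum_le_sum fun π' hπ' => by rw [hothers π' hπ'])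
  have hroom : ((plays H π + 1 : ℕ) : ℝ≥0∞) ≤ ENNReal.ofReal
      (16 * Rmax ^ 2 * Real.log n / (∫ o, R o ∂μ π₀ - ∫ o, R o ∂μ π) ^ 2 + 1) := by
    rw [← ENNReal.ofReal_natCast]
    refine ENNReal.ofReal_le_ofReal ?_
    push_cast
    gcongr
  rw [← mul_one_add]
  gcongr
  obtain ⟨d, hd⟩ := exists_add_of_le hroom
  rw [hd, ENNReal.add_sub_cancel_left (by finiteness), Nat.cast_add, Nat.cast_one, add_assoc,
    ENNReal.add_sub_cancel_left (by finiteness)]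

theorem remainingCost_nil_le {n : ℕ} {π₀ : D}
    (hgap : ∀ π, ∫ o, R o ∂μ π₀ - ∫ o, R o ∂μ π ≤ Rmax) :
    remainingCost μ R Rmax n π₀ [] ≤
      (∑ π, ENNReal.ofReal (16 * Rmax ^ 2 / (∫ o, R o ∂μ π₀ - ∫ o, R o ∂μ π))) *
        ENNReal.ofReal (Real.log n) + Fintype.card D * ENNReal.ofReal Rmax := by
  have : 0 ≤ Real.log n := Real.log_natCast_nonneg n
  rw [Finset.sum_mul, ← nsmul_eq_mul, ← Finset.card_univ, ← Finset.sum_const,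
    ← Finset.sum_add_distrib]
  refine Finset.sum_le_sum fun π _ => ?_
  set Δ := ∫ o, R o ∂μ π₀ - ∫ o, R o ∂μ π
  rcases le_or_gt Δ 0 with hΔ | hΔ
  · simp [ENNReal.ofReal_of_nonpos hΔ]
  · have hcost : Δ * (16 * Rmax ^ 2 * Real.log n / Δ ^ 2 + 1) =
        16 * Rmax ^ 2 / Δ * Real.log n + Δ := by field_simp
    rw [← ENNReal.ofReal_mul (by positivity), ← ENNReal.ofReal_add (by positivity)
      (hΔ.le.trans (hgap π))]
    simp only [plays, List.filter_nil, List.length_nil, Nat.cast_zero, tsub_zero]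
    rw [← ENNReal.ofReal_mul hΔ.le, hcost]
    gcongr
    exact hgap π

theorem add_remainingCost_ucb_le (hRmax : 0 < Rmax) {n : ℕ} (hn : 1 ≤ n)
    {ucb : List (D × O) → D} (hucb : IsUCB R Rmax n ucb) {H : List (D × O)} (hH : H.length ≤ n)
    {π₀ : D} (hgap : ∀ π, ∫ o, R o ∂μ π₀ - ∫ o, R o ∂μ π ≤ Rmax) (o : O) :
    ENNReal.ofReal (∫ o, R o ∂μ π₀ - ∫ o, R o ∂μ (ucb H)) +
        remainingCost μ R Rmax n π₀ (H ++ [(ucb H, o)]) ≤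
      remainingCost μ R Rmax n π₀ H + ENNReal.ofReal Rmax * failPotential μ R Rmax n H := by
  rcases lt_or_ge (failPotential μ R Rmax n H) 1 with hgood | hbad
  · refine le_add_right ?_
    rcases le_or_gt (∫ o, R o ∂μ π₀ - ∫ o, R o ∂μ (ucb H)) 0 with hΔ | hΔ
    · rw [ENNReal.ofReal_of_nonpos hΔ, zero_add]
      exact remainingCost_append_le n π₀ _ H o
    · exact add_remainingCost_append_le (plays_ucb_le hRmax hn hucb hH hgood hΔ) o
  · rw [add_comm]
    refine add_le_add (remainingCost_append_le n π₀ _ H o) ?_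
    exact (ENNReal.ofReal_le_ofReal (hgap _)).trans (le_mul_of_one_le_right' hbad)

/-- The constant in the gap-dependent regret bound of UCB relative to the reference decision
`π₀`. Decisions that are not worse than `π₀` do not contribute, as `ENNReal.ofReal` truncates. -/
def ucbConst (μ : D → Measure O) (R : O → ℝ) (Rmax : ℝ) (π₀ : D) : ℝ≥0∞ :=
  ∑ π, ENNReal.ofReal (16 * Rmax ^ 2 / (∫ o, R o ∂μ π₀ - ∫ o, R o ∂μ π))

theorem expectedCost_ucb_le_of_pos [∀ π, IsProbabilityMeasure (μ π)] (hR : Measurable R)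
    (hbound : ∀ π, ∀ᵐ o ∂μ π, R o ∈ Set.Icc 0 Rmax) (hRmax : 0 < Rmax) {n : ℕ} (hn : 1 ≤ n)
    {ucb : List (D × O) → D} (hucb : IsUCB R Rmax n ucb) {π₀ : D}
    (hgap : ∀ π, ∫ o, R o ∂μ π₀ - ∫ o, R o ∂μ π ≤ Rmax) {r : ℕ} (hr : r ≤ n) :
    expectedCost μ (fun π => ENNReal.ofReal (∫ o, R o ∂μ π₀ - ∫ o, R o ∂μ π)) r
        (fun z => ucb (ucbHistory ucb z)) ≤
      remainingCost μ R Rmax n π₀ [] +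
        r * (ENNReal.ofReal Rmax * failPotential μ R Rmax n []) := by
  refine expectedCost_le_of_potential (fun z => remainingCost μ R Rmax n π₀ (ucbHistory ucb z) +
    (r - z.length : ℕ) * (ENNReal.ofReal Rmax * failPotential μ R Rmax n (ucbHistory ucb z)))
    fun z hz => ?_
  set H := ucbHistory ucb z with hH
  have hlen : H.length ≤ n := by
    rw [hH, length_ucbHistory]
    lia
  obtain ⟨k, hk⟩ : ∃ k, r - z.length = k + 1 := ⟨r - z.length - 1, by lia⟩
  have hk' : ∀ o, r - (z ++ [o]).length = k := fun o => by simp; lia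
  have hfail := measurable_failPotential_append (μ := μ) (Rmax := Rmax) hR n (ucb H) H
  simp only [ucbHistory_append, ← hH, hk, hk']
  set C := ENNReal.ofReal (∫ o, R o ∂μ π₀ - ∫ o, R o ∂μ (ucb H))
  set S := remainingCost μ R Rmax n π₀ H
  set E := ENNReal.ofReal Rmax * failPotential μ R Rmax n H with hE
  calc C + ∫⁻ o, (remainingCost μ R Rmax n π₀ (H ++ [(ucb H, o)]) +
          k * (ENNReal.ofReal Rmax * failPotential μ R Rmax n (H ++ [(ucb H, o)]))) ∂μ (ucb H)
      = ∫⁻ o, (C + remainingCost μ R Rmax n π₀ (H ++ [(ucb H, o)]) +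
          k * (ENNReal.ofReal Rmax * failPotential μ R Rmax n (H ++ [(ucb H, o)])))
            ∂μ (ucb H) := by
        simp only [add_assoc, lintegral_add_left measurable_const, lintegral_const, measure_univ,
          mul_one]
    _ ≤ ∫⁻ o, (S + E +
          k * (ENNReal.ofReal Rmax * failPotential μ R Rmax n (H ++ [(ucb H, o)])))
            ∂μ (ucb H) := by
        exact lintegral_mono fun o =>
          add_le_add_left (add_remainingCost_ucb_le hRmax hn hucb hlen hgap o) _
    _ ≤ S + E + k * E := by
        rw [lintegral_add_left measurable_const, lintegral_const, measure_univ, mul_one,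
          lintegral_const_mul _ (hfail.const_mul _), lintegral_const_mul _ hfail, hE]
        gcongr
        exact lintegral_failPotential_append_le hR hbound n _ H
    _ = S + (k + 1 : ℕ) * E := by
        push_cast
        ring

theorem expectedCost_ucb_le [∀ π, IsProbabilityMeasure (μ π)] (hR : Measurable R)
    (hbound : ∀ π, ∀ᵐ o ∂μ π, R o ∈ Set.Icc 0 Rmax) {n : ℕ} (hn : 1 ≤ n)
    {ucb : List (D × O) → D} (hucb : IsUCB R Rmax n ucb) (π₀ : D) {r : ℕ} (hr : r ≤ n) :
    expectedCost μ (fun π => ENNReal.ofReal (∫ o, R o ∂μ π₀ - ∫ o, R o ∂μ π)) r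
        (fun z => ucb (ucbHistory ucb z)) ≤
      ucbConst μ R Rmax π₀ * ENNReal.ofReal (Real.log n) +
        3 * Fintype.card D * ENNReal.ofReal Rmax := by
  have hmean π := expectedReward_mem_Icc hR (hbound π)
  have hgap π : ∫ o, R o ∂μ π₀ - ∫ o, R o ∂μ π ≤ Rmax := by linarith [(hmean π).1, (hmean π₀).2]
  rcases ((hmean π₀).1.trans (hmean π₀).2).eq_or_lt with rfl | hRmax
  · refine (expectedCost_le_mul (C := 0) (fun z => ?_) r).trans (by simp)
    exact (ENNReal.ofReal_of_nonpos (hgap _)).le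
  · calc _ ≤ remainingCost μ R Rmax n π₀ [] +
          r * (ENNReal.ofReal Rmax * failPotential μ R Rmax n []) :=
        expectedCost_ucb_le_of_pos hR hbound hRmax hn hucb hgap hr
      _ ≤ (ucbConst μ R Rmax π₀ * ENNReal.ofReal (Real.log n) +
            Fintype.card D * ENNReal.ofReal Rmax) +
          ENNReal.ofReal Rmax * (n * failPotential μ R Rmax n []) := by
        rw [mul_left_comm]
        gcongr
        exact remainingCost_nil_le hgap
      _ ≤ (ucbConst μ R Rmax π₀ * ENNReal.ofReal (Real.log n) +
            Fintype.card D * ENNReal.ofReal Rmax) +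
          ENNReal.ofReal Rmax * (2 * Fintype.card D) := by
        exact add_le_add_right (mul_le_mul_right (natCast_mul_failPotential_nil_le hn) _) _
      _ = _ := by ring

end UCB

section KLDivergence

theorem klFun_mul (r x : ℝ) :
    klFun (r * x) = r * klFun x + x * (r * Real.log r) + (1 - r) := by
  rcases eq_or_ne r 0 with rfl | hr
  · simp [klFun_zero]
  rcases eq_or_ne x 0 with rfl | hx
  · simp [klFun_zero]
  rw [klFun_apply, klFun_apply, Real.log_mul hr hx]
  ring

theorem klFun_mul_le {η r x : ℝ} (hη1 : η < 1) (hr : |r - 1| ≤ η) (hx : 0 ≤ x) :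
    klFun (r * x) ≤ (1 + η) * klFun x + 2 * η * (x + 1) := by
  obtain ⟨hlower, hupper⟩ := abs_le.1 hr
  have hlog : r * Real.log r ≤ 2 * η := by
    have := mul_le_mul_of_nonneg_left (Real.log_le_sub_one_of_pos (by linarith : 0 < r))
      (by linarith : 0 ≤ r)
    nlinarith
  rw [klFun_mul]
  nlinarith [mul_le_mul_of_nonneg_left hlog hx,
    mul_le_mul_of_nonneg_right hupper (klFun_nonneg hx)]

theorem le_klFun_mul {η r x : ℝ} (hη1 : η < 1) (hr : |r - 1| ≤ η) (hx : 0 ≤ x) :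
    (1 - η) * klFun x ≤ klFun (r * x) + η * (x + 1) := by
  obtain ⟨hlower, hupper⟩ := abs_le.1 hr
  have hlog : -η ≤ r * Real.log r := by
    have := klFun_nonneg (by linarith : 0 ≤ r)
    rw [klFun_apply] at this
    linarith
  rw [klFun_mul]
  nlinarith [mul_le_mul_of_nonneg_left hlog hx,
    mul_le_mul_of_nonneg_right hlower (klFun_nonneg hx)]

theorem exists_eq_mul_of_abs_sub_le {p₀ p η : ℝ} (hη : 0 ≤ η) (hp₀ : 0 ≤ p₀)
    (h : |p - p₀| ≤ η * p₀) : ∃ r, p = r * p₀ ∧ |r - 1| ≤ η := by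
  rcases hp₀.eq_or_lt with rfl | hpos
  · exact ⟨1, by simpa using h, by simpa using hη⟩
  · refine ⟨p / p₀, by field_simp, ?_⟩
    rwa [div_sub_one hpos.ne', abs_div, abs_of_pos hpos, div_le_iff₀ hpos]

theorem mul_klFun_div_le {p₀ p q η : ℝ} (hp₀ : 0 ≤ p₀) (hq : 0 ≤ q) (hη : 0 ≤ η) (hη1 : η < 1)
    (h : |p - p₀| ≤ η * p₀) :
    q * klFun (p / q) ≤ (1 + η) * (q * klFun (p₀ / q)) + 2 * η * (p₀ + q) := by
  obtain ⟨r, rfl, hr⟩ := exists_eq_mul_of_abs_sub_le hη hp₀ h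
  rcases hq.eq_or_lt with rfl | hq
  · simpa using by positivity
  calc q * klFun (r * p₀ / q)
      ≤ q * ((1 + η) * klFun (p₀ / q) + 2 * η * (p₀ / q + 1)) := by
        rw [mul_div_assoc]
        exact mul_le_mul_of_nonneg_left (klFun_mul_le hη1 hr (by positivity)) hq.le
    _ = (1 + η) * (q * klFun (p₀ / q)) + 2 * η * (p₀ + q) := by field_simp

theorem le_mul_klFun_div {p₀ p q η : ℝ} (hp₀ : 0 ≤ p₀) (hq : 0 ≤ q) (hη : 0 ≤ η) (hη1 : η < 1)
    (h : |p - p₀| ≤ η * p₀) :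
    (1 - η) * (q * klFun (p₀ / q)) ≤ q * klFun (p / q) + η * (p₀ + q) := by
  obtain ⟨r, rfl, hr⟩ := exists_eq_mul_of_abs_sub_le hη hp₀ h
  rcases hq.eq_or_lt with rfl | hq
  · simpa using by positivity
  calc (1 - η) * (q * klFun (p₀ / q)) = q * ((1 - η) * klFun (p₀ / q)) := by ring
    _ ≤ q * (klFun (r * (p₀ / q)) + η * (p₀ / q + 1)) :=
        mul_le_mul_of_nonneg_left (le_klFun_mul hη1 hr (by positivity)) hq.le
    _ = q * klFun (r * p₀ / q) + η * (p₀ + q) := by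
        rw [← mul_div_assoc]
        field_simp

variable {O : Type*} [MeasurableSpace O] {ν : Measure O}

/-- The measure with density `p` with respect to `ν`, so that `law ν f π = densityLaw ν (f π)`. -/
abbrev densityLaw (ν : Measure O) (p : O → ℝ≥0) : Measure O :=
  ν.withDensity fun o => (p o : ℝ≥0∞)

/-- Probability densities with respect to `ν`. -/
structure IsDensity (ν : Measure O) (p : O → ℝ≥0) : Prop where
  measurable : Measurable p
  lintegral_eq_one : ∫⁻ o, (p o : ℝ≥0∞) ∂ν = 1

theorem IsDecisionProblem.isDensity {D : Type*} {R : O → ℝ} {Rmax : ℝ} {F : Set (Inst D O)}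
    (hF : IsDecisionProblem ν R Rmax F) {f : Inst D O} (hf : f ∈ F) (π : D) :
    IsDensity ν (f π) :=
  ⟨hF.measurable_density f hf π, hF.lintegral_density f hf π⟩

/-- `p` is a relative perturbation of `p₀` of size `η`. -/
def RelClose (ν : Measure O) (η : ℝ) (p₀ p : O → ℝ≥0) : Prop :=
  ∀ᵐ o ∂ν, |(p o : ℝ) - p₀ o| ≤ η * p₀ o

variable {p₀ p q : O → ℝ≥0} {η : ℝ}

theorem RelClose.eq_zero_iff (h : RelClose ν η p₀ p) (hη1 : η < 1) :
    ∀ᵐ o ∂ν, p o = 0 ↔ p₀ o = 0 := by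
  filter_upwards [h] with o ho
  have hlower : (1 - η) * p₀ o ≤ p o := by linarith [(abs_le.1 ho).1]
  refine ⟨fun hp => ?_, fun hp₀ => by
    simpa only [hp₀, NNReal.coe_zero, mul_zero, sub_zero, abs_nonpos_iff, NNReal.coe_eq_zero]
      using ho⟩
  rw [hp, NNReal.coe_zero] at hlower
  exact_mod_cast (nonpos_of_mul_nonpos_right hlower (sub_pos.2 hη1)).antisymm (p₀ o).coe_nonneg

theorem densityLaw_absolutelyContinuous_iff (hp : Measurable p) (hq : Measurable q) :
    densityLaw ν p ≪ densityLaw ν q ↔ ∀ᵐ o ∂ν, q o = 0 → p o = 0 := by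
  rw [← Measure.ae_le_iff_absolutelyContinuous]
  have hae {r : O → ℝ≥0} (hr : Measurable r) {P : O → Prop} :
      (∀ᵐ o ∂densityLaw ν r, P o) ↔ ∀ᵐ o ∂ν, r o ≠ 0 → P o := by
    simpa using ae_withDensity_iff (μ := ν) (p := P) hr.coe_nnreal_ennreal
  constructor
  · intro h
    filter_upwards [(hae hp).1 (h ((hae hq).2 (.of_forall fun o ho => ho)))] with o ho
    exact not_imp_not.1 ho
  · intro h s hs
    refine (hae hp).2 ?_
    filter_upwards [h, (hae hq).1 hs] with o ho hos hp0
    exact hos (mt ho hp0)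

theorem rnDeriv_densityLaw (hp : Measurable p) (hq : IsDensity ν q)
    (hac : ∀ᵐ o ∂ν, q o = 0 → p o = 0) :
    (densityLaw ν p).rnDeriv (densityLaw ν q) =ᵐ[densityLaw ν q]
      fun o => (p o : ℝ≥0∞) / q o := by
  have : IsProbabilityMeasure (densityLaw ν q) := ⟨by simp [hq.lintegral_eq_one]⟩
  have hq' := hq.measurable.coe_nnreal_ennreal
  have hratio : Measurable fun o => (p o : ℝ≥0∞) / q o := hp.coe_nnreal_ennreal.div hq'
  have heq : densityLaw ν p = (densityLaw ν q).withDensity fun o => (p o : ℝ≥0∞) / q o := by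
    rw [← withDensity_mul _ hq' hratio]
    refine withDensity_congr_ae ?_
    filter_upwards [hac] with o ho
    by_cases h0 : q o = 0
    · simp [h0, ho h0]
    · simp [ENNReal.mul_div_cancel (a := (q o : ℝ≥0∞)) (by simpa using h0)]
  rw [heq]
  exact Measure.rnDeriv_withDensity _ hratio

theorem klDiv_densityLaw (hp : IsDensity ν p) (hq : IsDensity ν q)
    (hac : ∀ᵐ o ∂ν, q o = 0 → p o = 0) :
    klDiv (densityLaw ν p) (densityLaw ν q) =
      ∫⁻ o, ENNReal.ofReal (q o * klFun (p o / q o)) ∂ν := by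
  have : IsProbabilityMeasure (densityLaw ν p) := ⟨by simp [hp.lintegral_eq_one]⟩
  have : IsProbabilityMeasure (densityLaw ν q) := ⟨by simp [hq.lintegral_eq_one]⟩
  have hp' := hp.measurable.coe_nnreal_ennreal
  have hq' := hq.measurable.coe_nnreal_ennreal
  rw [klDiv_eq_lintegral_klFun_of_ac
    ((densityLaw_absolutelyContinuous_iff hp.measurable hq.measurable).2 hac),
    lintegral_congr_ae ((rnDeriv_densityLaw hp.measurable hq hac).mono fun o ho =>
      congrArg (fun x => ENNReal.ofReal (klFun x.toReal)) ho),
    lintegral_withDensity_eq_lintegral_mul _ hq' (by fun_prop)]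
  refine lintegral_congr fun o => ?_
  simp [ENNReal.ofReal_mul]

theorem lintegral_ofReal_mul_add_density (hp : IsDensity ν p) (hq : IsDensity ν q) {c : ℝ}
    (hc : 0 ≤ c) : ∫⁻ o, ENNReal.ofReal (c * (p o + q o)) ∂ν = ENNReal.ofReal (2 * c) := by
  have hp' := hp.measurable.coe_nnreal_ennreal
  have hsplit o : ENNReal.ofReal (c * (p o + q o)) =
      ENNReal.ofReal c * ((p o : ℝ≥0∞) + q o) := by
    rw [ENNReal.ofReal_mul hc, ENNReal.ofReal_add (by positivity) (by positivity),
      ENNReal.ofReal_coe_nnreal, ENNReal.ofReal_coe_nnreal]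
  simp_rw [hsplit]
  rw [lintegral_const_mul' _ _ (by finiteness), lintegral_add_left hp', hp.lintegral_eq_one,
    hq.lintegral_eq_one, one_add_one_eq_two, mul_comm, ENNReal.ofReal_mul zero_le_two,
    ENNReal.ofReal_ofNat]

theorem RelClose.absolutelyContinuous_iff (h : RelClose ν η p₀ p) (hη1 : η < 1)
    (hp₀ : Measurable p₀) (hp : Measurable p) (hq : Measurable q) :
    densityLaw ν p ≪ densityLaw ν q ↔ densityLaw ν p₀ ≪ densityLaw ν q := by
  rw [densityLaw_absolutelyContinuous_iff hp hq, densityLaw_absolutelyContinuous_iff hp₀ hq]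
  refine eventually_congr ?_
  filter_upwards [h.eq_zero_iff hη1] with o ho
  rw [ho]

theorem RelClose.klDiv_le (h : RelClose ν η p₀ p) (hη : 0 ≤ η) (hη1 : η < 1)
    (hp₀ : IsDensity ν p₀) (hp : IsDensity ν p) (hq : IsDensity ν q) :
    klDiv (densityLaw ν p) (densityLaw ν q) ≤
      ENNReal.ofReal (1 + η) * klDiv (densityLaw ν p₀) (densityLaw ν q) +
        ENNReal.ofReal (4 * η) := by
  by_cases hac : densityLaw ν p₀ ≪ densityLaw ν q
  · have hac' := (h.absolutelyContinuous_iff hη1 hp₀.1 hp.1 hq.1).2 hac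
    have hmeas : Measurable fun o => ENNReal.ofReal (q o * klFun (p₀ o / q o)) := by
      have := hp₀.measurable
      have := hq.measurable
      fun_prop
    rw [klDiv_densityLaw hp hq ((densityLaw_absolutelyContinuous_iff hp.1 hq.1).1 hac'),
      klDiv_densityLaw hp₀ hq ((densityLaw_absolutelyContinuous_iff hp₀.1 hq.1).1 hac),
      show 4 * η = 2 * (2 * η) by ring,
      ← lintegral_ofReal_mul_add_density hp₀ hq (by positivity : 0 ≤ 2 * η),
      ← lintegral_const_mul _ hmeas, ← lintegral_add_left (hmeas.const_mul _)]
    refine lintegral_mono_ae ?_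
    filter_upwards [h] with o ho
    have : 0 ≤ klFun ((p₀ o : ℝ) / q o) := klFun_nonneg (by positivity)
    rw [← ENNReal.ofReal_mul (by positivity), ← ENNReal.ofReal_add (by positivity) (by positivity)]
    exact ENNReal.ofReal_le_ofReal
      (mul_klFun_div_le (p₀ o).coe_nonneg (q o).coe_nonneg hη hη1 ho)
  · rw [klDiv_of_not_ac hac, ENNReal.mul_top (by simpa using by linarith), top_add]
    exact le_top

theorem RelClose.le_klDiv (h : RelClose ν η p₀ p) (hη : 0 ≤ η) (hη1 : η < 1)
    (hp₀ : IsDensity ν p₀) (hp : IsDensity ν p) (hq : IsDensity ν q) :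
    ENNReal.ofReal (1 - η) * klDiv (densityLaw ν p₀) (densityLaw ν q) ≤
      klDiv (densityLaw ν p) (densityLaw ν q) + ENNReal.ofReal (2 * η) := by
  by_cases hac : densityLaw ν p ≪ densityLaw ν q
  · have hac₀ := (h.absolutelyContinuous_iff hη1 hp₀.1 hp.1 hq.1).1 hac
    have hmeas : Measurable fun o => ENNReal.ofReal (q o * klFun (p o / q o)) := by
      have := hp.measurable
      have := hq.measurable
      fun_prop
    rw [klDiv_densityLaw hp hq ((densityLaw_absolutelyContinuous_iff hp.1 hq.1).1 hac),
      klDiv_densityLaw hp₀ hq ((densityLaw_absolutelyContinuous_iff hp₀.1 hq.1).1 hac₀),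
      ← lintegral_ofReal_mul_add_density hp₀ hq hη,
      ← lintegral_const_mul' _ _ (by finiteness), ← lintegral_add_left hmeas]
    refine lintegral_mono_ae ?_
    filter_upwards [h] with o ho
    have : 0 ≤ klFun ((p o : ℝ) / q o) := klFun_nonneg (by positivity)
    rw [← ENNReal.ofReal_mul (by linarith), ← ENNReal.ofReal_add (by positivity) (by positivity)]
    exact ENNReal.ofReal_le_ofReal
      (le_mul_klFun_div (p₀ o).coe_nonneg (q o).coe_nonneg hη hη1 ho)
  · simp [klDiv_of_not_ac hac]

end KLDivergence

section DecaysSlowly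

/-- Functions that are eventually larger than every negative power of their argument: the accuracies
and Rényi orders of the algorithm, as functions of `ln n`, may tend to `0` only this slowly. -/
def DecaysSlowly (s : ℝ → ℝ) : Prop := ∀ θ : ℝ, 0 < θ → ∀ᶠ x in atTop, x ^ (-θ) ≤ s x

variable {s t : ℝ → ℝ}

theorem DecaysSlowly.eventually_pos (hs : DecaysSlowly s) : ∀ᶠ x in atTop, 0 < s x := by
  filter_upwards [hs 1 one_pos, eventually_gt_atTop 0] with x hx h0
  exact (Real.rpow_pos_of_pos h0 _).trans_le hx

theorem DecaysSlowly.const {c : ℝ} (hc : 0 < c) : DecaysSlowly fun _ => c := fun _ hθ =>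
  (tendsto_rpow_neg_atTop hθ).eventually_le_const hc

theorem DecaysSlowly.mul (hs : DecaysSlowly s) (ht : DecaysSlowly t) :
    DecaysSlowly fun x => s x * t x := by
  intro θ hθ
  filter_upwards [hs (θ / 2) (by positivity), ht (θ / 2) (by positivity), eventually_gt_atTop 0]
    with x hsx htx hx
  calc x ^ (-θ) = x ^ (-(θ / 2)) * x ^ (-(θ / 2)) := by
        rw [← Real.rpow_add hx]
        ring_nf
    _ ≤ s x * t x := mul_le_mul hsx htx (by positivity) (le_trans (by positivity) hsx)

theorem DecaysSlowly.min (hs : DecaysSlowly s) (ht : DecaysSlowly t) :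
    DecaysSlowly fun x => min (s x) (t x) := fun θ hθ => by
  filter_upwards [hs θ hθ, ht θ hθ] with x hsx htx using le_min hsx htx

theorem DecaysSlowly.rpow (hs : DecaysSlowly s) {p : ℝ} (hp : 0 < p) :
    DecaysSlowly fun x => s x ^ p := by
  intro θ hθ
  filter_upwards [hs (θ / p) (by positivity), eventually_gt_atTop 0] with x hsx hx
  calc x ^ (-θ) = (x ^ (-(θ / p))) ^ p := by
        rw [← Real.rpow_mul hx.le]
        congr 1
        field_simp
    _ ≤ s x ^ p := by gcongr

theorem decaysSlowly_inv_log : DecaysSlowly fun x => (Real.log x)⁻¹ := by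
  intro θ hθ
  filter_upwards [(isLittleO_log_rpow_atTop hθ).bound one_pos, eventually_gt_atTop 1] with x hx h1
  have hlog : 0 < Real.log x := Real.log_pos h1
  rw [Real.norm_of_nonneg hlog.le, one_mul, Real.norm_of_nonneg (by positivity)] at hx
  rw [Real.rpow_neg (by linarith)]
  exact inv_anti₀ hlog hx

end DecaysSlowly

section Affinity

variable {D O : Type*} [MeasurableSpace O] {ν : Measure O} {p q : O → ℝ≥0} {lam : ℝ}

/-- The Hellinger affinity `∫ p^(1-λ) q^λ dν`, whose logarithm is `-λ` times the Rényi divergence of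
order `1 - λ`. -/
def affinity (ν : Measure O) (lam : ℝ) (p q : O → ℝ≥0) : ℝ≥0∞ :=
  ∫⁻ o, (p o : ℝ≥0∞) ^ (1 - lam) * (q o : ℝ≥0∞) ^ lam ∂ν

theorem renyi_one_sub (ν : Measure O) (lam : ℝ) (p q : O → ℝ≥0) :
    renyi ν (1 - lam) p q = ((-(1 / lam) : ℝ) : EReal) * ENNReal.log (affinity ν lam p q) := by
  unfold renyi affinity
  rw [sub_sub_cancel, show 1 - lam - 1 = -lam by ring, one_div_neg_eq_neg_one_div]

theorem affinity_le_of_le_renyi {d : ℝ} (hlam : 0 < lam)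
    (h : (d : EReal) ≤ renyi ν (1 - lam) p q) :
    affinity ν lam p q ≤ ENNReal.ofReal (Real.exp (-(lam * d))) := by
  rw [renyi_one_sub] at h
  have hneg : -(1 / lam) < 0 := neg_lt_zero.2 (by positivity)
  rcases eq_or_ne (affinity ν lam p q) 0 with h0 | h0
  · exact h0.le.trans zero_le
  rcases eq_or_ne (affinity ν lam p q) ⊤ with htop | htop
  · rw [htop, ENNReal.log_top, EReal.coe_mul_top_of_neg hneg] at h
    exact absurd (le_bot_iff.1 h) (EReal.coe_ne_bot _)
  rw [ENNReal.log_pos_real h0 htop, ← EReal.coe_mul, EReal.coe_le_coe_iff] at h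
  rw [← ENNReal.ofReal_toReal htop]
  refine ENNReal.ofReal_le_ofReal ?_
  rw [← Real.log_le_iff_le_exp (ENNReal.toReal_pos h0 htop), le_neg]
  calc lam * d ≤ lam * (-(1 / lam) * Real.log (affinity ν lam p q).toReal) := by gcongr
    _ = -Real.log (affinity ν lam p q).toReal := by field_simp

theorem affinity_le_one (hp : IsDensity ν p) (hq : IsDensity ν q) (h0 : 0 ≤ lam)
    (h1 : lam ≤ 1) : affinity ν lam p q ≤ 1 := by
  have hp' := hp.measurable.coe_nnreal_ennreal
  have hq' := hq.measurable.coe_nnreal_ennreal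
  have hgm o : (p o : ℝ≥0∞) ^ (1 - lam) * (q o : ℝ≥0∞) ^ lam ≤
      ENNReal.ofReal (1 - lam) * p o + ENNReal.ofReal lam * q o := by
    have := NNReal.geom_mean_le_arith_mean2_weighted (1 - lam).toNNReal lam.toNNReal
      (p o) (q o) (by rw [← Real.toNNReal_add (by linarith) h0]; simp)
    rw [Real.coe_toNNReal _ (by linarith), Real.coe_toNNReal _ h0] at this
    rw [← ENNReal.coe_rpow_of_nonneg _ (by linarith), ← ENNReal.coe_rpow_of_nonneg _ h0]
    unfold ENNReal.ofReal
    exact_mod_cast this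
  refine (lintegral_mono hgm).trans_eq ?_
  rw [lintegral_add_left (hp'.const_mul _), lintegral_const_mul _ hp', lintegral_const_mul _ hq',
    hp.lintegral_eq_one, hq.lintegral_eq_one, mul_one, mul_one,
    ← ENNReal.ofReal_add (by linarith) h0, sub_add_cancel, ENNReal.ofReal_one]

theorem affinity_ne_zero (hp : Measurable p) (hq : IsDensity ν q)
    (h : ∀ o, q o ≠ 0 → p o ≠ 0) : affinity ν lam p q ≠ 0 := by
  intro hzero
  have hq' := hq.measurable.coe_nnreal_ennreal
  rw [affinity, lintegral_eq_zero_iff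
    ((hp.coe_nnreal_ennreal.pow_const _).fun_mul (hq'.pow_const _))] at hzero
  have hq0 : (fun o => (q o : ℝ≥0∞)) =ᵐ[ν] 0 := by
    filter_upwards [hzero] with o ho
    by_contra hqo
    have hqo' : q o ≠ 0 := by simpa using hqo
    exact mul_ne_zero (by simp [ENNReal.rpow_eq_zero_iff, h o hqo'])
      (by simp [ENNReal.rpow_eq_zero_iff, hqo']) ho
  simpa [lintegral_congr_ae hq0] using hq.lintegral_eq_one

theorem affinity_half_eq_zero_of_kl_eq_top {F : Set (Inst D O)}
    (hRenyi : RenyiUniformConvergence ν F) {f g : Inst D O} (hf : f ∈ F) (hg : g ∈ F) {π : D}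
    (hkl : kl ν f g π = ⊤) : affinity ν (1 / 2) (f π) (g π) = 0 := by
  obtain ⟨c₁, c₂, c₃, ι, lam₀, hc₁, hc₂, -, hι, hlam₀⟩ := hRenyi
  have hbound (α : ℝ) (hα : 0 < α) :
      affinity ν (1 / 2) (f π) (g π) ≤ ENNReal.ofReal (Real.exp (-(1 / 2 * α))) := by
    have hc : 0 < min (1 / α) c₂ ^ c₃ * ι f :=
      mul_pos (Real.rpow_pos_of_pos (lt_min (by positivity) hc₂) _) (hι f hf)
    have hlim : Tendsto (fun ε : ℝ => ε ^ c₁ * (min (1 / α) c₂ ^ c₃ * ι f)) atTop atTop :=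
      (tendsto_rpow_atTop hc₁).atTop_mul_const hc
    obtain ⟨ε, hε1, hε⟩ := ((hlim.eventually_ge_atTop (1 / 2)).and (eventually_gt_atTop 0)).exists
    obtain ⟨-, hlam, hmin⟩ := hlam₀ α hα ε hε f hf
    rw [mul_assoc] at hlam
    have hle := hmin (1 / 2) (by norm_num) (by norm_num) (hε1.trans hlam) g hg π
    rw [hkl, EReal.coe_ennreal_top, EReal.top_sub_coe, min_eq_right le_top] at hle
    exact affinity_le_of_le_renyi (by norm_num) hle
  have hlim : Tendsto (fun α : ℝ => ENNReal.ofReal (Real.exp (-(1 / 2 * α)))) atTop (𝓝 0) := by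
    rw [← ENNReal.ofReal_zero]
    exact ENNReal.tendsto_ofReal (Real.tendsto_exp_neg_atTop_nhds_zero.comp
      (tendsto_id.const_mul_atTop (by norm_num)))
  exact le_antisymm (ge_of_tendsto hlim ((eventually_gt_atTop 0).mono hbound)) zero_le

/-- The truncation `min (x - ε) α` of a divergence `x`; the subtraction in `ℝ≥0∞` also truncates it
below at `0`. -/
def clip (ε α : ℝ) (x : ℝ≥0∞) : ℝ := (min (x - ENNReal.ofReal ε) (ENNReal.ofReal α)).toReal

theorem clip_nonneg (ε α : ℝ) (x : ℝ≥0∞) : 0 ≤ clip ε α x := ENNReal.toReal_nonneg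

theorem clip_le (ε : ℝ) {α : ℝ} (hα : 0 ≤ α) (x : ℝ≥0∞) : clip ε α x ≤ α :=
  ENNReal.toReal_le_of_le_ofReal hα (min_le_right _ _)

theorem clip_eq_zero {ε : ℝ} {x : ℝ≥0∞} (h : x ≤ ENNReal.ofReal ε) (α : ℝ) :
    clip ε α x = 0 := by
  simp [clip, tsub_eq_zero_of_le h]

theorem le_clip {ε α d : ℝ} {x : ℝ≥0∞} (hε : 0 ≤ ε) (hd : 0 ≤ d) (hdα : d ≤ α)
    (hx : ENNReal.ofReal (d + ε) ≤ x) : d ≤ clip ε α x := by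
  rw [clip, ← ENNReal.ofReal_le_iff_le_toReal (ne_top_of_le_ne_top (by simp) (min_le_right _ _))]
  refine le_min (ENNReal.le_sub_of_add_le_right (by simp) ?_) (ENNReal.ofReal_le_ofReal hdα)
  rwa [← ENNReal.ofReal_add hd hε]

theorem coe_clip_le {ε α : ℝ} {x : ℝ≥0∞} (hε : 0 ≤ ε) (hα : 0 ≤ α)
    (hx : ENNReal.ofReal ε ≤ x) : (clip ε α x : EReal) ≤ min (x - (ε : EReal)) α := by
  rw [clip]
  rcases eq_or_ne x ⊤ with rfl | hxtop
  · simp [hα]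
  have hx' : ε ≤ x.toReal := (ENNReal.ofReal_le_iff_le_toReal hxtop).1 hx
  rw [← ENNReal.ofReal_toReal hxtop, ← ENNReal.ofReal_sub _ hε, ← ENNReal.ofReal_min,
    ENNReal.toReal_ofReal (le_min (by linarith) hα), EReal.coe_ennreal_ofReal,
    max_eq_left ENNReal.toReal_nonneg, ← EReal.coe_sub]
  exact EReal.coe_strictMono.monotone.map_min.le

/-- The form in which the Rényi condition enters the deviation bounds: every alternative has
affinity at most `exp (-λ d)` with `f`, where `d` is the truncated KL divergence. -/
def AffinityBound (ν : Measure O) (F : Set (Inst D O)) (f : Inst D O) (lam ε α : ℝ) : Prop :=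
  ∀ g ∈ F, ∀ π, affinity ν lam (f π) (g π) ≤
    ENNReal.ofReal (Real.exp (-(lam * clip ε α (kl ν f g π))))

variable {R : O → ℝ} {Rmax : ℝ} {F : Set (Inst D O)}

theorem affinityBound_of_min_le_renyi (hF : IsDecisionProblem ν R Rmax F) {f : Inst D O}
    (hf : f ∈ F) {ε α : ℝ} (hε : 0 ≤ ε) (hα : 0 ≤ α) (h0 : 0 < lam) (h1 : lam ≤ 1)
    (h : ∀ g ∈ F, ∀ π, min ((kl ν f g π : EReal) - ε) α ≤ renyi ν (1 - lam) (f π) (g π)) :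
    AffinityBound ν F f lam ε α := by
  intro g hg π
  rcases le_total (kl ν f g π) (ENNReal.ofReal ε) with hsmall | hlarge
  · rw [clip_eq_zero hsmall, mul_zero, neg_zero, Real.exp_zero, ENNReal.ofReal_one]
    exact affinity_le_one (hF.isDensity hf π) (hF.isDensity hg π) h0.le h1
  · exact affinity_le_of_le_renyi h0 ((coe_clip_le hε hα hlarge).trans (h g hg π))

theorem exists_decaysSlowly_affinityBound (hF : IsDecisionProblem ν R Rmax F)
    (hRenyi : RenyiUniformConvergence ν F) {f : Inst D O} (hf : f ∈ F) {ε α : ℝ → ℝ}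
    (hε : DecaysSlowly ε) (hα : DecaysSlowly fun x => 1 / α x) :
    ∃ lam : ℝ → ℝ, DecaysSlowly lam ∧ ∀ᶠ x in atTop,
      0 < lam x ∧ lam x ≤ 1 / 2 ∧ AffinityBound ν F f (lam x) (ε x) (α x) := by
  obtain ⟨c₁, c₂, c₃, ι, lam₀, hc₁, hc₂, hc₃, hι, hlam₀⟩ := hRenyi
  let lam x := min (1 / 2) (ε x ^ c₁ * min (1 / α x) c₂ ^ c₃ * ι f)
  have hlam : DecaysSlowly lam := (DecaysSlowly.const (by norm_num)).min
    (((hε.rpow hc₁).mul ((hα.min (.const hc₂)).rpow hc₃)).mul (.const (hι f hf)))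
  refine ⟨lam, hlam, ?_⟩
  filter_upwards [hlam.eventually_pos, hε.eventually_pos, hα.eventually_pos]
    with x hlamx hεx hαx
  have hαx := one_div_pos.1 hαx
  have hhalf : lam x ≤ 1 / 2 := min_le_left _ _
  obtain ⟨-, hle, hmin⟩ := hlam₀ (α x) hαx (ε x) hεx f hf
  exact ⟨hlamx, hhalf, affinityBound_of_min_le_renyi hF hf hεx.le hαx.le hlamx (by linarith)
    (hmin _ hlamx (by linarith) ((min_le_right _ _).trans hle))⟩

end Affinity

section SupDistance

variable {D O : Type*} {p q p₀ : O → ℝ≥0} {r cmin η : ℝ}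

theorem abs_sub_le_of_densityDist_le (hr : 0 ≤ r) (h : densityDist p q ≤ ENNReal.ofReal r)
    (o : O) : |(q o : ℝ) - p o| ≤ r := by
  have := (le_iSup (fun o => edist (p o) (q o)) o).trans h
  rwa [edist_dist, ENNReal.ofReal_le_ofReal_iff hr, NNReal.dist_eq, abs_sub_comm] at this

theorem densityDist_le_instDist (f g : Inst D O) (π : D) :
    densityDist (f π) (g π) ≤ instDist f g := le_iSup (fun π => densityDist (f π) (g π)) π

theorem instDist_self (f : Inst D O) : instDist f f = 0 := by simp [instDist, densityDist]

theorem instDist_comm (f g : Inst D O) : instDist f g = instDist g f := by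
  simp only [instDist, densityDist, edist_comm]

theorem instDist_triangle (f g h : Inst D O) : instDist f h ≤ instDist f g + instDist g h :=
  iSup_le fun π => iSup_le fun o => (edist_triangle _ (g π o) _).trans (add_le_add
    ((le_iSup (fun o => edist (f π o) (g π o)) o).trans (densityDist_le_instDist f g π))
    ((le_iSup (fun o => edist (g π o) (h π o)) o).trans (densityDist_le_instDist g h π)))

theorem one_sub_mul_le_of_densityDist_le (hcmin : 0 < cmin)
    (hmin : ∀ o, p₀ o ≠ 0 → cmin < p₀ o) (hη : 0 ≤ η)
    (hd : densityDist p₀ p ≤ ENNReal.ofReal (cmin * η)) {o : O} (ho : p₀ o ≠ 0) :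
    (1 - η) * p₀ o ≤ p o := by
  have hdist := (abs_le.1 (abs_sub_le_of_densityDist_le (by positivity) hd o)).1
  nlinarith [mul_le_mul_of_nonneg_right (hmin o ho).le hη]

theorem coe_le_ofReal_mul_of_densityDist_le (hcmin : 0 < cmin)
    (hmin : ∀ o, p₀ o ≠ 0 → cmin < p₀ o) (hη : 0 ≤ η) (hη1 : η ≤ 1 / 2)
    (hd : densityDist p₀ p ≤ ENNReal.ofReal (cmin * η)) {o : O} (ho : p₀ o ≠ 0) :
    (p₀ o : ℝ≥0∞) ≤ ENNReal.ofReal (1 + 2 * η) * p o := by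
  have hle : (p₀ o : ℝ) ≤ (1 + 2 * η) * p o :=
    calc (p₀ o : ℝ) ≤ (1 + 2 * η) * ((1 - η) * p₀ o) := by
          nlinarith [mul_nonneg (p₀ o).coe_nonneg (mul_nonneg hη (sub_nonneg.2 hη1))]
      _ ≤ _ := by gcongr; exact one_sub_mul_le_of_densityDist_le hcmin hmin hη hd ho
  rw [← ENNReal.ofReal_coe_nnreal, ← ENNReal.ofReal_coe_nnreal,
    ← ENNReal.ofReal_mul (by positivity)]
  exact ENNReal.ofReal_le_ofReal hle

variable [MeasurableSpace O] {ν : Measure O}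

theorem relClose_of_densityDist_le (hcmin : 0 < cmin) (hmin : ∀ o, p₀ o ≠ 0 → cmin < p₀ o)
    (hac : ∀ᵐ o ∂ν, p₀ o = 0 → p o = 0) (hη : 0 ≤ η)
    (hd : densityDist p₀ p ≤ ENNReal.ofReal (cmin * η)) : RelClose ν η p₀ p := by
  filter_upwards [hac] with o ho
  by_cases h0 : p₀ o = 0
  · simp [h0, ho h0]
  · have := abs_sub_le_of_densityDist_le (by positivity) hd o
    nlinarith [mul_le_mul_of_nonneg_right (hmin o h0).le hη]

variable {R : O → ℝ} {Rmax : ℝ} {F : Set (Inst D O)}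

/-- Closeness in sup-distance alone does not prevent `f` from putting mass outside the support of
`f₀`; that is excluded because the affinity of `f` and `f₀` does not vanish, so that by the Rényi
condition their KL divergence is finite. -/
theorem relClose_of_instDist_le (hF : IsDecisionProblem ν R Rmax F)
    (hRenyi : RenyiUniformConvergence ν F) {f₀ f : Inst D O} (hf₀ : f₀ ∈ F) (hf : f ∈ F)
    (hcmin : 0 < cmin) (hmin : ∀ π o, f₀ π o ≠ 0 → cmin < f₀ π o) (hη : 0 ≤ η) (hη1 : η < 1)
    (hd : instDist f₀ f ≤ ENNReal.ofReal (cmin * η)) (π : D) : RelClose ν η (f₀ π) (f π) := by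
  have hdπ := (densityDist_le_instDist f₀ f π).trans hd
  refine relClose_of_densityDist_le hcmin (hmin π) ?_ hη hdπ
  rw [← densityLaw_absolutelyContinuous_iff (hF.isDensity hf π).1 (hF.isDensity hf₀ π).1]
  by_contra hac
  refine affinity_ne_zero (hF.isDensity hf π).1 (hF.isDensity hf₀ π) (fun o ho hfo => ?_)
    (affinity_half_eq_zero_of_kl_eq_top hRenyi hf hf₀ (klDiv_of_not_ac hac))
  have hlower := one_sub_mul_le_of_densityDist_le hcmin (hmin π) hη hdπ ho
  rw [hfo, NNReal.coe_zero] at hlower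
  have hpos : (0 : ℝ) < f₀ π o := hcmin.trans (hmin π o ho)
  nlinarith

end SupDistance

section RewardContinuity

variable {D O : Type*} [MeasurableSpace O] {ν : Measure O} {R : O → ℝ} {Rmax η s : ℝ}
  {F : Set (Inst D O)} {f₀ f : Inst D O}

theorem meanReward_eq_integral_smul (hF : IsDecisionProblem ν R Rmax F) (hf : f ∈ F) (π : D) :
    meanReward ν R f π = ∫ o, f π o • max 0 (min (R o) Rmax) ∂ν := by
  rw [← integral_withDensity_eq_integral_smul (hF.measurable_density f hf π)]
  refine integral_congr_ae ?_
  filter_upwards [hF.bounded_reward f hf π] with o ho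
  rw [min_eq_left ho.2, max_eq_right ho.1]

theorem integrable_smul_reward (hF : IsDecisionProblem ν R Rmax F) (hf : f ∈ F) (π : D) :
    Integrable (fun o => f π o • max 0 (min (R o) Rmax)) ν := by
  have := hF.isProbabilityMeasure hf π
  rw [← integrable_withDensity_iff_integrable_smul (hF.measurable_density f hf π)]
  refine (hF.integrable_reward hf π).congr ?_
  filter_upwards [hF.bounded_reward f hf π] with o ho
  rw [min_eq_left ho.2, max_eq_right ho.1]

theorem abs_meanReward_sub_le [IsFiniteMeasure ν] (hF : IsDecisionProblem ν R Rmax F)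
    (hf₀ : f₀ ∈ F) (hf : f ∈ F) (hR : 0 ≤ Rmax) (hη : 0 ≤ η) {π : D}
    (hd : densityDist (f₀ π) (f π) ≤ ENNReal.ofReal η) :
    |meanReward ν R f π - meanReward ν R f₀ π| ≤ Rmax * ν.real Set.univ * η := by
  rw [meanReward_eq_integral_smul hF hf, meanReward_eq_integral_smul hF hf₀,
    ← integral_sub (integrable_smul_reward hF hf π) (integrable_smul_reward hF hf₀ π),
    ← Real.norm_eq_abs]
  refine (norm_integral_le_of_norm_le_const (C := η * Rmax) (ae_of_all _ fun o => ?_)).trans_eq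
    (by ring)
  rw [NNReal.smul_def, NNReal.smul_def, ← sub_smul, norm_smul, Real.norm_eq_abs,
    Real.norm_of_nonneg (le_max_left _ _)]
  exact mul_le_mul (abs_sub_le_of_densityDist_le hη hd o) (max_le hR (min_le_right _ _))
    (le_max_left _ _) hη

variable [Fintype D] [Nonempty D]

theorem meanReward_le_best (ν : Measure O) (R : O → ℝ) (f : Inst D O) (π : D) :
    meanReward ν R f π ≤ meanReward ν R f (best ν R f) :=
  Classical.choose_spec (Finite.exists_max (meanReward ν R f)) π

theorem gap_pos_of_ne_best (hF : IsDecisionProblem ν R Rmax F) (hf : f ∈ F) {π : D}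
    (h : π ≠ best ν R f) : 0 < gap ν R f π := by
  refine (gap_nonneg ν R f π).lt_of_ne fun h0 => h ?_
  have hmax : meanReward ν R f π = meanReward ν R f (best ν R f) := (sub_eq_zero.1 h0.symm).symm
  exact (hF.unique_optimal f hf).unique (fun π' => hmax ▸ meanReward_le_best ν R f π')
    (meanReward_le_best ν R f)

theorem best_eq_of_meanReward_close (hs : ∀ π, π ≠ best ν R f₀ → 2 * s < gap ν R f₀ π)
    (hd : ∀ π, |meanReward ν R f π - meanReward ν R f₀ π| ≤ s) : best ν R f = best ν R f₀ := by
  by_contra hne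
  have hgap := hs _ hne
  have hf := (abs_le.1 (hd (best ν R f))).2
  have hf₀ := (abs_le.1 (hd (best ν R f₀))).1
  unfold gap at hgap
  linarith [meanReward_le_best ν R f (best ν R f₀)]

theorem abs_gap_sub_le (hbest : best ν R f = best ν R f₀)
    (hd : ∀ π, |meanReward ν R f π - meanReward ν R f₀ π| ≤ s) (π : D) :
    |gap ν R f π - gap ν R f₀ π| ≤ 2 * s := by
  unfold gap
  rw [hbest, sub_sub_sub_comm]
  exact (abs_sub _ _).trans (by linarith [hd π, hd (best ν R f₀)])

end RewardContinuity

section Covers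

variable {D O : Type*} {F G : Set (Inst D O)} {ε : ℝ}

theorem exists_finset_card_le_coveringNumber (hfin : coveringNumber F ε ≠ ⊤) :
    ∃ C : Finset (Inst D O), C.card ≤ (coveringNumber F ε).toNat ∧
      ∀ g ∈ F, ∃ g' ∈ C, instDist g g' ≤ ENNReal.ofReal ε := by
  obtain ⟨⟨C, _, hcover⟩, hC⟩ := csInf_mem (Set.range_nonempty (ι := {C : Set (Inst D O) //
    C ⊆ F ∧ ∀ g ∈ F, ∃ g' ∈ C, instDist g g' ≤ ENNReal.ofReal ε})
    (fun C => C.1.encard) (h := ⟨F, subset_rfl, fun g hg => ⟨g, hg, by simp [instDist_self]⟩⟩))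
  have hcard : C.encard = coveringNumber F ε := by rw [coveringNumber, iInf_subtype']; exact hC
  have hCfin : C.Finite := Set.encard_ne_top_iff.1 (hcard ▸ hfin)
  refine ⟨hCfin.toFinset, ?_, by simpa using hcover⟩
  rw [← hcard, hCfin.encard_eq_coe_toFinset_card, ENat.toNat_natCast]

/-- The centres of a cover of `F` need not lie in `G`; replacing each by a nearby element of `G`
doubles the radius. -/
theorem exists_finset_subset_of_subset (hG : G ⊆ F) (hε : 0 ≤ ε)
    (hfin : coveringNumber F ε ≠ ⊤) :
    ∃ J : Finset (Inst D O), ↑J ⊆ G ∧ J.card ≤ (coveringNumber F ε).toNat ∧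
      ∀ g ∈ G, ∃ j ∈ J, instDist g j ≤ ENNReal.ofReal (2 * ε) := by
  classical
  obtain ⟨C, hcard, hcover⟩ := exists_finset_card_le_coveringNumber hfin
  let near g' := ∃ g ∈ G, instDist g g' ≤ ENNReal.ofReal ε
  have hrep (g') : ∃ g, near g' → g ∈ G ∧ instDist g g' ≤ ENNReal.ofReal ε := by
    by_cases h : near g'
    · exact h.imp fun _ hg _ => hg
    · exact ⟨g', fun h' => (h h').elim⟩
  choose rep hrep using hrep
  refine ⟨(C.filter near).image rep, ?_,
    Finset.card_image_le.trans ((Finset.card_filter_le _ _).trans hcard), fun g hg => ?_⟩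
  · intro j hj
    obtain ⟨g', hg', rfl⟩ := Finset.mem_image.1 hj
    exact (hrep g' (Finset.mem_filter.1 hg').2).1
  · obtain ⟨g', hg', hd⟩ := hcover g (hG hg)
    have hnear : near g' := ⟨g, hg, hd⟩
    refine ⟨rep g', Finset.mem_image_of_mem _ (Finset.mem_filter.2 ⟨hg', hnear⟩), ?_⟩
    calc instDist g (rep g') ≤ instDist g g' + instDist g' (rep g') := instDist_triangle _ _ _
      _ ≤ ENNReal.ofReal ε + ENNReal.ofReal ε :=
        add_le_add hd (instDist_comm g' _ ▸ (hrep g' hnear).2)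
      _ = ENNReal.ofReal (2 * ε) := by rw [← ENNReal.ofReal_add hε hε, two_mul]

theorem coe_le_add_of_instDist_le {f g : Inst D O} (h : instDist f g ≤ ENNReal.ofReal ε) (π : D)
    (o : O) : (f π o : ℝ≥0∞) ≤ g π o + ENNReal.ofReal ε := by
  have hd : edist (f π o) (g π o) ≤ ENNReal.ofReal ε :=
    ((le_iSup (fun o => edist (f π o) (g π o)) o).trans (densityDist_le_instDist f g π)).trans h
  rw [ENNReal.ofReal, edist_nndist, ENNReal.coe_le_coe] at hd
  rw [ENNReal.ofReal]
  exact_mod_cast (NNReal.le_add_nndist (f π o) (g π o)).trans (by gcongr)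

end Covers

section LikelihoodRatios

variable {ι : Type*} {p q f v : ι → ℝ≥0∞} {c : ℝ≥0∞} {l : List ι}

theorem prod_map_ne_zero (hv : ∀ i ∈ l, v i ≠ 0) : (l.map v).prod ≠ 0 :=
  List.prod_ne_zero (by simpa using hv)

theorem prod_map_ne_top (hv : ∀ i ∈ l, v i ≠ ⊤) : (l.map v).prod ≠ ⊤ := by
  induction l with
  | nil => simp
  | cons i l ih =>
    rw [List.forall_mem_cons] at hv
    rw [List.map_cons, List.prod_cons]
    exact ENNReal.mul_ne_top hv.1 (ih hv.2)

theorem prod_map_rpow {lam : ℝ} (hlam : 0 ≤ lam) (l : List ι) (v : ι → ℝ≥0∞) :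
    (l.map fun i => v i ^ lam).prod = (l.map v).prod ^ lam := by
  induction l with
  | nil => simp
  | cons i l ih =>
    simp only [List.map_cons, List.prod_cons, ih, ENNReal.mul_rpow_of_nonneg _ _ hlam]

theorem sum_map_log (l : List ι) (v : ι → ℝ≥0∞) :
    (l.map fun i => ENNReal.log (v i)).sum = ENNReal.log (l.map v).prod := by
  induction l with
  | nil => simp
  | cons i l ih => simp only [List.map_cons, List.sum_cons, List.prod_cons, ENNReal.log_mul_add, ih]

theorem prod_map_div_eq_top (hv : ∀ i, v i ≠ 0) (hp : ∀ i, p i ≠ ⊤) {i : ι} (hi : i ∈ l)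
    (hpi : p i = 0) : (l.map fun i => v i / p i).prod = ⊤ := by
  obtain ⟨s, t, rfl⟩ := List.append_of_mem hi
  have hne (l : List ι) : (l.map fun i => v i / p i).prod ≠ 0 :=
    prod_map_ne_zero fun i _ => ENNReal.div_ne_zero.2 ⟨hv i, hp i⟩
  rw [List.map_append, List.prod_append, List.map_cons, List.prod_cons, hpi,
    ENNReal.div_zero (hv i), ENNReal.top_mul (hne t), ENNReal.mul_top (hne s)]

/-- Up to the factor `c`, the density `q` explains the sample `l` at least as well as `p`. The
ratio is taken for strictly positive majorants `v` of `q`, which avoids the case `0 / 0 = 0` and is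
what covering arguments provide. -/
def Outweighs (c : ℝ≥0∞) (p q : ι → ℝ≥0∞) (l : List ι) : Prop :=
  ∀ v : ι → ℝ≥0∞, (∀ i, v i ≠ 0) → (∀ i, q i ≤ v i) → 1 ≤ c * (l.map fun i => v i / p i).prod

theorem Outweighs.mono (h : Outweighs c p q l) {c' : ℝ≥0∞} (hc : c ≤ c') : Outweighs c' p q l :=
  fun v hv hqv => (h v hv hqv).trans (by gcongr)

theorem outweighs_of_forall_ne_zero (hc : c ≠ 0) (hp : ∀ i, p i ≠ ⊤)
    (h : (∀ i ∈ l, p i ≠ 0) → Outweighs c p q l) : Outweighs c p q l := by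
  intro v hv hqv
  by_cases hzero : ∀ i ∈ l, p i ≠ 0
  · exact h hzero v hv hqv
  · push Not at hzero
    obtain ⟨i, hi, hpi⟩ := hzero
    rw [prod_map_div_eq_top hv hp hi hpi, ENNReal.mul_top hc]
    exact le_top

theorem outweighs_of_prod_le (hc : c ≠ 0) (hp : ∀ i, p i ≠ ⊤)
    (h : (l.map p).prod ≤ c * (l.map q).prod) : Outweighs c p q l := by
  refine outweighs_of_forall_ne_zero hc hp fun hp0 v _ hqv => ?_
  have hq : (l.map q).prod ≤ (l.map fun i => v i / p i).prod * (l.map p).prod := by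
    rw [← List.prod_map_mul]
    refine List.prod_le_prod' fun i hi => ?_
    rw [ENNReal.div_mul_cancel (hp0 i hi) (hp i)]
    exact hqv i
  refine (ENNReal.mul_le_mul_iff_left (prod_map_ne_zero hp0) (prod_map_ne_top fun i _ => hp i)).1 ?_
  rw [one_mul, mul_assoc]
  exact h.trans (by gcongr)

theorem outweighs_of_prod_div_le {a x : ℝ≥0∞} (ha : a ≠ 0) (hx : x ≠ 0) (hp : ∀ i, p i ≠ ⊤)
    (hq : ∀ i, q i ≠ ⊤) (hpf : ∀ i, p i ≠ 0 → p i ≤ a * f i)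
    (h : (l.map fun i => f i / q i).prod ≤ x) : Outweighs (x * a ^ l.length) p q l := by
  refine outweighs_of_forall_ne_zero (mul_ne_zero hx (pow_ne_zero _ ha)) hp fun hp0 v hv hqv => ?_
  have hone : ∀ i ∈ l, 1 ≤ a * ((v i / p i) * (f i / q i)) := by
    intro i hi
    have hfi : f i ≠ 0 := fun hfi => hp0 i hi (by simpa [hfi] using hpf i (hp0 i hi))
    by_cases hqi : q i = 0
    · rw [hqi, ENNReal.div_zero hfi, ENNReal.mul_top (ENNReal.div_ne_zero.2 ⟨hv i, hp i⟩),
        ENNReal.mul_top ha]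
      exact le_top
    calc (1 : ℝ≥0∞) = (p i / p i) * (q i / q i) := by
          rw [ENNReal.div_self (hp0 i hi) (hp i), ENNReal.div_self hqi (hq i), one_mul]
      _ ≤ (a * f i / p i) * (v i / q i) := by
          gcongr
          exacts [hpf i (hp0 i hi), hqv i]
      _ = a * ((v i / p i) * (f i / q i)) := by simp only [div_eq_mul_inv]; ring
  calc (1 : ℝ≥0∞) ≤ (l.map fun i => a * ((v i / p i) * (f i / q i))).prod :=
        List.one_le_prod_of_one_le (by simpa using hone)
    _ = a ^ l.length * ((l.map fun i => v i / p i).prod * (l.map fun i => f i / q i).prod) := by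
        simp [List.prod_map_mul]
    _ ≤ a ^ l.length * ((l.map fun i => v i / p i).prod * x) := by gcongr
    _ = x * a ^ l.length * (l.map fun i => v i / p i).prod := by ring

variable {D O : Type*} {f₀ f g : Inst D O} {l : List (D × O)}

theorem le_logLikRatio_iff {n : ℕ} (hn : 1 ≤ n) :
    (Real.log n : EReal) ≤ logLikRatio f g l ↔
      (n : ℝ≥0∞) ≤ (l.map fun p => (f p.1 p.2 : ℝ≥0∞) / g p.1 p.2).prod := by
  rw [logLikRatio, sum_map_log, ← ENNReal.log_ofReal_of_pos (by exact_mod_cast hn),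
    ENNReal.log_le_log_iff, ENNReal.ofReal_natCast]

theorem outweighs_of_logLik_le {tol : ℝ} (h : logLik f₀ l ≤ logLik f l + (tol : EReal)) :
    Outweighs (ENNReal.ofReal (Real.exp tol)) (fun p : D × O => f₀ p.1 p.2)
      (fun p => f p.1 p.2) l := by
  refine outweighs_of_prod_le (by simp [Real.exp_pos]) (by simp) ?_
  rwa [logLik, logLik, sum_map_log, sum_map_log, add_comm, ← Real.log_exp tol,
    ← ENNReal.log_ofReal_of_pos (Real.exp_pos tol), ← ENNReal.log_mul_add,
    ENNReal.log_le_log_iff] at h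

end LikelihoodRatios

section LargeDeviations

variable {D O : Type*} [MeasurableSpace O] {ν : Measure O} {p q : O → ℝ≥0} {lam α M : ℝ}

theorem mul_div_rpow_le (x y r : ℝ≥0∞) (hx : x ≠ ⊤) (h0 : 0 < lam) (h1 : lam ≤ 1) :
    x * ((y + r) / x) ^ lam ≤ x ^ (1 - lam) * y ^ lam + (1 + x) * r ^ lam := by
  rcases eq_or_ne x 0 with rfl | hx0
  · simp
  have hpow : x ^ (1 - lam) ≤ 1 + x := by
    rcases le_total x 1 with h | h
    · exact (ENNReal.rpow_le_one h (by linarith)).trans le_self_add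
    · exact (ENNReal.rpow_le_rpow_of_exponent_le h (by linarith)).trans
        ((ENNReal.rpow_one x).le.trans le_add_self)
  calc x * ((y + r) / x) ^ lam = x ^ (1 - lam) * (y + r) ^ lam := by
        rw [ENNReal.div_rpow_of_nonneg _ _ h0.le, ENNReal.rpow_sub _ _ hx0 hx, ENNReal.rpow_one]
        simp only [div_eq_mul_inv]
        ring
    _ ≤ x ^ (1 - lam) * (y ^ lam + r ^ lam) := by
        gcongr
        exact ENNReal.rpow_add_le_add_rpow _ _ h0.le h1
    _ ≤ x ^ (1 - lam) * y ^ lam + (1 + x) * r ^ lam := by rw [mul_add]; gcongr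

theorem lintegral_add_div_rpow_le (hp : IsDensity ν p) (hq : Measurable q) (r : ℝ≥0∞)
    (h0 : 0 < lam) (h1 : lam ≤ 1) :
    ∫⁻ o, (((q o : ℝ≥0∞) + r) / p o) ^ lam ∂densityLaw ν p ≤
      affinity ν lam p q + (ν Set.univ + 1) * r ^ lam := by
  have hp' := hp.measurable.coe_nnreal_ennreal
  have hq' := hq.coe_nnreal_ennreal
  have hratio : Measurable fun o => (((q o : ℝ≥0∞) + r) / p o) ^ lam :=
    ((hq'.add_const r).div hp').pow_const lam
  rw [densityLaw, lintegral_withDensity_eq_lintegral_mul _ hp' hratio]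
  refine (lintegral_mono fun o =>
    mul_div_rpow_le (p o : ℝ≥0∞) (q o) r ENNReal.coe_ne_top h0 h1).trans_eq ?_
  rw [lintegral_add_left (by fun_prop), lintegral_mul_const _ (by fun_prop),
    lintegral_add_left measurable_const, hp.lintegral_eq_one, lintegral_one, affinity]

theorem ofReal_two_mul_exp_rpow_le (h0 : 0 ≤ lam) (h1 : lam ≤ 1) (M : ℝ) :
    ENNReal.ofReal (2 * Real.exp (-M)) ^ lam ≤ ENNReal.ofReal (2 * Real.exp (-(lam * M))) := by
  have htwo : (2 : ℝ) ^ lam ≤ 2 := by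
    simpa using Real.rpow_le_rpow_of_exponent_le (x := 2) (by norm_num) h1
  rw [ENNReal.ofReal_rpow_of_nonneg (by positivity) h0]
  refine ENNReal.ofReal_le_ofReal ?_
  rw [Real.mul_rpow (by norm_num) (by positivity), ← Real.exp_mul, neg_mul, mul_comm M]
  gcongr

theorem exp_add_mul_exp_le {d V : ℝ} (h0 : 0 ≤ lam) (hdα : d ≤ α) (hV : 0 ≤ V) :
    Real.exp (-(lam * d)) + V * (2 * Real.exp (-(lam * M))) ≤
      Real.exp (-(lam * d) + 2 * V * Real.exp (lam * (α - M))) := by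
  have hM : Real.exp (-(lam * M)) ≤ Real.exp (-(lam * d)) * Real.exp (lam * (α - M)) := by
    rw [← Real.exp_add, Real.exp_le_exp]
    linarith [mul_le_mul_of_nonneg_left hdα h0]
  calc Real.exp (-(lam * d)) + V * (2 * Real.exp (-(lam * M)))
      ≤ Real.exp (-(lam * d)) +
          V * (2 * (Real.exp (-(lam * d)) * Real.exp (lam * (α - M)))) := by gcongr
    _ = Real.exp (-(lam * d)) * (2 * V * Real.exp (lam * (α - M)) + 1) := by ring
    _ ≤ Real.exp (-(lam * d)) * Real.exp (2 * V * Real.exp (lam * (α - M))) := by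
        gcongr
        exact Real.add_one_le_exp _
    _ = Real.exp (-(lam * d) + 2 * V * Real.exp (lam * (α - M))) := (Real.exp_add _ _).symm

/-- The price in the exponent, per observation, of replacing the alternatives by the members of a
cover of radius `2 exp (-M)` in a moment of order `lam`. -/
def coverPenalty (ν : Measure O) (lam α M : ℝ) : ℝ :=
  2 * (ν.real Set.univ + 1) * Real.exp (lam * (α - M))

variable {R : O → ℝ} {Rmax ε : ℝ} {F : Set (Inst D O)} [IsFiniteMeasure ν]

theorem lintegral_envelope_div_rpow_le (hF : IsDecisionProblem ν R Rmax F) {f g : Inst D O}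
    (hf : f ∈ F) (hg : g ∈ F) (haff : AffinityBound ν F f lam ε α) (h0 : 0 < lam) (h1 : lam ≤ 1)
    (hα : 0 ≤ α) (M : ℝ) (π : D) :
    ∫⁻ o, (((g π o : ℝ≥0∞) + ENNReal.ofReal (2 * Real.exp (-M))) / f π o) ^ lam ∂law ν f π ≤
      ENNReal.ofReal (Real.exp
        (-(lam * clip ε α (kl ν f g π)) + coverPenalty ν lam α M)) := by
  refine (lintegral_add_div_rpow_le (hF.isDensity hf π) (hF.isDensity hg π).measurable _ h0
    h1).trans ?_
  have hV : ν Set.univ + 1 = ENNReal.ofReal (ν.real Set.univ + 1) := by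
    rw [ENNReal.ofReal_add (by positivity) zero_le_one, ofReal_measureReal, ENNReal.ofReal_one]
  calc _ ≤ ENNReal.ofReal (Real.exp (-(lam * clip ε α (kl ν f g π)))) +
        ENNReal.ofReal (ν.real Set.univ + 1) * ENNReal.ofReal (2 * Real.exp (-(lam * M))) := by
        rw [hV]
        gcongr
        exacts [haff g hg π, ofReal_two_mul_exp_rpow_le h0.le h1 M]
    _ = ENNReal.ofReal (Real.exp (-(lam * clip ε α (kl ν f g π))) +
        (ν.real Set.univ + 1) * (2 * Real.exp (-(lam * M)))) := by
        rw [← ENNReal.ofReal_mul (by positivity), ← ENNReal.ofReal_add (by positivity)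
          (by positivity)]
    _ ≤ _ := ENNReal.ofReal_le_ofReal (exp_add_mul_exp_le h0.le (clip_le ε hα _) (by positivity))

variable [Fintype D]

theorem prod_lintegral_envelope_le (hF : IsDecisionProblem ν R Rmax F) {f g : Inst D O}
    (hf : f ∈ F) (hg : g ∈ F) (haff : AffinityBound ν F f lam ε α) (h0 : 0 < lam) (h1 : lam ≤ 1)
    (hα : 0 ≤ α) (M : ℝ) (N : D → ℕ) {T : ℝ} (hT : T ≤ ∑ π, N π * clip ε α (kl ν f g π)) :
    ((playList N).map fun π => ∫⁻ o,
      (((g π o : ℝ≥0∞) + ENNReal.ofReal (2 * Real.exp (-M))) / f π o) ^ lam ∂law ν f π).prod ≤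
      ENNReal.ofReal (Real.exp
        (-(lam * T) + (playList N).length * coverPenalty ν lam α M)) := by
  rw [prod_map_playList]
  calc _ ≤ ∏ π, ENNReal.ofReal (Real.exp
          (-(lam * clip ε α (kl ν f g π)) + coverPenalty ν lam α M)) ^ N π := by
        gcongr with π
        exact lintegral_envelope_div_rpow_le hF hf hg haff h0 h1 hα M π
    _ = ENNReal.ofReal (Real.exp
          (∑ π, N π * (-(lam * clip ε α (kl ν f g π)) + coverPenalty ν lam α M))) := by
        rw [Real.exp_sum, ENNReal.ofReal_prod_of_nonneg fun _ _ => (Real.exp_pos _).le]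
        refine Finset.prod_congr rfl fun π _ => ?_
        rw [← ENNReal.ofReal_pow (Real.exp_pos _).le, ← Real.exp_nat_mul]
    _ = ENNReal.ofReal (Real.exp (-(lam * ∑ π, N π * clip ε α (kl ν f g π)) +
          (playList N).length * coverPenalty ν lam α M)) := by
        rw [length_playList, Nat.cast_sum, Finset.sum_mul, Finset.mul_sum,
          ← Finset.sum_neg_distrib, ← Finset.sum_add_distrib]
        congr 3 with π
        ring
    _ ≤ _ := by gcongr

/-- A Chernoff bound with the moment of order `lam` of the likelihood ratios, uniform over the
alternatives in `G` by a union bound over a cover of `G`. -/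
theorem playProb_le_of_outweighs (hF : IsDecisionProblem ν R Rmax F) {f : Inst D O} (hf : f ∈ F)
    {G : Set (Inst D O)} (hG : G ⊆ F) (haff : AffinityBound ν F f lam ε α) (h0 : 0 < lam)
    (h1 : lam ≤ 1) (hα : 0 ≤ α) {X : ℝ} (hfin : coveringNumber F (Real.exp (-M)) ≠ ⊤)
    (hX : (coveringNumber F (Real.exp (-M))).toNat ≤ X) {N : D → ℕ} {T : ℝ}
    (hT : ∀ g ∈ G, T ≤ ∑ π, N π * clip ε α (kl ν f g π)) {c : ℝ≥0∞} {E : Set (List O)}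
    (hE : ∀ y ∈ E, y.length = (playList N).length → ∃ g ∈ G,
      Outweighs c (fun p : D × O => f p.1 p.2) (fun p => g p.1 p.2) ((playList N).zip y)) :
    playProb (law ν f) (playList N) E ≤ c ^ lam * ENNReal.ofReal
      (X * Real.exp (-(lam * T) + (playList N).length * coverPenalty ν lam α M)) := by
  obtain ⟨J, hJG, hJcard, hJ⟩ := exists_finset_subset_of_subset hG (Real.exp_pos (-M)).le hfin
  let v (g : Inst D O) (p : D × O) : ℝ≥0∞ := g p.1 p.2 + ENNReal.ofReal (2 * Real.exp (-M))
  let B := Real.exp (-(lam * T) + (playList N).length * coverPenalty ν lam α M)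
  have hmeas : ∀ g ∈ J, ∀ π, Measurable fun o => (v g (π, o) / f π o) ^ lam := fun g hg π =>
    (((hF.measurable_density g (hG (hJG hg)) π).coe_nnreal_ennreal.add_const _).div
      (hF.measurable_density f hf π).coe_nnreal_ennreal).pow_const lam
  have hcover : ∀ y ∈ E, y.length = (playList N).length → 1 ≤ ∑ g ∈ J, c ^ lam *
      (((playList N).zip y).map fun p => (v g (p.1, p.2) / f p.1 p.2) ^ lam).prod := by
    intro y hy hlen
    obtain ⟨g, hgG, hg⟩ := hE y hy hlen
    obtain ⟨j, hj, hd⟩ := hJ g hgG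
    have hone := hg (v j) (fun p => by simp [v, Real.exp_pos])
      fun p => coe_le_add_of_instDist_le hd p.1 p.2
    refine le_trans ?_ (Finset.single_le_sum (fun _ _ => zero_le) hj)
    rw [prod_map_rpow h0.le, ← ENNReal.mul_rpow_of_nonneg _ _ h0.le]
    exact ENNReal.one_le_rpow hone h0
  calc _ ≤ ∑ g ∈ J, c ^ lam * ((playList N).map fun π =>
          ∫⁻ o, (v g (π, o) / f π o) ^ lam ∂law ν f π).prod :=
        playProb_le_sum_mul_prod hmeas hcover
    _ ≤ ∑ _ ∈ J, c ^ lam * ENNReal.ofReal B := by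
        gcongr with _ hg
        exact prod_lintegral_envelope_le hF hf (hG (hJG hg)) haff h0 h1 hα M N (hT _ (hJG hg))
    _ = c ^ lam * (J.card * ENNReal.ofReal B) := by rw [Finset.sum_const, nsmul_eq_mul]; ring
    _ ≤ c ^ lam * (ENNReal.ofReal X * ENNReal.ofReal B) := by
        rw [← ENNReal.ofReal_natCast]
        gcongr
        exact le_trans (by exact_mod_cast hJcard) hX
    _ = c ^ lam * ENNReal.ofReal (X * B) := by
        rw [← ENNReal.ofReal_mul (le_trans (by positivity) hX)]

end LargeDeviations

section Feasibility

variable {D O : Type*} [Fintype D] [MeasurableSpace O] {ν : Measure O} {η b : ℝ}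
  {f₀ f g : Inst D O}

theorem sum_coe_mul_ofReal (w : D → ℝ≥0) {a : ℝ} (ha : 0 ≤ a) :
    ∑ π, (w π : ℝ≥0∞) * ENNReal.ofReal a = ENNReal.ofReal (a * ∑ π, (w π : ℝ)) := by
  rw [← Finset.sum_mul, mul_comm, ENNReal.ofReal_mul ha,
    ENNReal.ofReal_sum_of_nonneg fun π _ => (w π).coe_nonneg]
  simp only [ENNReal.ofReal_coe_nnreal]

theorem sum_mul_kl_le_of_relClose (h : ∀ π, RelClose ν η (f₀ π) (f π)) (hη : 0 ≤ η)
    (hη1 : η < 1) (hf₀ : ∀ π, IsDensity ν (f₀ π)) (hf : ∀ π, IsDensity ν (f π))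
    (hg : ∀ π, IsDensity ν (g π)) (w : D → ℝ≥0) :
    ∑ π, (w π : ℝ≥0∞) * kl ν f g π ≤ ENNReal.ofReal (1 + η) * ∑ π, (w π : ℝ≥0∞) * kl ν f₀ g π +
      ENNReal.ofReal (4 * η * ∑ π, (w π : ℝ)) := by
  rw [← sum_coe_mul_ofReal w (by positivity), Finset.mul_sum, ← Finset.sum_add_distrib]
  refine Finset.sum_le_sum fun π _ => ?_
  calc (w π : ℝ≥0∞) * kl ν f g π
      ≤ w π * (ENNReal.ofReal (1 + η) * kl ν f₀ g π + ENNReal.ofReal (4 * η)) := by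
        gcongr; exact (h π).klDiv_le hη hη1 (hf₀ π) (hf π) (hg π)
    _ = _ := by ring

theorem le_sum_mul_kl_of_relClose (h : ∀ π, RelClose ν η (f₀ π) (f π)) (hη : 0 ≤ η)
    (hη1 : η < 1) (hf₀ : ∀ π, IsDensity ν (f₀ π)) (hf : ∀ π, IsDensity ν (f π))
    (hg : ∀ π, IsDensity ν (g π)) (w : D → ℝ≥0) :
    ENNReal.ofReal (1 - η) * ∑ π, (w π : ℝ≥0∞) * kl ν f₀ g π ≤
      ∑ π, (w π : ℝ≥0∞) * kl ν f g π + ENNReal.ofReal (2 * η * ∑ π, (w π : ℝ)) := by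
  rw [← sum_coe_mul_ofReal w (by positivity), Finset.mul_sum, ← Finset.sum_add_distrib]
  refine Finset.sum_le_sum fun π _ => ?_
  calc ENNReal.ofReal (1 - η) * ((w π : ℝ≥0∞) * kl ν f₀ g π)
      = w π * (ENNReal.ofReal (1 - η) * kl ν f₀ g π) := by ring
    _ ≤ w π * (kl ν f g π + ENNReal.ofReal (2 * η)) := by
        gcongr; exact (h π).le_klDiv hη hη1 (hf₀ π) (hf π) (hg π)
    _ = _ := by ring

theorem sum_coe_le_card_mul {w : D → ℝ≥0} (hw : ∀ π, (w π : ℝ) ≤ b) :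
    ∑ π, (w π : ℝ) ≤ Fintype.card D * b :=
  (Finset.sum_le_card_nsmul _ _ b fun π _ => hw π).trans_eq (by simp)

variable [Nonempty D] {R : O → ℝ} {Rmax : ℝ} {F : Set (Inst D O)}

theorem cost_eq_ofReal (ν : Measure O) (R : O → ℝ) (f : Inst D O) (w : D → ℝ≥0) :
    cost ν R f w = ENNReal.ofReal (∑ π, (w π : ℝ) * gap ν R f π) := by
  rw [ENNReal.ofReal_sum_of_nonneg fun π _ => mul_nonneg (w π).coe_nonneg (gap_nonneg _ _ _ _)]
  simp only [cost, ENNReal.ofReal_mul (w _).coe_nonneg, ENNReal.ofReal_coe_nnreal]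

theorem Feasible.of_relClose (hF : IsDecisionProblem ν R Rmax F) (hf₀ : f₀ ∈ F) (hf : f ∈ F)
    (hη : 0 ≤ η) (hη1 : η < 1) (hrel : ∀ π, RelClose ν η (f₀ π) (f π))
    (hbest : best ν R f = best ν R f₀) {B : ℝ} {w : D → ℝ≥0} (hw : Feasible ν R F f₀ B w)
    {θ : ℝ≥0} (hθ : 1 ≤ (1 + θ : ℝ) * (1 - η - 2 * η * ∑ π, (w π : ℝ)))
    (hb : ∀ π, (1 + θ : ℝ) * w π ≤ b) : Feasible ν R F f b fun π => (1 + θ) * w π := by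
  refine ⟨fun g hg hgf => ?_, fun π => by push_cast; exact hb π⟩
  have hinfo : ENNReal.ofReal (1 - η - 2 * η * ∑ π, (w π : ℝ)) ≤
      ∑ π, (w π : ℝ≥0∞) * kl ν f g π := by
    rw [ENNReal.ofReal_sub _ (by positivity), tsub_le_iff_right]
    exact (le_mul_of_one_le_right' (hw.1 g hg (hbest ▸ hgf))).trans
      (le_sum_mul_kl_of_relClose hrel hη hη1 (hF.isDensity hf₀) (hF.isDensity hf)
        (hF.isDensity hg) w)
  calc (1 : ℝ≥0∞) ≤ ENNReal.ofReal ((1 + θ : ℝ) * (1 - η - 2 * η * ∑ π, (w π : ℝ))) :=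
        ENNReal.one_le_ofReal.2 hθ
    _ = (1 + θ) * ENNReal.ofReal (1 - η - 2 * η * ∑ π, (w π : ℝ)) := by
        rw [ENNReal.ofReal_mul (by positivity), ENNReal.ofReal_add zero_le_one (by positivity)]
        simp
    _ ≤ (1 + θ) * ∑ π, (w π : ℝ≥0∞) * kl ν f g π := by gcongr
    _ = _ := by
        rw [Finset.mul_sum]
        exact Finset.sum_congr rfl fun π _ => by push_cast; ring

theorem sum_weights_gap_le {s θ tol : ℝ} (hgap : ∀ π, |gap ν R f π - gap ν R f₀ π| ≤ 2 * s)
    (hθ : 0 ≤ θ) (htol : 0 ≤ tol) {w v : D → ℝ≥0} (hv : ∀ π, (v π : ℝ) ≤ b)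
    (hopt : cost ν R f v ≤ cost ν R f (fun π => (1 + θ.toNNReal) * w π) + ENNReal.ofReal tol) :
    ∑ π, (v π : ℝ) * gap ν R f₀ π ≤
      (1 + θ) * (∑ π, (w π : ℝ) * gap ν R f₀ π + 2 * s * ∑ π, (w π : ℝ)) + tol +
        2 * s * (Fintype.card D * b) := by
  have hs : 0 ≤ 2 * s := (abs_nonneg _).trans (hgap (Classical.arbitrary D))
  have hnonneg : 0 ≤ ∑ π, (w π : ℝ) * gap ν R f π :=
    Finset.sum_nonneg fun π _ => mul_nonneg (w π).coe_nonneg (gap_nonneg _ _ _ _)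
  have hcost : ∑ π, (v π : ℝ) * gap ν R f π ≤ (1 + θ) * ∑ π, (w π : ℝ) * gap ν R f π + tol := by
    rw [cost_eq_ofReal, cost_eq_ofReal] at hopt
    simp only [NNReal.coe_mul, NNReal.coe_add, NNReal.coe_one, Real.coe_toNNReal θ hθ, mul_assoc,
      ← Finset.mul_sum] at hopt
    rwa [← ENNReal.ofReal_add (by positivity) htol,
      ENNReal.ofReal_le_ofReal_iff (by positivity)] at hopt
  have htransfer (u : D → ℝ≥0) :
      |∑ π, (u π : ℝ) * gap ν R f π - ∑ π, (u π : ℝ) * gap ν R f₀ π| ≤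
        2 * s * ∑ π, (u π : ℝ) := by
    rw [← Finset.sum_sub_distrib, Finset.mul_sum]
    refine (Finset.abs_sum_le_sum_abs _ _).trans (Finset.sum_le_sum fun π _ => ?_)
    rw [← mul_sub, abs_mul, abs_of_nonneg (u π).coe_nonneg, mul_comm]
    exact mul_le_mul_of_nonneg_right (hgap π) (u π).coe_nonneg
  calc ∑ π, (v π : ℝ) * gap ν R f₀ π
      ≤ ∑ π, (v π : ℝ) * gap ν R f π + 2 * s * ∑ π, (v π : ℝ) := by
        linarith [(abs_le.1 (htransfer v)).1]
    _ ≤ ((1 + θ) * (∑ π, (w π : ℝ) * gap ν R f₀ π + 2 * s * ∑ π, (w π : ℝ)) + tol) +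
          2 * s * (Fintype.card D * b) := by
        gcongr
        · refine hcost.trans ?_
          gcongr
          linarith [(abs_le.1 (htransfer w)).2]
        · exact sum_coe_le_card_mul hv

/-- The instances that the weights `w`, used with the cap `b`, tell apart from `f₀`. The slack
`1 / (4 * b)` is what remains of the constraints of the program when they are stated for an
instance close to `f₀`. -/
def Separated (ν : Measure O) (F : Set (Inst D O)) (f₀ : Inst D O) (b : ℝ) (w : D → ℝ≥0) :
    Set (Inst D O) :=
  {g ∈ F | ENNReal.ofReal (1 - 1 / (4 * b)) ≤ ∑ π, (w π : ℝ≥0∞) * kl ν f₀ g π}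

theorem mem_separated_of_feasible (hF : IsDecisionProblem ν R Rmax F) (hf₀ : f₀ ∈ F)
    (hf : f ∈ F) (hη : 0 ≤ η) (hb : 1 ≤ b) (hηb : 64 * Fintype.card D * b ^ 2 * η ≤ 1)
    (hrel : ∀ π, RelClose ν η (f₀ π) (f π)) {w : D → ℝ≥0} (hw : Feasible ν R F f b w)
    (hg : g ∈ F) (hne : best ν R g ≠ best ν R f) : g ∈ Separated ν F f₀ b w := by
  refine ⟨hg, le_of_not_gt fun hlt => ?_⟩
  have hK : (1 : ℝ) ≤ Fintype.card D := by exact_mod_cast Fintype.card_pos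
  have hKbη : Fintype.card D * b * η ≤ 1 / (4 * b) / 16 := by
    rw [div_div, le_div_iff₀ (by positivity)]; linarith
  have hηK : η ≤ Fintype.card D * b * η := by
    have : 1 ≤ Fintype.card D * b := by nlinarith
    nlinarith
  have hq1 : 1 / (4 * b) ≤ 1 / 4 := by gcongr; linarith
  have hinfo : 1 ≤ ENNReal.ofReal ((1 + η) * (1 - 1 / (4 * b)) + 4 * (Fintype.card D * b * η)) :=
    calc (1 : ℝ≥0∞) ≤ ∑ π, (w π : ℝ≥0∞) * kl ν f g π := hw.1 g hg hne
      _ ≤ _ := sum_mul_kl_le_of_relClose hrel hη (by linarith) (hF.isDensity hf₀)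
          (hF.isDensity hf) (hF.isDensity hg) w
      _ ≤ ENNReal.ofReal (1 + η) * ENNReal.ofReal (1 - 1 / (4 * b)) +
          ENNReal.ofReal (4 * (Fintype.card D * b * η)) := by
        refine add_le_add (by gcongr) (ENNReal.ofReal_le_ofReal ?_)
        linarith [mul_le_mul_of_nonneg_left (sum_coe_le_card_mul hw.2) hη]
      _ = _ := by
        rw [← ENNReal.ofReal_mul (by positivity),
          ← ENNReal.ofReal_add (mul_nonneg (by positivity) (by linarith)) (by positivity)]
  rw [ENNReal.one_le_ofReal] at hinfo
  have : 0 < 1 / (4 * b) := by positivity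
  nlinarith [mul_nonneg hη this.le]

end Feasibility

section Information

theorem toReal_sub_le_clip {ε α : ℝ} {x : ℝ≥0∞} (hε : 0 ≤ ε) (hα : 0 ≤ α)
    (hx : x ≤ ENNReal.ofReal (α + ε)) : x.toReal - ε ≤ clip ε α x := by
  rcases le_total (x.toReal - ε) 0 with hneg | hpos
  · exact hneg.trans (clip_nonneg _ _ _)
  refine le_clip hε hpos ?_ ?_
  · linarith [ENNReal.toReal_le_of_le_ofReal (by positivity) hx]
  · rw [sub_add_cancel, ENNReal.ofReal_toReal (ne_top_of_le_ne_top ENNReal.ofReal_ne_top hx)]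

variable {ι : Type*} [Fintype ι] {w : ι → ℝ≥0} {N : ι → ℝ} {x : ι → ℝ≥0∞} {b ε L : ℝ}

theorem le_sum_mul_toReal {a : ℝ} (hx : ∀ i, x i ≠ ⊤) (ha : ENNReal.ofReal a ≤ ∑ i, w i * x i) :
    a ≤ ∑ i, w i * (x i).toReal := by
  have hfin : ∀ i, (w i : ℝ≥0∞) * x i ≠ ⊤ := fun i => ENNReal.mul_ne_top (by simp) (hx i)
  rw [ENNReal.ofReal_le_iff_le_toReal (ENNReal.sum_ne_top.2 fun i _ => hfin i),
    ENNReal.toReal_sum fun i _ => hfin i] at ha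
  simpa using ha

theorem le_mul_clip_of_two_mul_le (hb : 2 ≤ b) (hε : 0 ≤ ε) (hL : 0 ≤ L) {m : ℝ} {y : ℝ≥0∞}
    (hm : 1 / b * L ≤ m) (hy : ENNReal.ofReal (2 * b + ε) ≤ y) :
    (1 + 1 / (4 * b)) * L ≤ m * clip ε (2 * b) y := by
  have hq : 1 / (4 * b) ≤ 1 := by rw [div_le_one (by positivity)]; linarith
  calc (1 + 1 / (4 * b)) * L ≤ 2 * L := by gcongr; linarith
    _ = 1 / b * L * (2 * b) := by field_simp
    _ ≤ m * clip ε (2 * b) y :=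
        mul_le_mul hm (le_clip hε (by positivity) le_rfl hy) (by positivity)
          (le_trans (by positivity) hm)

theorem le_sum_mul_clip_of_le (hb : 2 ≤ b) (hε : 0 ≤ ε) (hL : 0 ≤ L)
    (hN : ∀ i, (1 + 1 / b) * w i * L ≤ N i) (hw : ε * ∑ i, (w i : ℝ) ≤ 1 / (4 * b))
    (hx : ∀ i, x i ≤ ENNReal.ofReal (2 * b + ε))
    (hinfo : ENNReal.ofReal (1 - 1 / (4 * b)) ≤ ∑ i, w i * x i) :
    (1 + 1 / (4 * b)) * L ≤ ∑ i, N i * clip ε (2 * b) (x i) := by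
  have hsum := le_sum_mul_toReal (fun i => ne_top_of_le_ne_top ENNReal.ofReal_ne_top (hx i)) hinfo
  have hmargin : 1 + 1 / (4 * b) ≤ (1 + 1 / b) * (1 - 1 / (4 * b) - 1 / (4 * b)) := by
    have : (1 + 1 / b) * (1 - 1 / (4 * b) - 1 / (4 * b)) - (1 + 1 / (4 * b)) =
        (b - 2) / (4 * b ^ 2) := by field_simp; ring
    have : 0 ≤ (b - 2) / (4 * b ^ 2) := div_nonneg (by linarith) (by positivity)
    linarith
  calc (1 + 1 / (4 * b)) * L
      ≤ (1 + 1 / b) * (1 - 1 / (4 * b) - 1 / (4 * b)) * L := by gcongr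
    _ ≤ (1 + 1 / b) * (∑ i, w i * (x i).toReal - ε * ∑ i, (w i : ℝ)) * L := by gcongr
    _ = ∑ i, (1 + 1 / b) * w i * L * ((x i).toReal - ε) := by
        rw [Finset.mul_sum Finset.univ _ ε, ← Finset.sum_sub_distrib, Finset.mul_sum,
          Finset.sum_mul]
        exact Finset.sum_congr rfl fun i _ => by ring
    _ ≤ ∑ i, (1 + 1 / b) * w i * L * clip ε (2 * b) (x i) := by
        gcongr with i
        exact toReal_sub_le_clip hε (by positivity) (hx i)
    _ ≤ _ := by
        gcongr with i
        · exact clip_nonneg _ _ _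
        · exact hN i

/-- The divergences above `2 * b + ε` are treated separately: a single one of them provides the
information through the term `1 / b` of the number of plays. -/
theorem le_sum_mul_clip (hb : 2 ≤ b) (hε : 0 ≤ ε) (hL : 0 ≤ L)
    (hN : ∀ i, ((1 + 1 / b) * w i + 1 / b) * L ≤ N i)
    (hw : ε * ∑ i, (w i : ℝ) ≤ 1 / (4 * b))
    (hinfo : ENNReal.ofReal (1 - 1 / (4 * b)) ≤ ∑ i, w i * x i) :
    (1 + 1 / (4 * b)) * L ≤ ∑ i, N i * clip ε (2 * b) (x i) := by
  have hN₁ : ∀ i, (1 + 1 / b) * w i * L ≤ N i := fun i =>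
    le_trans (by gcongr; exact le_add_of_nonneg_right (by positivity)) (hN i)
  have hN₂ : ∀ i, 1 / b * L ≤ N i := fun i =>
    le_trans (by gcongr; exact le_add_of_nonneg_left (by positivity)) (hN i)
  by_cases hlarge : ∃ i, ENNReal.ofReal (2 * b + ε) ≤ x i
  · obtain ⟨i, hi⟩ := hlarge
    have hnonneg : ∀ j, 0 ≤ N j * clip ε (2 * b) (x j) := fun j =>
      mul_nonneg (le_trans (by positivity) (hN₂ j)) (clip_nonneg _ _ _)
    exact (le_mul_clip_of_two_mul_le hb hε hL (hN₂ i) hi).trans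
      (Finset.single_le_sum (fun j _ => hnonneg j) (Finset.mem_univ i))
  · push Not at hlarge
    exact le_sum_mul_clip_of_le hb hε hL hN₁ hw (fun i => (hlarge i).le) hinfo

end Information

section Identification

variable {D : Type*} {n : ℕ} {w : D → ℝ≥0}

/-- The number of plays of `π` in the second phase, so that
`identPlays n w = playList (identCount n w)`. -/
def identCount (n : ℕ) (w : D → ℝ≥0) (π : D) : ℕ :=
  ⌈((1 + 1 / cap n) * w π + 1 / cap n) * Real.log n⌉₊

theorem identCount_le (hcap : 0 < cap n) (w : D → ℝ≥0) (π : D) :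
    (identCount n w π : ℝ) ≤ ((1 + 1 / cap n) * w π + 1 / cap n) * Real.log n + 1 :=
  (Nat.ceil_lt_add_one (mul_nonneg (by positivity) (Real.log_natCast_nonneg n))).le

variable [Fintype D]

/-- An upper bound for the length of the second phase. -/
def identBound (D : Type*) [Fintype D] (n : ℕ) : ℝ :=
  Fintype.card D * ((cap n + 1 + 1 / cap n) * Real.log n + 1)

theorem sum_identCount_le (hcap : 0 < cap n) (hw : ∀ π, (w π : ℝ) ≤ cap n) :
    ∑ π, (identCount n w π : ℝ) ≤ identBound D n := by
  have : 0 ≤ Real.log n := Real.log_natCast_nonneg n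
  have hcount : ∀ π, (identCount n w π : ℝ) ≤ (cap n + 1 + 1 / cap n) * Real.log n + 1 := by
    intro π
    calc (identCount n w π : ℝ) ≤ ((1 + 1 / cap n) * w π + 1 / cap n) * Real.log n + 1 :=
          identCount_le hcap w π
      _ ≤ ((1 + 1 / cap n) * cap n + 1 / cap n) * Real.log n + 1 := by gcongr; exact hw π
      _ = _ := by field_simp
  exact (Finset.sum_le_card_nsmul _ _ _ fun π _ => hcount π).trans_eq
    (by simp only [identBound, Finset.card_univ, nsmul_eq_mul])

variable {O : Type*} [MeasurableSpace O] {ν : Measure O}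

theorem le_sum_identCount_mul_clip {F : Set (Inst D O)} {f₀ g : Inst D O} (hcap : 2 ≤ cap n)
    (hw : ∀ π, (w π : ℝ) ≤ cap n) (hg : g ∈ Separated ν F f₀ (cap n) w) :
    (1 + 1 / (4 * cap n)) * Real.log n ≤ ∑ π, (identCount n w π : ℝ) *
      clip (1 / (4 * Fintype.card D * cap n ^ 2)) (2 * cap n) (kl ν f₀ g π) := by
  refine le_sum_mul_clip hcap (by positivity) (Real.log_natCast_nonneg n)
    (fun π => Nat.le_ceil _) ?_ hg.2
  calc 1 / (4 * Fintype.card D * cap n ^ 2) * ∑ π, (w π : ℝ)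
      ≤ 1 / (4 * Fintype.card D * cap n ^ 2) * (Fintype.card D * cap n) := by
        gcongr; exact sum_coe_le_card_mul hw
    _ ≤ 1 / (4 * cap n) := by
        rcases Nat.eq_zero_or_pos (Fintype.card D) with h0 | hpos
        · simp [h0]; linarith
        · exact le_of_eq (by field_simp)

variable [Nonempty D] {R : O → ℝ} {Rmax : ℝ} {F : Set (Inst D O)} {f : Inst D O}

theorem sum_identCount_mul_gap_le_identBound (hF : IsDecisionProblem ν R Rmax F) (hf : f ∈ F)
    (hcap : 0 < cap n) (hw : ∀ π, (w π : ℝ) ≤ cap n) :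
    ∑ π, (identCount n w π : ℝ) * gap ν R f π ≤ identBound D n * Rmax := by
  have hR := hF.Rmax_nonneg hf
  calc ∑ π, (identCount n w π : ℝ) * gap ν R f π ≤ ∑ π, (identCount n w π : ℝ) * Rmax := by
        gcongr with π
        exact hF.gap_le hf π
    _ ≤ _ := by rw [← Finset.sum_mul]; gcongr; exact sum_identCount_le hcap hw

theorem sum_identCount_mul_gap_le (hF : IsDecisionProblem ν R Rmax F) (hf : f ∈ F)
    (hcap : 0 < cap n) {A : ℝ} (hA : ∑ π, (w π : ℝ) * gap ν R f π ≤ A) :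
    ∑ π, (identCount n w π : ℝ) * gap ν R f π ≤ (1 + 1 / cap n) * Real.log n * A +
      Fintype.card D * Rmax * (1 / cap n * Real.log n + 1) := by
  calc ∑ π, (identCount n w π : ℝ) * gap ν R f π
      ≤ ∑ π, ((1 + 1 / cap n) * Real.log n * (w π * gap ν R f π) +
          (1 / cap n * Real.log n + 1) * gap ν R f π) := by
        gcongr with π
        refine (mul_le_mul_of_nonneg_right (identCount_le hcap w π)
          (gap_nonneg ν R f π)).trans_eq ?_
        ring
    _ ≤ ∑ π, ((1 + 1 / cap n) * Real.log n * (w π * gap ν R f π) +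
          (1 / cap n * Real.log n + 1) * Rmax) := by
        gcongr with π
        exact hF.gap_le hf π
    _ = (1 + 1 / cap n) * Real.log n * ∑ π, (w π : ℝ) * gap ν R f π +
          Fintype.card D * Rmax * (1 / cap n * Real.log n + 1) := by
        rw [Finset.sum_add_distrib, ← Finset.mul_sum, Finset.sum_const, nsmul_eq_mul,
          Finset.card_univ]
        ring
    _ ≤ _ := by gcongr

end Identification

section TestToCommit

theorem lintegral_likelihoodRatio_le_one {D O : Type*} [MeasurableSpace O] {ν : Measure O}
    {R : O → ℝ} {F : Set (Inst D O)} {Rmax : ℝ} {f : Inst D O}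
    (hF : IsDecisionProblem ν R Rmax F) (hf : f ∈ F)
    {g : Inst D O} (hg : g ∈ F) (π : D) :
    ∫⁻ o, (g π o : ℝ≥0∞) / f π o ∂law ν f π ≤ 1 := by
  have hfm := (hF.measurable_density f hf π).coe_nnreal_ennreal
  have hgm := (hF.measurable_density g hg π).coe_nnreal_ennreal
  rw [law, lintegral_withDensity_eq_lintegral_mul _ hfm (hgm.fun_div hfm),
    ← hF.lintegral_density g hg π]
  exact lintegral_mono fun o => ENNReal.mul_div_le

variable {D O : Type*} [Fintype D] [Nonempty D] [MeasurableSpace O] {ν : Measure O} {R : O → ℝ}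
  {F : Set (Inst D O)} {n : ℕ} {est : List O → Inst D O} {wt : List O → D → ℝ≥0}
  {ucb : List (D × O) → D} {x y : List O}

theorem t2c_of_length_lt (hx : x.length < (initPlays D n).length) :
    t2c ν R F n est wt ucb x = (initPlays D n)[x.length] := by
  simp only [t2c, dif_pos hx]

theorem t2c_append_of_length_lt (hx : x.length = (initPlays D n).length)
    (hy : y.length < (identPlays n (wt x)).length) :
    t2c ν R F n est wt ucb (x ++ y) = (identPlays n (wt x))[y.length] := by
  have hlen : ¬(x ++ y).length < (initPlays D n).length := by simp [hx]
  simp only [t2c, dif_neg hlen, List.take_left' hx, List.drop_left' hx, dif_pos hy]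

open scoped Classical in
theorem t2c_append_append (hx : x.length = (initPlays D n).length)
    (hy : y.length = (identPlays n (wt x)).length) (z : List O) :
    t2c ν R F n est wt ucb (x ++ (y ++ z)) =
      if Accepts ν R F n (est x) ((identPlays n (wt x)).zip y) then best ν R (est x)
      else ucb (ucbHistory ucb z) := by
  have hinit : ¬(x ++ (y ++ z)).length < (initPlays D n).length := by simp [hx]
  have hident : ¬(y ++ z).length < (identPlays n (wt x)).length := by simp [hy]
  have hzip : (identPlays n (wt x)).zip (y ++ z) = (identPlays n (wt x)).zip y := by
    simpa using List.zip_append (r₁ := []) (r₂ := z) hy.symm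
  simp only [t2c, dif_neg hinit, List.take_left' hx, List.drop_left' hx, dif_neg hident, hzip,
    List.drop_left' hy]

/-- The observations of the second phase on which the estimate is rejected, given the
observations `x` of the first phase. -/
def rejections (ν : Measure O) (R : O → ℝ) (F : Set (Inst D O)) (n : ℕ) (est : List O → Inst D O)
    (wt : List O → D → ℝ≥0) (x : List O) : Set (List O) :=
  {y | ¬Accepts ν R F n (est x) ((identPlays n (wt x)).zip y)}

/-- The regret bound for the UCB phase, with horizon `n`. -/
def ucbBound (ν : Measure O) (R : O → ℝ) (Rmax : ℝ) (f : Inst D O) (n : ℕ) : ℝ≥0∞ :=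
  ucbConst (law ν f) R Rmax (best ν R f) * ENNReal.ofReal (Real.log n) +
    3 * Fintype.card D * ENNReal.ofReal Rmax

variable {Rmax : ℝ} {f : Inst D O}

theorem ucbBound_ne_top : ucbBound ν R Rmax f n ≠ ⊤ := by
  have hconst : ucbConst (law ν f) R Rmax (best ν R f) ≠ ⊤ := by simp [ucbConst]
  exact ENNReal.add_ne_top.2 ⟨by finiteness, by finiteness⟩

/-- Markov's inequality: accepting a wrong decision requires a likelihood ratio of at least `n`
against the true instance. -/
theorem natCast_mul_playProb_accepts_le_one (hF : IsDecisionProblem ν R Rmax F) (hf : f ∈ F)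
    (hn : 1 ≤ n) (hest : est x ∈ F) (hne : best ν R (est x) ≠ best ν R f) :
    n * playProb (law ν f) (identPlays n (wt x)) (rejections ν R F n est wt x)ᶜ ≤ 1 := by
  have hmeas : ∀ j ∈ Finset.univ (α := Unit), ∀ π,
      Measurable fun o => (est x π o : ℝ≥0∞) / f π o := fun _ _ π =>
    (hF.measurable_density _ hest π).coe_nnreal_ennreal.div
      (hF.measurable_density f hf π).coe_nnreal_ennreal
  have hn0 : (n : ℝ≥0∞) ≠ 0 := by exact_mod_cast (Nat.one_le_iff_ne_zero.1 hn)
  have hprob : playProb (law ν f) (identPlays n (wt x)) (rejections ν R F n est wt x)ᶜ ≤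
      (n : ℝ≥0∞)⁻¹ * ((identPlays n (wt x)).map fun π =>
        ∫⁻ o, (est x π o : ℝ≥0∞) / f π o ∂law ν f π).prod := by
    refine (playProb_le_sum_mul_prod (c := fun _ => (n : ℝ≥0∞)⁻¹) hmeas
      fun y hy _ => ?_).trans_eq (by simp)
    have hacc : Accepts ν R F n (est x) ((identPlays n (wt x)).zip y) := not_not.1 hy
    have hratio := (le_logLikRatio_iff hn).1 (hacc f hf hne.symm)
    rw [Finset.univ_unique, Finset.sum_singleton, ← ENNReal.inv_mul_cancel hn0 (by simp)]
    gcongr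
  have hle : ((identPlays n (wt x)).map fun π =>
      ∫⁻ o, (est x π o : ℝ≥0∞) / f π o ∂law ν f π).prod ≤ 1 := by
    rw [identPlays, prod_map_playList]
    exact Finset.prod_le_one' fun π _ =>
      pow_le_one₀ zero_le (lintegral_likelihoodRatio_le_one hF hf hest π)
  calc _ ≤ n * ((n : ℝ≥0∞)⁻¹ * 1) := by gcongr; exact hprob.trans (by gcongr)
    _ = 1 := by rw [mul_one, ENNReal.mul_inv_cancel hn0 (by simp)]

theorem expectedCost_commit_eq_zero (hx : x.length = (initPlays D n).length)
    (hy : y.length = (identPlays n (wt x)).length) (hacc : y ∉ rejections ν R F n est wt x)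
    (hbest : best ν R (est x) = best ν R f) (r : ℕ) [∀ π, IsProbabilityMeasure (law ν f π)] :
    expectedCost (law ν f) (fun π => ENNReal.ofReal (gap ν R f π)) r
      (fun z => t2c ν R F n est wt ucb (x ++ (y ++ z))) = 0 := by
  refine le_antisymm ((expectedCost_le_mul (C := 0) (fun z => ?_) r).trans (by simp)) zero_le
  rw [t2c_append_append hx hy, if_pos (not_not.1 hacc), hbest, gap_best, ENNReal.ofReal_zero]

theorem expectedCost_ucb_phase_le (hF : IsDecisionProblem ν R Rmax F) (hf : f ∈ F) (hn : 1 ≤ n)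
    (hucb : IsUCB R Rmax n ucb) (hx : x.length = (initPlays D n).length)
    (hy : y.length = (identPlays n (wt x)).length) (hrej : y ∈ rejections ν R F n est wt x)
    {r : ℕ} (hr : r ≤ n) :
    expectedCost (law ν f) (fun π => ENNReal.ofReal (gap ν R f π)) r
      (fun z => t2c ν R F n est wt ucb (x ++ (y ++ z))) ≤ ucbBound ν R Rmax f n := by
  have := hF.isProbabilityMeasure hf
  simp only [t2c_append_append hx hy, if_neg (show ¬Accepts _ _ _ _ _ _ from hrej)]
  exact expectedCost_ucb_le hF.measurable_reward (hF.bounded_reward f hf) hn hucb _ hr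

theorem expectedCost_after_init_eq (hF : IsDecisionProblem ν R Rmax F) (hf : f ∈ F)
    (hx : x.length = (initPlays D n).length) (r : ℕ) :
    expectedCost (law ν f) (fun π => ENNReal.ofReal (gap ν R f π))
        ((identPlays n (wt x)).length + r) (fun z => t2c ν R F n est wt ucb (x ++ z)) =
      ENNReal.ofReal (∑ π, (identCount n (wt x) π : ℝ) * gap ν R f π) +
        playLIntegral (law ν f) (identPlays n (wt x)) fun y =>
          expectedCost (law ν f) (fun π => ENNReal.ofReal (gap ν R f π)) r
            fun z => t2c ν R F n est wt ucb (x ++ (y ++ z)) := by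
  have := hF.isProbabilityMeasure hf
  rw [expectedCost_length_add _ (fun y hy => t2c_append_of_length_lt hx hy) r]
  congr 1
  rw [identPlays, sum_map_playList,
    ENNReal.ofReal_sum_of_nonneg fun π _ => mul_nonneg (by positivity) (gap_nonneg _ _ _ _)]
  refine Finset.sum_congr rfl fun π _ => ?_
  rw [nsmul_eq_mul, ENNReal.ofReal_mul (by positivity), ENNReal.ofReal_natCast, identCount]

theorem expectedCost_after_init_le_of_best_eq (hF : IsDecisionProblem ν R Rmax F) (hf : f ∈ F)
    (hn : 1 ≤ n) (hucb : IsUCB R Rmax n ucb) (hx : x.length = (initPlays D n).length)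
    (hbest : best ν R (est x) = best ν R f) {r : ℕ} (hr : r ≤ n) :
    expectedCost (law ν f) (fun π => ENNReal.ofReal (gap ν R f π))
        ((identPlays n (wt x)).length + r) (fun z => t2c ν R F n est wt ucb (x ++ z)) ≤
      ENNReal.ofReal (∑ π, (identCount n (wt x) π : ℝ) * gap ν R f π) +
        ucbBound ν R Rmax f n *
          playProb (law ν f) (identPlays n (wt x)) (rejections ν R F n est wt x) := by
  have := hF.isProbabilityMeasure hf
  rw [expectedCost_after_init_eq hF hf hx]
  gcongr
  refine (playLIntegral_le_add_mul_playProb (a := 0) (b := ucbBound ν R Rmax f n)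
    ucbBound_ne_top fun y hy => ?_).trans_eq (zero_add _)
  by_cases hrej : y ∈ rejections ν R F n est wt x
  · simpa [hrej] using expectedCost_ucb_phase_le hF hf hn hucb hx hy hrej hr
  · exact (expectedCost_commit_eq_zero hx hy hrej hbest r).trans_le zero_le

theorem expectedCost_after_init_le (hF : IsDecisionProblem ν R Rmax F) (hf : f ∈ F)
    (hn : 1 ≤ n) (hucb : IsUCB R Rmax n ucb) (hx : x.length = (initPlays D n).length)
    (hest : est x ∈ F) {r : ℕ} (hr : r ≤ n) :
    expectedCost (law ν f) (fun π => ENNReal.ofReal (gap ν R f π))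
        ((identPlays n (wt x)).length + r) (fun z => t2c ν R F n est wt ucb (x ++ z)) ≤
      ENNReal.ofReal (∑ π, (identCount n (wt x) π : ℝ) * gap ν R f π) +
        (ucbBound ν R Rmax f n + ENNReal.ofReal Rmax) := by
  have := hF.isProbabilityMeasure hf
  rw [expectedCost_after_init_eq hF hf hx]
  gcongr
  by_cases hbest : best ν R (est x) = best ν R f
  · refine le_trans (playLIntegral_le_add_mul_playProb (a := ucbBound ν R Rmax f n) (b := 0)
      (E := ∅) (by simp) fun y hy => ?_) (by simp)
    by_cases hrej : y ∈ rejections ν R F n est wt x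
    · simpa using expectedCost_ucb_phase_le hF hf hn hucb hx hy hrej hr
    · exact (expectedCost_commit_eq_zero hx hy hrej hbest r).trans_le zero_le
  · refine (playLIntegral_le_add_mul_playProb (a := ucbBound ν R Rmax f n)
      (b := n * ENNReal.ofReal Rmax) (E := (rejections ν R F n est wt x)ᶜ)
      (ENNReal.mul_ne_top (by simp) (by simp)) fun y hy => ?_).trans ?_
    · by_cases hrej : y ∈ rejections ν R F n est wt x
      · simpa [hrej] using expectedCost_ucb_phase_le hF hf hn hucb hx hy hrej hr
      · have hcost := expectedCost_le_mul (μ := law ν f)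
          (c := fun π => ENNReal.ofReal (gap ν R f π)) (C := ENNReal.ofReal Rmax)
          (alg := fun z => t2c ν R F n est wt ucb (x ++ (y ++ z)))
          (fun z => ENNReal.ofReal_le_ofReal (hF.gap_le hf _)) r
        refine hcost.trans (le_trans ?_ le_add_self)
        simp only [Set.mem_compl_iff, hrej, not_false_eq_true, Set.indicator_of_mem, Pi.one_apply,
          mul_one]
        gcongr
    · rw [mul_right_comm]
      gcongr
      exact mul_le_of_le_one_left' (natCast_mul_playProb_accepts_le_one hF hf hn hest hbest)

theorem ofReal_regret_t2c_le (hF : IsDecisionProblem ν R Rmax F) (hf : f ∈ F) (hn : 1 ≤ n)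
    (hucb : IsUCB R Rmax n ucb) {I A : ℝ} {p : ℝ≥0∞} {E : Set (List O)}
    (hest : ∀ x, x.length = (initPlays D n).length → est x ∈ F)
    (hlen : ∀ x, x.length = (initPlays D n).length →
      (initPlays D n).length + (identPlays n (wt x)).length ≤ n)
    (hI : ∀ x, x.length = (initPlays D n).length →
      ∑ π, (identCount n (wt x) π : ℝ) * gap ν R f π ≤ I)
    (hgood : ∀ x ∉ E, x.length = (initPlays D n).length → best ν R (est x) = best ν R f ∧
      ∑ π, (identCount n (wt x) π : ℝ) * gap ν R f π ≤ A ∧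
      playProb (law ν f) (identPlays n (wt x)) (rejections ν R F n est wt x) ≤ p) :
    ENNReal.ofReal (regret ν R f (t2c ν R F n est wt ucb) n) ≤
      (initPlays D n).length * ENNReal.ofReal Rmax +
        (ENNReal.ofReal A + ucbBound ν R Rmax f n * p +
          (ENNReal.ofReal I + (ucbBound ν R Rmax f n + ENNReal.ofReal Rmax)) *
            playProb (law ν f) (initPlays D n) E) := by
  have := hF.isProbabilityMeasure hf
  obtain ⟨x₀, hx₀⟩ : ∃ x : List O, x.length = (initPlays D n).length := by
    obtain ⟨o⟩ := (law ν f (Classical.arbitrary D)).nonempty_of_neZero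
    exact ⟨List.replicate _ o, List.length_replicate⟩
  refine (ofReal_regret_le_expectedCost R _ n).trans ?_
  obtain ⟨m, hm⟩ := Nat.exists_eq_add_of_le ((Nat.le_add_right _ _).trans (hlen x₀ hx₀))
  have hcost := expectedCost_length_add (μ := law ν f) (l := initPlays D n)
    (alg := t2c ν R F n est wt ucb) (fun π => ENNReal.ofReal (gap ν R f π))
    (fun x hx => t2c_of_length_lt hx) m
  rw [← hm] at hcost
  rw [hcost]
  have hinit : ((initPlays D n).map fun π => ENNReal.ofReal (gap ν R f π)).sum ≤
      (initPlays D n).length * ENNReal.ofReal Rmax := by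
    refine (List.sum_le_card_nsmul _ (ENNReal.ofReal Rmax) ?_).trans_eq (by simp)
    simpa using fun π _ => ENNReal.ofReal_le_ofReal (hF.gap_le hf π)
  refine add_le_add hinit (playLIntegral_le_add_mul_playProb ?_ fun x hx => ?_)
  · exact ENNReal.add_ne_top.2 ⟨by simp, ENNReal.add_ne_top.2 ⟨ucbBound_ne_top, by simp⟩⟩
  obtain ⟨r, rfl⟩ := Nat.exists_eq_add_of_le
    (Nat.le_of_add_le_add_left ((hlen x hx).trans_eq hm))
  have hr : r ≤ n := by omega
  by_cases hE : x ∈ E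
  · refine (expectedCost_after_init_le hF hf hn hucb hx (hest x hx) hr).trans
      (le_trans ?_ le_add_self)
    simp only [hE, Set.indicator_of_mem, Pi.one_apply, mul_one]
    gcongr
    exact hI x hx
  · obtain ⟨hbest, hA, hp⟩ := hgood x hE hx
    refine (expectedCost_after_init_le_of_best_eq hF hf hn hucb hx hbest hr).trans
      (le_trans ?_ le_self_add)
    gcongr

end TestToCommit

section Asymptotics

/-- The cap `b_n` as a function of `x = ln n`. -/
def logCap (x : ℝ) : ℝ := Real.log x ^ (1 / 4 : ℝ)

theorem cap_eq_logCap (n : ℕ) : cap n = logCap (Real.log n) := rfl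

theorem tendsto_log_natCast_atTop : Tendsto (fun n : ℕ => Real.log n) atTop atTop :=
  Real.tendsto_log_atTop.comp tendsto_natCast_atTop_atTop

theorem tendsto_logCap_atTop : Tendsto logCap atTop atTop :=
  (tendsto_rpow_atTop (by norm_num)).comp Real.tendsto_log_atTop

theorem tendsto_cap_atTop : Tendsto cap atTop atTop :=
  tendsto_logCap_atTop.comp tendsto_log_natCast_atTop

theorem decaysSlowly_inv_logCap : DecaysSlowly fun x => (logCap x)⁻¹ := by
  intro θ hθ
  filter_upwards [decaysSlowly_inv_log.rpow (by norm_num : (0 : ℝ) < 1 / 4) θ hθ,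
    eventually_gt_atTop 1] with x hx h1
  rwa [logCap, ← Real.inv_rpow (Real.log_pos h1).le]

theorem DecaysSlowly.eventually_le_rpow {α : ℝ → ℝ} (hα : DecaysSlowly fun x => 1 / α x)
    {θ : ℝ} (hθ : 0 < θ) : ∀ᶠ x in atTop, 0 < α x ∧ α x ≤ x ^ θ := by
  filter_upwards [hα θ hθ, hα.eventually_pos, eventually_gt_atTop 0] with x hx hpos h0
  have hα0 : 0 < α x := one_div_pos.1 hpos
  rw [Real.rpow_neg h0.le, one_div] at hx
  exact ⟨hα0, (inv_le_inv₀ (by positivity) hα0).1 hx⟩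

theorem DecaysSlowly.eventually_exp_le_inv {s : ℝ → ℝ} (hs : DecaysSlowly s) (c : ℝ) :
    ∀ᶠ x in atTop, Real.exp (c * √x + 2 - x * s x) ≤ x⁻¹ := by
  have hlog := (isLittleO_log_rpow_atTop (by norm_num : (0 : ℝ) < 3 / 4)).def
    (by norm_num : (0 : ℝ) < 1 / 4)
  filter_upwards [hs (1 / 4) (by norm_num), hlog, eventually_gt_atTop 1,
    (tendsto_rpow_atTop (by norm_num : (0 : ℝ) < 1 / 4)).eventually_ge_atTop (4 * c),
    (tendsto_rpow_atTop (by norm_num : (0 : ℝ) < 3 / 4)).eventually_ge_atTop 4]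
    with x hsx hlog hx hc h2
  have h0 : 0 < x := by linarith
  have hsqrt : 4 * (c * √x) ≤ x ^ (3 / 4 : ℝ) :=
    calc 4 * (c * √x) = 4 * c * √x := by ring
      _ ≤ x ^ (1 / 4 : ℝ) * √x := by gcongr
      _ = x ^ (3 / 4 : ℝ) := by rw [Real.sqrt_eq_rpow, ← Real.rpow_add h0]; norm_num
  have hmain : x ^ (3 / 4 : ℝ) ≤ x * s x :=
    calc x ^ (3 / 4 : ℝ) = x * x ^ (-(1 / 4) : ℝ) := by
          rw [← Real.rpow_one_add' h0.le (by norm_num)]; norm_num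
      _ ≤ x * s x := by gcongr
  rw [Real.norm_of_nonneg (by positivity : 0 ≤ x ^ (3 / 4 : ℝ))] at hlog
  rw [← Real.exp_log (inv_pos.2 h0), Real.log_inv, Real.exp_le_exp]
  linarith [Real.le_norm_self (Real.log x)]

theorem DecaysSlowly.eventually_mul_exp_le_one {lam α : ℝ → ℝ} (hlam : DecaysSlowly lam)
    (hα : DecaysSlowly fun x => 1 / α x) (C : ℝ) :
    ∀ᶠ x in atTop, C * x ^ 2 * Real.exp (lam x * (α x - √x)) ≤ 1 := by
  have hlim : Tendsto (fun x : ℝ => |C| * ((x ^ (1 / 4 : ℝ)) ^ 8 * Real.exp (-(x ^ (1 / 4 : ℝ)))))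
      atTop (𝓝 0) := by
    simpa using ((Real.tendsto_pow_mul_exp_neg_atTop_nhds_zero 8).comp
      (tendsto_rpow_atTop (by norm_num : (0 : ℝ) < 1 / 4))).const_mul |C|
  filter_upwards [hlam (1 / 8) (by norm_num), hα.eventually_le_rpow (θ := 3 / 8) (by norm_num),
    hlim.eventually_le_const one_pos, eventually_gt_atTop 0,
    (tendsto_rpow_atTop (by norm_num : (0 : ℝ) < 1 / 8)).eventually_ge_atTop 2]
    with x hlamx hαx hexp h0 h2
  have hlam0 : 0 ≤ lam x := le_trans (by positivity) hlamx
  have hpow : (x ^ (1 / 4 : ℝ)) ^ 8 = x ^ 2 := by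
    rw [← Real.rpow_natCast, ← Real.rpow_mul h0.le]; norm_num
  have hsqrt : √x = x ^ (3 / 8 : ℝ) * x ^ (1 / 8 : ℝ) := by
    rw [← Real.rpow_add h0, Real.sqrt_eq_rpow]; norm_num
  have hexponent : x ^ (1 / 4 : ℝ) ≤ lam x * (√x - α x) :=
    calc x ^ (1 / 4 : ℝ) = x ^ (-(1 / 8) : ℝ) * x ^ (3 / 8 : ℝ) := by
          rw [← Real.rpow_add h0]; norm_num
      _ ≤ lam x * (√x - α x) := by
          gcongr
          nlinarith [hαx.2, Real.rpow_pos_of_pos h0 (3 / 8)]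
  calc C * x ^ 2 * Real.exp (lam x * (α x - √x))
      ≤ |C| * x ^ 2 * Real.exp (-(x ^ (1 / 4 : ℝ))) := by
        gcongr
        · exact le_abs_self C
        · linarith
    _ ≤ 1 := by rw [← hpow, mul_assoc]; exact hexp

end Asymptotics

section ErrorProbability

variable {D O : Type*} [MeasurableSpace O] {ν : Measure O} {R : O → ℝ} {Rmax : ℝ}
  {F : Set (Inst D O)} {f : Inst D O}

theorem LogCovering.exists_eventually_le_exp (hcov : LogCovering ν F) : ∃ c : ℝ, ∀ᶠ x in atTop,
    coveringNumber F (Real.exp (-√x)) ≠ ⊤ ∧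
      ((coveringNumber F (Real.exp (-√x))).toNat : ℝ) ≤ Real.exp (c * √x) := by
  obtain ⟨⟨c, hc⟩, -⟩ := hcov
  have hlim : Tendsto (fun x => Real.exp (-√x)) atTop (𝓝[>] 0) :=
    tendsto_nhdsWithin_iff.2 ⟨Real.tendsto_exp_neg_atTop_nhds_zero.comp
      Real.tendsto_sqrt_atTop, .of_forall fun _ => Real.exp_pos _⟩
  refine ⟨c, ?_⟩
  filter_upwards [hlim.eventually hc] with x hx
  refine ⟨hx.1, (Real.le_exp_log _).trans (Real.exp_le_exp.2 (hx.2.trans_eq ?_))⟩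
  rw [one_div, ← Real.exp_neg, Real.log_exp, neg_neg]

/-- The large deviation bound with all its parameters chosen as functions of `x = ln n`: the
covering scale is `exp (-√x)`, and an information surplus `T - S` of order `x * s x`
dominates the log-covering number, which is of order `√x`. -/
theorem eventually_playProb_le_inv [Fintype D] (hF : IsDecisionProblem ν R Rmax F)
    (hRenyi : RenyiUniformConvergence ν F) (hcov : LogCovering ν F) (hf : f ∈ F)
    {ε α s : ℝ → ℝ} (hε : DecaysSlowly ε) (hα : DecaysSlowly fun x => 1 / α x)
    (hs : DecaysSlowly s) (C : ℝ) :
    ∀ᶠ x in atTop, ∀ (N : D → ℕ) (G : Set (Inst D O)) (S T : ℝ) (E : Set (List O)),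
      ∑ π, (N π : ℝ) ≤ C * x ^ 2 → G ⊆ F → x * s x ≤ T - S + 1 →
      (∀ g ∈ G, T ≤ ∑ π, N π * clip (ε x) (α x) (kl ν f g π)) →
      (∀ y ∈ E, y.length = (playList N).length → ∃ g ∈ G,
        Outweighs (ENNReal.ofReal (Real.exp S)) (fun p : D × O => f p.1 p.2)
          (fun p => g p.1 p.2) ((playList N).zip y)) →
      playProb (law ν f) (playList N) E ≤ ENNReal.ofReal x⁻¹ := by
  have : IsFiniteMeasure ν := ⟨hcov.2⟩
  obtain ⟨lam, hlam, haff⟩ := exists_decaysSlowly_affinityBound hF hRenyi hf hε hα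
  obtain ⟨c, hc⟩ := hcov.exists_eventually_le_exp
  filter_upwards [haff, hc, (hlam.mul hs).eventually_exp_le_inv c,
    hlam.eventually_mul_exp_le_one hα (C * (2 * (ν.real Set.univ + 1))),
    hα.eventually_le_rpow one_pos] with
    x ⟨h0, h1, haff⟩ ⟨hfin, hX⟩ hexp hpenalty hα0 N G S T E hN hG hST hT hE
  have hlength : ((playList N).length : ℝ) = ∑ π, (N π : ℝ) := by simp [length_playList]
  have hcover : (playList N).length * coverPenalty ν (lam x) (α x) √x ≤ 1 := by
    refine le_trans ?_ hpenalty
    rw [hlength, coverPenalty]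
    calc _ ≤ C * x ^ 2 *
          (2 * (ν.real Set.univ + 1) * Real.exp (lam x * (α x - √x))) := by gcongr
      _ = _ := by ring
  refine (playProb_le_of_outweighs hF hf hG haff h0 (by linarith) hα0.1.le hfin hX hT hE).trans ?_
  rw [ENNReal.ofReal_rpow_of_pos (Real.exp_pos _), ← ENNReal.ofReal_mul (by positivity),
    ← Real.exp_mul, ← Real.exp_add, ← Real.exp_add]
  refine ENNReal.ofReal_le_ofReal ((Real.exp_le_exp.2 ?_).trans hexp)
  nlinarith [mul_le_mul_of_nonneg_left hST h0.le]

end ErrorProbability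

section Estimation

variable {D O : Type*} [MeasurableSpace O] {ν : Measure O} {R : O → ℝ} {Rmax : ℝ}
  {F : Set (Inst D O)} {f : Inst D O}

/-- The instances of `F` whose divergence from `f` exceeds `δ` for some decision: the estimate of
the first phase must avoid them. -/
def Distant (ν : Measure O) (F : Set (Inst D O)) (f : Inst D O) (δ : ℝ) : Set (Inst D O) :=
  {g ∈ F | ∃ π, ENNReal.ofReal δ < kl ν f g π}

theorem exists_decaysSlowly_instDist_le (hctrl : DensityControl ν F f) {η : ℝ → ℝ}
    (hη : DecaysSlowly η) : ∃ δ : ℝ → ℝ, DecaysSlowly δ ∧ (∀ x, δ x ≤ 1) ∧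
      ∀ᶠ x in atTop, ∀ g ∈ F, g ∉ Distant ν F f (δ x) → instDist f g ≤ ENNReal.ofReal (η x) := by
  obtain ⟨-, ι, c₅, hι, hc₅, hdist⟩ := hctrl
  refine ⟨fun x => min 1 ((η x * ι⁻¹) ^ (1 / c₅)), (DecaysSlowly.const one_pos).min
    ((hη.mul (.const (inv_pos.2 hι))).rpow (by positivity)), fun x => min_le_left _ _, ?_⟩
  filter_upwards [hη.eventually_pos] with x hx g hg hgδ
  refine iSup_le fun π => ?_
  have hkl := le_of_not_gt fun h => hgδ ⟨hg, π, h⟩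
  calc densityDist (f π) (g π) ≤ ENNReal.ofReal ι * kl ν f g π ^ c₅ :=
        hdist g hg π (hkl.trans (by simp))
    _ ≤ ENNReal.ofReal ι * ENNReal.ofReal ((η x * ι⁻¹) ^ (1 / c₅)) ^ c₅ := by
        gcongr
        exact hkl.trans (ENNReal.ofReal_le_ofReal (min_le_right _ _))
    _ = ENNReal.ofReal (η x) := by
        rw [ENNReal.ofReal_rpow_of_nonneg (by positivity) hc₅.le, ← Real.rpow_mul (by positivity),
          one_div_mul_cancel hc₅.ne', Real.rpow_one, ← ENNReal.ofReal_mul hι.le]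
        congr 1
        field_simp

/-- The number of plays of every decision in the first phase, so that
`initPlays D n = playList fun _ => initCount n`. -/
def initCount (n : ℕ) : ℕ := ⌈Real.log n / Real.log (Real.log n)⌉₊

theorem isLittleO_initCount :
    (fun n => (initCount n : ℝ)) =o[atTop] fun n : ℕ => Real.log n := by
  have hdiv : (fun x => x / Real.log x) =o[atTop] fun x : ℝ => x := by
    simpa [div_eq_mul_inv] using (Asymptotics.isBigO_refl (fun x : ℝ => x) atTop).mul_isLittleO
      ((Asymptotics.isLittleO_one_iff ℝ).2 Real.tendsto_log_atTop.inv_tendsto_atTop)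
  have hceil : (fun x : ℝ => (⌈x / Real.log x⌉₊ : ℝ)) =o[atTop] fun x => x := by
    refine Asymptotics.IsBigO.trans_isLittleO (.of_bound' ?_)
      (hdiv.add (Asymptotics.isLittleO_const_id_atTop (1 : ℝ)))
    filter_upwards [eventually_ge_atTop 1] with x hx
    have hnonneg : 0 ≤ x / Real.log x := div_nonneg (by linarith) (Real.log_nonneg hx)
    rw [Real.norm_of_nonneg (by positivity), Real.norm_of_nonneg (by positivity)]
    exact (Nat.ceil_lt_add_one hnonneg).le
  exact hceil.comp_tendsto tendsto_log_natCast_atTop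

variable [Fintype D]

/-- The total information about a distant instance in the first phase is of order
`ln n / ln ln n` times `δ`, which dominates the log-covering number at the scale in use. -/
theorem eventually_playProb_distant_le (hF : IsDecisionProblem ν R Rmax F)
    (hRenyi : RenyiUniformConvergence ν F) (hcov : LogCovering ν F) (hf : f ∈ F) {δ : ℝ → ℝ}
    (hδ : DecaysSlowly δ) (hδ1 : ∀ x, δ x ≤ 1) :
    ∀ᶠ n : ℕ in atTop, ∀ (tol : ℝ) (est : List O → Inst D O), tol ≤ 1 → IsMLE F n tol est →
      playProb (law ν f) (initPlays D n) {x | est x ∈ Distant ν F f (δ (Real.log n))} ≤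
        ENNReal.ofReal (Real.log n)⁻¹ := by
  have hε : DecaysSlowly fun x => δ x * (1 / 2) := hδ.mul (.const (by norm_num))
  filter_upwards [tendsto_log_natCast_atTop.eventually (eventually_playProb_le_inv hF hRenyi hcov
      hf hε (α := fun _ => 1) (.const (by norm_num)) (decaysSlowly_inv_log.mul hε)
      (Fintype.card D)),
    tendsto_log_natCast_atTop.eventually hδ.eventually_pos,
    isLittleO_initCount.bound one_pos, tendsto_log_natCast_atTop.eventually_ge_atTop 1]
    with n hprob hδ0 hcount hlog tol est htol hest
  rw [Real.norm_of_nonneg (by positivity), Real.norm_of_nonneg (by positivity), one_mul] at hcount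
  refine hprob (fun _ => initCount n) (Distant ν F f (δ (Real.log n))) tol
    (initCount n * (δ (Real.log n) * (1 / 2))) _ ?_ (fun g hg => hg.1) ?_ ?_
    fun y hy hlen => ⟨est y, hy, outweighs_of_logLik_le (hest.maximal y hlen f hf)⟩
  · rw [Finset.sum_const, nsmul_eq_mul, Finset.card_univ]
    gcongr
    nlinarith
  · have hceil : Real.log n / Real.log (Real.log n) ≤ initCount n := Nat.le_ceil _
    calc _ = Real.log n / Real.log (Real.log n) * (δ (Real.log n) * (1 / 2)) := by ring
      _ ≤ initCount n * (δ (Real.log n) * (1 / 2)) := by gcongr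
      _ ≤ _ := by linarith
  · rintro g ⟨-, π, hπ⟩
    have hclip : δ (Real.log n) * (1 / 2) ≤ clip (δ (Real.log n) * (1 / 2)) 1 (kl ν f g π) :=
      le_clip (by positivity) (by positivity) (by linarith [hδ1 (Real.log n)])
        (by rw [← mul_add, add_halves, mul_one]; exact hπ.le)
    refine (mul_le_mul_of_nonneg_left hclip (by positivity)).trans ?_
    exact Finset.single_le_sum (f := fun π => (initCount n : ℝ) *
      clip (δ (Real.log n) * (1 / 2)) 1 (kl ν f g π))
      (fun π _ => mul_nonneg (by positivity) (clip_nonneg _ _ _)) (Finset.mem_univ π)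

end Estimation

section Rejection

theorem decaysSlowly_one_div_mul_logCap_sq {c : ℝ} (hc : 0 < c) :
    DecaysSlowly fun x => 1 / (c * logCap x ^ 2) := by
  convert (DecaysSlowly.const (inv_pos.2 hc)).mul
    (decaysSlowly_inv_logCap.mul decaysSlowly_inv_logCap) using 2 with x
  rw [one_div, mul_inv, sq, mul_inv]

/-- The relative accuracy of the estimated densities, as a function of `x = ln n`; the constant
is the one in `mem_separated_of_feasible`. -/
def relTol (D : Type*) [Fintype D] (x : ℝ) : ℝ := 1 / (64 * Fintype.card D * logCap x ^ 2)

theorem decaysSlowly_relTol (D : Type*) [Fintype D] [Nonempty D] : DecaysSlowly (relTol D) :=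
  decaysSlowly_one_div_mul_logCap_sq (by have := Fintype.card_pos (α := D); positivity)

theorem identBound_le (D : Type*) [Fintype D] {n : ℕ} (hcap : 2 ≤ cap n)
    (hlog : 1 ≤ Real.log n) :
    identBound D n ≤ 3 * Fintype.card D * (cap n * Real.log n) := by
  have hinv : 1 / cap n ≤ 1 := by rw [div_le_one (by linarith)]; linarith
  calc identBound D n ≤ Fintype.card D * ((cap n + 1 + 1) * Real.log n + 1) := by
        unfold identBound; gcongr
    _ ≤ Fintype.card D * (3 * (cap n * Real.log n)) := by gcongr; nlinarith
    _ = _ := by ring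

theorem eventually_identBound_le (D : Type*) [Fintype D] :
    ∀ᶠ n : ℕ in atTop, identBound D n ≤ 3 * Fintype.card D * Real.log n ^ 2 := by
  have hcap : DecaysSlowly fun x => 1 / logCap x := by
    simpa only [one_div] using decaysSlowly_inv_logCap
  filter_upwards [tendsto_cap_atTop.eventually_ge_atTop 2,
    tendsto_log_natCast_atTop.eventually_ge_atTop 1,
    tendsto_log_natCast_atTop.eventually (hcap.eventually_le_rpow one_pos)] with n h2 hlog hle
  rw [Real.rpow_one, ← cap_eq_logCap] at hle
  refine (identBound_le D h2 hlog).trans ?_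
  rw [sq]
  gcongr
  exact hle.2

variable {D O : Type*} [MeasurableSpace O] {ν : Measure O} {R : O → ℝ}
  {Rmax : ℝ} {F : Set (Inst D O)} {f₀ : Inst D O} {n : ℕ} {η cmin : ℝ}

theorem natCast_mul_ofReal_pow_le (hn : 1 ≤ n) (hη : 0 ≤ η) {k : ℕ} {B : ℝ} (hk : (k : ℝ) ≤ B) :
    (n : ℝ≥0∞) * ENNReal.ofReal (1 + 2 * η) ^ k ≤
      ENNReal.ofReal (Real.exp (Real.log n + 2 * η * B)) := by
  rw [← ENNReal.ofReal_pow (by positivity), ← ENNReal.ofReal_natCast,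
    ← ENNReal.ofReal_mul (by positivity), Real.exp_add, Real.exp_log (by exact_mod_cast hn)]
  gcongr
  calc (1 + 2 * η) ^ k ≤ Real.exp (2 * η) ^ k := by
        gcongr; linarith [Real.add_one_le_exp (2 * η)]
    _ = Real.exp (2 * η * k) := by rw [← Real.exp_nat_mul, mul_comm]
    _ ≤ _ := by gcongr

variable [Fintype D] [Nonempty D] {est : List O → Inst D O} {wt : List O → D → ℝ≥0} {x y : List O}

theorem exists_outweighs_of_mem_rejections (hF : IsDecisionProblem ν R Rmax F)
    (hRenyi : RenyiUniformConvergence ν F) (hf₀ : f₀ ∈ F) (hcmin : 0 < cmin)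
    (hmin : ∀ π o, f₀ π o ≠ 0 → cmin < f₀ π o) (hn : 1 ≤ n) (hcap : 1 ≤ cap n) (hη : 0 ≤ η)
    (hη1 : η ≤ 1 / 2) (hηcap : 64 * Fintype.card D * cap n ^ 2 * η ≤ 1) (hest : est x ∈ F)
    (hd : instDist f₀ (est x) ≤ ENNReal.ofReal (cmin * η))
    (hw : Feasible ν R F (est x) (cap n) (wt x)) (hy : y ∈ rejections ν R F n est wt x)
    (hlen : y.length = (identPlays n (wt x)).length) :
    ∃ g ∈ Separated ν F f₀ (cap n) (wt x),
      Outweighs (ENNReal.ofReal (Real.exp (Real.log n + 2 * η * identBound D n)))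
        (fun p : D × O => f₀ p.1 p.2) (fun p => g p.1 p.2) ((identPlays n (wt x)).zip y) := by
  simp only [rejections, Accepts, Set.mem_ofPred_eq, not_forall, exists_prop] at hy
  obtain ⟨g, hg, hne, hlt⟩ := hy
  rw [le_logLikRatio_iff hn, not_le] at hlt
  refine ⟨g, mem_separated_of_feasible hF hf₀ hest hη hcap hηcap
    (relClose_of_instDist_le hF hRenyi hf₀ hest hcmin hmin hη (by linarith) hd) hw hg hne,
    (outweighs_of_prod_div_le (a := ENNReal.ofReal (1 + 2 * η)) ?_ ?_ (by simp) (by simp)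
      (fun p hp => ?_) hlt.le).mono (natCast_mul_ofReal_pow_le hn hη ?_)⟩
  · exact (ENNReal.ofReal_pos.2 (by positivity)).ne'
  · exact_mod_cast (by omega : n ≠ 0)
  · exact coe_le_ofReal_mul_of_densityDist_le hcmin (hmin p.1) hη hη1
      ((densityDist_le_instDist _ _ _).trans hd) (by exact_mod_cast hp)
  · rw [List.length_zip, hlen, min_self]
    refine le_trans (le_of_eq ?_) (sum_identCount_le (by linarith) hw.2)
    rw [← Nat.cast_sum]
    exact congrArg _ (length_playList _)

theorem eventually_playProb_rejections_le (hF : IsDecisionProblem ν R Rmax F)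
    (hRenyi : RenyiUniformConvergence ν F) (hcov : LogCovering ν F) (hf₀ : f₀ ∈ F)
    (hcmin : 0 < cmin) (hmin : ∀ π o, f₀ π o ≠ 0 → cmin < f₀ π o) :
    ∀ᶠ n : ℕ in atTop, ∀ (est : List O → Inst D O) (wt : List O → D → ℝ≥0) (x : List O),
      est x ∈ F → instDist f₀ (est x) ≤ ENNReal.ofReal (cmin * relTol D (Real.log n)) →
      Feasible ν R F (est x) (cap n) (wt x) →
      playProb (law ν f₀) (identPlays n (wt x)) (rejections ν R F n est wt x) ≤
        ENNReal.ofReal (Real.log n)⁻¹ := by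
  have : (0 : ℝ) < Fintype.card D := by exact_mod_cast Fintype.card_pos
  filter_upwards [tendsto_log_natCast_atTop.eventually (eventually_playProb_le_inv hF hRenyi hcov
      hf₀ (decaysSlowly_one_div_mul_logCap_sq (c := 4 * Fintype.card D) (by positivity))
      (α := fun x => 2 * logCap x) (s := fun x => (logCap x)⁻¹ * (1 / 8))
      (by simpa [mul_comm] using decaysSlowly_inv_logCap.mul (.const (c := 1 / 2) (by norm_num)))
      (decaysSlowly_inv_logCap.mul (.const (by norm_num))) (3 * Fintype.card D)),
    eventually_identBound_le D, tendsto_cap_atTop.eventually_ge_atTop 2,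
    tendsto_log_natCast_atTop.eventually_ge_atTop 1, eventually_ge_atTop 1]
    with n hprob hbound hcap hlog hn est wt x hest hd hw
  set η := relTol D (Real.log n) with hη
  simp only [relTol, ← cap_eq_logCap] at hη hprob
  have hη0 : 0 ≤ η := by rw [hη]; positivity
  have hηcap : 64 * Fintype.card D * cap n ^ 2 * η = 1 := by rw [hη]; field_simp
  have hη1 : η ≤ 1 / 2 := by
    have : (1 : ℝ) ≤ Fintype.card D := by exact_mod_cast Fintype.card_pos
    have : 1 ≤ Fintype.card D * cap n ^ 2 := by nlinarith
    nlinarith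
  refine hprob (identCount n (wt x)) (Separated ν F f₀ (cap n) (wt x))
    (Real.log n + 2 * η * identBound D n) ((1 + 1 / (4 * cap n)) * Real.log n) _
    ((sum_identCount_le (by linarith) hw.2).trans hbound) (fun g hg => hg.1) ?_
    (fun g hg => le_sum_identCount_mul_clip hcap hw.2 hg)
    fun y hy hlen => exists_outweighs_of_mem_rejections hF hRenyi hf₀ hcmin hmin hn
      (by linarith) hη0 hη1 hηcap.le hest hd hw hy hlen
  have hloss : 2 * η * identBound D n ≤ 3 / 32 * (Real.log n * (cap n)⁻¹) :=
    calc 2 * η * identBound D n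
        ≤ 2 * η * (3 * Fintype.card D * (cap n * Real.log n)) := by
          gcongr; exact identBound_le D hcap hlog
      _ = _ := by rw [hη]; field_simp; norm_num
  have hsurplus : 1 / (4 * cap n) * Real.log n = 1 / 4 * (Real.log n * (cap n)⁻¹) := by
    field_simp
  have : 0 ≤ Real.log n * (cap n)⁻¹ := by positivity
  linarith

end Rejection

section Allocation

variable {D O : Type*} [Fintype D] [Nonempty D] [MeasurableSpace O] {ν : Measure O} {R : O → ℝ}
  {Rmax : ℝ} {F : Set (Inst D O)} {f₀ f : Inst D O} {cmin B : ℝ} {w : D → ℝ≥0}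

theorem exists_best_eq_of_instDist_le [IsFiniteMeasure ν] (hF : IsDecisionProblem ν R Rmax F)
    (hf₀ : f₀ ∈ F) : ∃ r > 0, ∀ f ∈ F, instDist f₀ f ≤ ENNReal.ofReal r →
      best ν R f = best ν R f₀ := by
  have hlim : Tendsto (fun r => 2 * (Rmax * ν.real Set.univ * r)) (𝓝[>] 0) (𝓝 0) := by
    have hcont : Continuous fun r => 2 * (Rmax * ν.real Set.univ * r) := by fun_prop
    simpa using (hcont.tendsto 0).mono_left nhdsWithin_le_nhds
  have hgap : ∀ᶠ r in 𝓝[>] 0, ∀ π, π ≠ best ν R f₀ →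
      2 * (Rmax * ν.real Set.univ * r) < gap ν R f₀ π :=
    eventually_all.2 fun π => eventually_imp_distrib_left.2 fun hπ =>
      hlim.eventually_lt_const (gap_pos_of_ne_best hF hf₀ hπ)
  obtain ⟨r, hr, hr0⟩ := (hgap.and self_mem_nhdsWithin).exists
  refine ⟨r, hr0, fun f hf hd => best_eq_of_meanReward_close hr fun π => ?_⟩
  exact abs_meanReward_sub_le hF hf₀ hf (hF.Rmax_nonneg hf₀) (le_of_lt hr0)
    ((densityDist_le_instDist f₀ f π).trans hd)

theorem tendsto_relTol (D : Type*) [Fintype D] :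
    Tendsto (fun n : ℕ => relTol D (Real.log n)) atTop (𝓝 0) := by
  have hinv := tendsto_cap_atTop.inv_tendsto_atTop
  convert (hinv.mul hinv).const_mul (64 * Fintype.card D : ℝ)⁻¹ using 2 with n
  · simp only [relTol, ← cap_eq_logCap, Pi.inv_apply, one_div, mul_inv, sq]
  · simp

theorem tendsto_relTol_mul_cap (D : Type*) [Fintype D] :
    Tendsto (fun n : ℕ => relTol D (Real.log n) * cap n) atTop (𝓝 0) := by
  have hlim := tendsto_cap_atTop.inv_tendsto_atTop.const_mul (64 * Fintype.card D : ℝ)⁻¹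
  rw [mul_zero] at hlim
  refine hlim.congr' ?_
  filter_upwards [tendsto_cap_atTop.eventually_gt_atTop 0] with n hn
  simp only [relTol, ← cap_eq_logCap, Pi.inv_apply, one_div, mul_inv]
  field_simp

theorem feasible_scaled_of_instDist_le (hF : IsDecisionProblem ν R Rmax F)
    (hRenyi : RenyiUniformConvergence ν F) (hf₀ : f₀ ∈ F) (hf : f ∈ F) (hcmin : 0 < cmin)
    (hmin : ∀ π o, f₀ π o ≠ 0 → cmin < f₀ π o) {n : ℕ}
    (hd : instDist f₀ f ≤ ENNReal.ofReal (cmin * relTol D (Real.log n)))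
    (hbest : best ν R f = best ν R f₀) (hw : Feasible ν R F f₀ B w)
    (hcap : 2 + 2 * ∑ π, (w π : ℝ) ≤ cap n) :
    Feasible ν R F f (cap n) fun π => (1 + (cap n)⁻¹.toNNReal) * w π := by
  have hcard : (1 : ℝ) ≤ Fintype.card D := by exact_mod_cast Fintype.card_pos
  have hW : 0 ≤ ∑ π, (w π : ℝ) := by positivity
  have hcap0 : 0 < cap n := by linarith
  have hinv : (cap n)⁻¹ ≤ 1 := inv_le_one_of_one_le₀ (by linarith)
  set η := relTol D (Real.log n) with hη
  rw [relTol, ← cap_eq_logCap] at hη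
  have hη0 : 0 ≤ η := by rw [hη]; positivity
  have hloss : η + 2 * η * ∑ π, (w π : ℝ) ≤ (cap n)⁻¹ / 2 :=
    calc η + 2 * η * ∑ π, (w π : ℝ) = η * (1 + 2 * ∑ π, (w π : ℝ)) := by ring
      _ ≤ η * (32 * Fintype.card D * cap n) := by gcongr; nlinarith
      _ = (cap n)⁻¹ / 2 := by rw [hη]; field_simp; norm_num
  have hθ : ((cap n)⁻¹.toNNReal : ℝ) = (cap n)⁻¹ := Real.coe_toNNReal _ (by positivity)
  refine .of_relClose hF hf₀ hf hη0 ?_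
    (relClose_of_instDist_le hF hRenyi hf₀ hf hcmin hmin hη0 ?_ hd) hbest hw ?_ fun π => ?_
  · nlinarith
  · nlinarith
  · rw [hθ]
    have : 0 < (cap n)⁻¹ := by positivity
    nlinarith
  · have hle : (w π : ℝ) ≤ ∑ π, (w π : ℝ) :=
      Finset.single_le_sum (f := fun π => (w π : ℝ)) (by simp) (Finset.mem_univ π)
    rw [hθ]
    nlinarith [(w π).coe_nonneg]

theorem eventually_feasible_and_sum_weights_gap_le [IsFiniteMeasure ν]
    (hF : IsDecisionProblem ν R Rmax F) (hRenyi : RenyiUniformConvergence ν F) (hf₀ : f₀ ∈ F)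
    (hcmin : 0 < cmin) (hmin : ∀ π o, f₀ π o ≠ 0 → cmin < f₀ π o) (hw : Feasible ν R F f₀ B w)
    {a : ℝ} (ha : ∑ π, (w π : ℝ) * gap ν R f₀ π < a) {tol : ℕ → ℝ} (htol : ∀ n, 0 ≤ tol n)
    (htol_lim : Tendsto tol atTop (𝓝 0)) :
    ∀ᶠ n : ℕ in atTop, ∀ (est : List O → Inst D O) (wt : List O → D → ℝ≥0) (x : List O),
      x.length = (initPlays D n).length → SolvesProgram ν R F n (tol n) est wt → est x ∈ F →
      instDist f₀ (est x) ≤ ENNReal.ofReal (cmin * relTol D (Real.log n)) →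
      best ν R (est x) = best ν R f₀ ∧ Feasible ν R F (est x) (cap n) (wt x) ∧
        ∑ π, (wt x π : ℝ) * gap ν R f₀ π ≤ a := by
  obtain ⟨r, hr, hbest⟩ := exists_best_eq_of_instDist_le hF hf₀
  let s (n : ℕ) : ℝ := Rmax * ν.real Set.univ * (cmin * relTol D (Real.log n))
  have hclose := (tendsto_relTol D).const_mul cmin
  have hs : Tendsto s atTop (𝓝 0) := by simpa [s] using hclose.const_mul (Rmax * ν.real Set.univ)
  have hscap : Tendsto (fun n => s n * cap n) atTop (𝓝 0) := by
    simpa [s, mul_assoc] using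
      ((tendsto_relTol_mul_cap D).const_mul cmin).const_mul (Rmax * ν.real Set.univ)
  have hlim : Tendsto (fun n => (1 + (cap n)⁻¹) *
      (∑ π, (w π : ℝ) * gap ν R f₀ π + 2 * s n * ∑ π, (w π : ℝ)) + tol n +
        2 * Fintype.card D * (s n * cap n)) atTop (𝓝 (∑ π, (w π : ℝ) * gap ν R f₀ π)) := by
    simpa using (((tendsto_cap_atTop.inv_tendsto_atTop.const_add 1).mul
      (((hs.const_mul 2).mul_const (∑ π, (w π : ℝ))).const_add _)).add htol_lim).add
        (hscap.const_mul (2 * Fintype.card D : ℝ))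
  rw [mul_zero] at hclose
  filter_upwards [hclose.eventually_le_const hr, hlim.eventually_le_const ha,
    tendsto_cap_atTop.eventually_ge_atTop (2 + 2 * ∑ π, (w π : ℝ))]
    with n hnr hna hcap est wt x hx hwt hest hd
  have hbest := hbest _ hest (hd.trans (ENNReal.ofReal_le_ofReal hnr))
  have hscaled := feasible_scaled_of_instDist_le hF hRenyi hf₀ hest hcmin hmin hd hbest hw hcap
  obtain ⟨hfeasible, hopt⟩ := hwt.optimal x hx ⟨_, hscaled⟩
  have hgap : ∀ π, |gap ν R (est x) π - gap ν R f₀ π| ≤ 2 * s n :=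
    abs_gap_sub_le hbest fun π => abs_meanReward_sub_le hF hf₀ hest (hF.Rmax_nonneg hf₀)
      (mul_nonneg hcmin.le (by unfold relTol; positivity))
      ((densityDist_le_instDist _ _ π).trans hd)
  have hcap0 : 0 ≤ cap n := le_trans (by positivity) hcap
  refine ⟨hbest, hfeasible, (sum_weights_gap_le hgap (inv_nonneg.2 hcap0) (htol n) hfeasible.2
    (hopt.trans ?_)).trans (hna.trans_eq' (by ring))⟩
  gcongr
  exact iInf₂_le _ hscaled

end Allocation

section Regret

theorem length_initPlays (D : Type*) [Fintype D] (n : ℕ) :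
    (initPlays D n).length = Fintype.card D * initCount n := by
  simp [initPlays, length_playList, initCount]

theorem eventually_mul_log_sq_le (C : ℝ) : ∀ᶠ n : ℕ in atTop, C * Real.log n ^ 2 ≤ n := by
  have hlim := ((Real.tendsto_pow_mul_exp_neg_atTop_nhds_zero 2).comp
    tendsto_log_natCast_atTop).const_mul C
  rw [mul_zero] at hlim
  filter_upwards [hlim.eventually_le_const one_pos, eventually_gt_atTop 0] with n hn h0
  have hpos : (0 : ℝ) < n := by exact_mod_cast h0
  rwa [Function.comp_apply, Real.exp_neg, Real.exp_log hpos, ← mul_assoc, ← div_eq_mul_inv,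
    div_le_one hpos] at hn

theorem eventually_length_add_length_le (D : Type*) [Fintype D] :
    ∀ᶠ n : ℕ in atTop, ∀ w : D → ℝ≥0, (∀ π, (w π : ℝ) ≤ cap n) →
      (initPlays D n).length + (identPlays n w).length ≤ n := by
  filter_upwards [eventually_mul_log_sq_le (4 * Fintype.card D), eventually_identBound_le D,
    isLittleO_initCount.bound one_pos, tendsto_log_natCast_atTop.eventually_ge_atTop 1,
    tendsto_cap_atTop.eventually_gt_atTop 0] with n hn hbound hcount hlog hcap w hw
  rw [Real.norm_of_nonneg (by positivity), Real.norm_of_nonneg (by positivity), one_mul] at hcount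
  have hident : ((identPlays n w).length : ℝ) ≤ 3 * Fintype.card D * Real.log n ^ 2 := by
    refine le_trans (le_of_eq ?_) ((sum_identCount_le hcap hw).trans hbound)
    rw [← Nat.cast_sum]
    exact congrArg _ (length_playList _)
  have hinit : ((initPlays D n).length : ℝ) ≤ Fintype.card D * Real.log n ^ 2 := by
    rw [length_initPlays, Nat.cast_mul]
    gcongr
    nlinarith
  exact_mod_cast (by linarith : ((initPlays D n).length + (identPlays n w).length : ℝ) ≤ n)

/-- An upper bound for the regret when `A` bounds the normalized cost of the weights of the second
phase, `C * ln n` bounds the regret of UCB, and the error events have probability at most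
`1 / ln n`. -/
def regretBound (D : Type*) [Fintype D] (Rmax A C : ℝ) (n : ℕ) : ℝ :=
  (initPlays D n).length * Rmax +
    ((1 + 1 / cap n) * Real.log n * A + Fintype.card D * Rmax * (1 / cap n * Real.log n + 1)) +
    (identBound D n * Rmax + 2 * (C * Real.log n) + Rmax) * (Real.log n)⁻¹

theorem tendsto_regretBound_div_log (D : Type*) [Fintype D] (Rmax A C : ℝ) :
    Tendsto (fun n => regretBound D Rmax A C n / Real.log n) atTop (𝓝 A) := by
  have hinit := isLittleO_initCount.tendsto_div_nhds_zero
  have hlog := tendsto_log_natCast_atTop.inv_tendsto_atTop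
  have hinv := tendsto_cap_atTop.inv_tendsto_atTop
  have hcap : Tendsto (fun n : ℕ => cap n / Real.log n) atTop (𝓝 0) := by
    simpa [Function.comp_def, cap] using ((isLittleO_log_rpow_rpow_atTop (1 / 4)
      one_pos).tendsto_div_nhds_zero).comp tendsto_log_natCast_atTop
  have hident := (((hcap.add hlog).add (hinv.mul hlog)).add
    (hlog.mul hlog)).const_mul (Fintype.card D * Rmax)
  have hlim := ((hinit.const_mul (Fintype.card D * Rmax)).add
    (((hinv.const_add 1).mul_const A).add ((hinv.add hlog).const_mul (Fintype.card D * Rmax)))).add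
      ((hident.add (hlog.const_mul (2 * C))).add ((hlog.mul hlog).const_mul Rmax))
  simp only [mul_zero, add_zero, zero_add, one_mul] at hlim
  refine hlim.congr' ?_
  filter_upwards [tendsto_log_natCast_atTop.eventually_gt_atTop 0] with n hn
  simp only [regretBound, identBound, length_initPlays, Nat.cast_mul, Pi.inv_apply]
  field_simp

variable {D O : Type*} [Fintype D] [Nonempty D] [MeasurableSpace O] {ν : Measure O} {R : O → ℝ}
  {Rmax : ℝ} {F : Set (Inst D O)} {f₀ : Inst D O}

theorem exists_eventually_ucbBound_le (ν : Measure O) (R : O → ℝ) (hR : 0 ≤ Rmax) (f : Inst D O) :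
    ∃ C ≥ 0, ∀ᶠ n : ℕ in atTop, ucbBound ν R Rmax f n ≤ ENNReal.ofReal (C * Real.log n) := by
  have hconst : ucbConst (law ν f) R Rmax (best ν R f) ≠ ⊤ := by simp [ucbConst]
  refine ⟨(ucbConst (law ν f) R Rmax (best ν R f)).toReal + 3 * Fintype.card D * Rmax,
    by positivity, ?_⟩
  filter_upwards [tendsto_log_natCast_atTop.eventually_ge_atTop 1] with n hn
  rw [add_mul, ENNReal.ofReal_add (by positivity) (by positivity),
    ENNReal.ofReal_mul ENNReal.toReal_nonneg, ENNReal.ofReal_toReal hconst, ucbBound]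
  gcongr
  calc 3 * Fintype.card D * ENNReal.ofReal Rmax = ENNReal.ofReal (3 * Fintype.card D * Rmax) := by
        rw [ENNReal.ofReal_mul (by positivity), ENNReal.ofReal_mul (by positivity)]
        simp
    _ ≤ _ := ENNReal.ofReal_le_ofReal (le_mul_of_one_le_right (by positivity) hn)

theorem regret_t2c_le_regretBound (hF : IsDecisionProblem ν R Rmax F) (hf₀ : f₀ ∈ F) {n : ℕ}
    (hn : 1 ≤ n) (hcap : 0 < cap n) (hlog : 0 < Real.log n) {A C tol : ℝ} (hA : 0 ≤ A) (hC : 0 ≤ C)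
    (hucbC : ucbBound ν R Rmax f₀ n ≤ ENNReal.ofReal (C * Real.log n)) {E : Set (List O)}
    {est : List O → Inst D O} {wt : List O → D → ℝ≥0} {ucb : List (D × O) → D}
    (hest : IsMLE F n tol est) (hwt : SolvesProgram ν R F n tol est wt) (hucb : IsUCB R Rmax n ucb)
    (hlen : ∀ w : D → ℝ≥0, (∀ π, (w π : ℝ) ≤ cap n) →
      (initPlays D n).length + (identPlays n w).length ≤ n)
    (hE : playProb (law ν f₀) (initPlays D n) E ≤ ENNReal.ofReal (Real.log n)⁻¹)
    (hgood : ∀ x ∉ E, x.length = (initPlays D n).length → best ν R (est x) = best ν R f₀ ∧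
      ∑ π, (wt x π : ℝ) * gap ν R f₀ π ≤ A ∧
      playProb (law ν f₀) (identPlays n (wt x)) (rejections ν R F n est wt x) ≤
        ENNReal.ofReal (Real.log n)⁻¹) :
    regret ν R f₀ (t2c ν R F n est wt ucb) n ≤ regretBound D Rmax A C n := by
  have hR := hF.Rmax_nonneg hf₀
  have hI : 0 ≤ identBound D n := by unfold identBound; positivity
  have key := ofReal_regret_t2c_le hF hf₀ hn hucb hest.mem
    (fun x hx => hlen _ (hwt.le_cap x hx))
    (fun x hx => sum_identCount_mul_gap_le_identBound hF hf₀ hcap (hwt.le_cap x hx))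
    fun x hx hxlen => (hgood x hx hxlen).imp_right
      (And.imp_left (sum_identCount_mul_gap_le hF hf₀ hcap))
  refine (ENNReal.ofReal_le_ofReal_iff (by unfold regretBound; positivity)).1 (key.trans ?_)
  rw [← ENNReal.ofReal_natCast (initPlays D n).length]
  grw [hE, hucbC]
  rw [← ENNReal.ofReal_add (by positivity) hR, ← ENNReal.ofReal_add (by positivity) (by positivity),
    ← ENNReal.ofReal_mul (by positivity), ← ENNReal.ofReal_mul (by positivity),
    ← ENNReal.ofReal_mul (by positivity), ← ENNReal.ofReal_add (by positivity) (by positivity),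
    ← ENNReal.ofReal_add (by positivity) (by positivity),
    ← ENNReal.ofReal_add (by positivity) (by positivity), regretBound]
  exact ENNReal.ofReal_le_ofReal (le_of_eq (by ring))

theorem eventually_regret_div_log_le (hF : IsDecisionProblem ν R Rmax F)
    (hRenyi : RenyiUniformConvergence ν F) (hcov : LogCovering ν F) (hf₀ : f₀ ∈ F)
    (hctrl : DensityControl ν F f₀) {tol : ℕ → ℝ} (htol : ∀ n, 0 ≤ tol n)
    (htol_lim : Tendsto tol atTop (𝓝 0)) {est : ℕ → List O → Inst D O}
    {wt : ℕ → List O → D → ℝ≥0} {ucb : ℕ → List (D × O) → D}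
    (hest : ∀ n, IsMLE F n (tol n) (est n))
    (hwt : ∀ n, SolvesProgram ν R F n (tol n) (est n) (wt n))
    (hucb : ∀ n, IsUCB R Rmax n (ucb n)) {B : ℝ} {w : D → ℝ≥0} (hw : Feasible ν R F f₀ B w)
    {a : ℝ} (ha : ∑ π, (w π : ℝ) * gap ν R f₀ π < a) :
    ∀ᶠ n : ℕ in atTop,
      regret ν R f₀ (t2c ν R F n (est n) (wt n) (ucb n)) n / Real.log n ≤ a := by
  have : IsFiniteMeasure ν := ⟨hcov.2⟩
  have ⟨⟨cmin, hcmin, hmin⟩, _⟩ := hctrl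
  obtain ⟨A, hA, hAa⟩ := exists_between ha
  have hA0 : 0 ≤ A := le_trans
    (Finset.sum_nonneg fun π _ => mul_nonneg (w π).coe_nonneg (gap_nonneg _ _ _ _)) hA.le
  obtain ⟨C, hC, hucbC⟩ := exists_eventually_ucbBound_le ν R (hF.Rmax_nonneg hf₀) f₀
  obtain ⟨δ, hδ, hδ1, hclose⟩ := exists_decaysSlowly_instDist_le hctrl
    ((DecaysSlowly.const hcmin).mul (decaysSlowly_relTol D))
  filter_upwards [hucbC, tendsto_log_natCast_atTop.eventually hclose, eventually_ge_atTop 1,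
    eventually_playProb_distant_le hF hRenyi hcov hf₀ hδ hδ1,
    eventually_playProb_rejections_le hF hRenyi hcov hf₀ hcmin hmin,
    eventually_feasible_and_sum_weights_gap_le hF hRenyi hf₀ hcmin hmin hw hA htol htol_lim,
    eventually_length_add_length_le D, htol_lim.eventually_le_const one_pos,
    tendsto_log_natCast_atTop.eventually_gt_atTop 0, tendsto_cap_atTop.eventually_gt_atTop 0,
    (tendsto_regretBound_div_log D Rmax A C).eventually_le_const hAa]
    with n hucbC hclose hn hdistant hrej hident hlen htol1 hlog hcap hbound
  refine le_trans ?_ hbound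
  gcongr
  refine regret_t2c_le_regretBound hF hf₀ hn hcap hlog hA0 hC hucbC (hest n) (hwt n) (hucb n) hlen
    (hdistant (tol n) (est n) htol1 (hest n)) fun x hx hxlen => ?_
  have hmem := (hest n).mem x hxlen
  have hd := hclose _ hmem hx
  obtain ⟨hbest, hfeasible, hcost⟩ := hident _ _ x hxlen (hwt n) hmem hd
  exact ⟨hbest, hcost, hrej _ _ x hmem hd hfeasible⟩

theorem exists_feasible_of_complexity_lt {a : ℝ} (ha : complexity ν R F f₀ < ENNReal.ofReal a) :
    ∃ (B : ℝ) (w : D → ℝ≥0), Feasible ν R F f₀ B w ∧ ∑ π, (w π : ℝ) * gap ν R f₀ π < a := by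
  obtain ⟨k, hk⟩ := ((tendsto_complexity ν R F f₀).eventually_lt_const ha).exists
  simp only [complexityAt, iInf_lt_iff, cost_eq_ofReal] at hk
  obtain ⟨w, hw, hcost⟩ := hk
  exact ⟨k, w, hw, (ENNReal.ofReal_lt_ofReal_iff_of_nonneg (Finset.sum_nonneg fun π _ =>
    mul_nonneg (w π).coe_nonneg (gap_nonneg _ _ _ _))).1 hcost⟩

end Regret

end T2C

end

theorem mainTheorem3 {D O : Type*} [Fintype D] [Nonempty D] [MeasurableSpace O]
    (ν : MeasureTheory.Measure O) (R : O → ℝ) (Rmax : ℝ) (F : Set (T2C.Inst D O))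
    (hF : T2C.IsDecisionProblem ν R Rmax F)
    (h₁ : T2C.RenyiUniformConvergence ν F)
    (h₂ : T2C.LogCovering ν F)
    (fstar : T2C.Inst D O) (hfstar : fstar ∈ F)
    (h₃ : T2C.DensityControl ν F fstar)
    (tol : ℕ → ℝ) (htol : ∀ n, 0 ≤ tol n)
    (htol_lim : Filter.Tendsto tol Filter.atTop (nhds 0))
    (est : ℕ → List O → T2C.Inst D O) (wt : ℕ → List O → D → NNReal)
    (ucb : ℕ → List (D × O) → D)
    (hest : ∀ n, T2C.IsMLE F n (tol n) (est n))
    (hwt : ∀ n, T2C.SolvesProgram ν R F n (tol n) (est n) (wt n))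
    (hucb : ∀ n, T2C.IsUCB R Rmax n (ucb n)) :
    Filter.limsup (fun n : ℕ =>
        ((T2C.regret ν R fstar (T2C.t2c ν R F n (est n) (wt n) (ucb n)) n /
          Real.log n : ℝ) : EReal)) Filter.atTop ≤
      ((T2C.complexity ν R F fstar : ENNReal) : EReal) := by
  refine le_of_forall_gt_imp_ge_of_dense fun a ha => ?_
  rcases eq_or_ne a ⊤ with rfl | hatop
  · exact le_top
  have ha0 : 0 < a := (EReal.coe_ennreal_nonneg _).trans_lt ha
  lift a to ℝ using ⟨hatop, (EReal.bot_lt_zero.trans ha0).ne'⟩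
  have hlt : T2C.complexity ν R F fstar < ENNReal.ofReal a := by
    rwa [← EReal.coe_ennreal_lt_coe_ennreal_iff, EReal.coe_ennreal_ofReal,
      max_eq_left (EReal.coe_pos.1 ha0).le]
  obtain ⟨B, w, hw, hcost⟩ := T2C.exists_feasible_of_complexity_lt hlt
  refine limsup_le_of_le (by isBoundedDefault) ?_
  filter_upwards [T2C.eventually_regret_div_log_le hF h₁ h₂ hfstar h₃ htol htol_lim hest hwt hucb
    hw hcost] with n hn
  exact_mod_cast hn
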